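/- **Setting.** There are $K$ arms with means $\mu_1,\dots,\mu_K\in\mathbb R$. Playing arm $a_t$ in round $t$ yields $y_t=\mu_{a_t}+\epsilon_t$, where the $\epsilon_t$ are i.i.d. $N(0,\sigma^2)$ with known $\sigma>0$. The set of change points of an environment $v=(\mu_i)$ is $\underline x^*_v=\{j\in[K-1]:\mu_j\ne\mu_{j+1}\}$, and $V_{K,m}$ is the set of environments with exactly $m$ change points, any two of which differ by at least $2$. Let $\Delta_{(1)}\ge\dots\ge\Delta_{(m)}>0$ be the magnitudes $|\mu_j-\mu_{j+1}|$, $j\in\underline x^*_v$, in decreasing order (with multiplicity). A policy consists of a sampling rule, a stopping rule with stopping time $\tau$, and a recommendation rule returning a set $\hat{\underline x}_\tau$; each depends only on the actions and rewards observed so far. A policy is *Exact-$(N,\delta)$* if for every $v\in V_{K,N}$: $\mathbb P_v(\hat{\underline x}_\tau=\underline x^*_v)>1-\delta$ and $\mathbb P_v(\tau<\infty)=1$. It is *Any-$(N,\delta)$* if for every $m\ge N$ and $v\in V_{K,m}$: $|\hat{\underline x}_\tau|=N$ almost surely, $\mathbb P_v(\hat{\underline x}_\tau\subseteq\underline x^*_v)>1-\delta$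 and $\mathbb P_v(\tau<\infty)=1$. **The policy MCPI** (inputs $K,\sigma,N\ge1,\delta\in(0,1)$). After $t$ rounds let $T_a(t)$ be the number of plays of arm $a$, $\hat\mu_a(t)$ its empirical mean reward, $\hat\Delta_a(t)=|\hat\mu_a(t)-\hat\mu_{a+1}(t)|$, and for $S\subseteq[K-1]$ let $\hat x_t(S)\in\operatorname{argmax}_{a\in S}\hat\Delta_a(t)$. With $\gamma=2e^39^6/\log 3$ put $$\beta(t,\delta)=\log\frac{t\gamma(K-1)}{\delta}+8\log\log\frac{t\gamma(K-1)}{\delta},\qquad r(t)=\sqrt{\frac{4\log t+2\log(2\log t)+1/2}{(t^{1/4}-K)_+}},$$ with $r(t)=+\infty$ if $t^{1/4}\le K$, and $$Z(t)=\frac{T_{\hat x_t}(t)\,T_{\hat x_t+1}(t)}{2\sigma^2\,(T_{\hat x_t}(t)+T_{\hat x_t+1}(t))}\,\hat\Delta_{\hat x_t}(t)^2 .$$ Start with $S=[K-1]$ and play each arm once. Then, after each number $t\ge K$ of rounds: 1. If there are $i,j\in[K-1]$ with $\hat\Delta_i(t)>\hat\Delta_j(t)+\sigma r(t)$, or if there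 is no estimate yet, set $\hat x_t=\hat x_t(S)$; otherwise keep $\hat x_t=\hat x_{t-1}$. 2. While fewer than $N$ change points have been recorded and $Z(t)\ge\beta(t,\delta/N)$: record $\hat x_t$, remove it from $S$, and start the next phase with $\hat x_t=\hat x_t(S)$ for the new $S$. If $N$ change points have been recorded, stop ($\tau_\delta=t$) and return the set of recorded points. 3. If $\min_i T_i(t)<\sqrt t$, play an arm in $\operatorname{argmin}_{i\in[K]}T_i(t)$; otherwise play an arm in $\operatorname{argmin}_{i\in\{\hat x_t,\hat x_t+1\}}T_i(t)$. Ties in each argmax and argmin are broken by an arbitrary fixed deterministic rule, depending on the round and on the set of tied elements. **Theorem.** Let $N\ge1$ and $\sigma>0$. For every $\delta\in(0,1)$, MCPI with inputs $N,\delta$ is both an Exact-$(N,\delta)$ and an Any-$(N,\delta)$ policy. Moreover, for every $m\ge N$ and every $v\in V_{K,m}$, its stopping time $\tau_\delta$ satisfies $$\limsup_{\delta\to0^+}\frac{\mathbb E_v[\tau_\delta]}{\log(1/\delta)}\le 8\sigma^2\sum_{i=1}^N\frac1{\Delta_{(i)}^2}.$$ -/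

import Mathlib

open MeasureTheory ProbabilityTheory Filter Topology
open scoped ENNReal

namespace PiecewiseBandit

/-! ### Environments

Arms are labelled `1, …, K`. An environment is given by its vector of mean rewards `μ 1, …, μ K`
(the values of `μ` at other labels are never used). -/

/-- The set of change points `{j ∈ [K-1] : μ_j ≠ μ_{j+1}}`. -/
noncomputable def changePoints (K : ℕ) (μ : ℕ → ℝ) : Finset ℕ :=
  (Finset.Icc 1 (K - 1)).filter fun j => μ j ≠ μ (j + 1)

/-- The class `V_{K,m}`: exactly `m` change points, any two of them separated by at least
one arm. -/
def Env (K m : ℕ) : Set (ℕ → ℝ) :=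
  {μ | (changePoints K μ).card = m ∧
    ∀ i ∈ changePoints K μ, ∀ j ∈ changePoints K μ, i < j → i + 1 < j}

/-- The magnitudes `|μ_j - μ_{j+1}|` of all the changes (with multiplicity), in decreasing order. -/
noncomputable def sortedChanges (K : ℕ) (μ : ℕ → ℝ) : List ℝ :=
  ((changePoints K μ).val.map fun j => |μ j - μ (j + 1)|).sort (· ≥ ·)

/-- `Δ_{(i)}`: the `i`-th largest magnitude of a change, `i = 1, 2, …`. -/
noncomputable def orderedChange (K : ℕ) (μ : ℕ → ℝ) (i : ℕ) : ℝ :=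
  (sortedChanges K μ).getD (i - 1) 0

/-! ### Policies and their interaction with an environment -/

/-- A history: the pairs (action, reward) of the rounds played so far, the most recent one first. -/
abbrev History : Type := List (ℕ × ℝ)

/-- A policy: a sampling rule, a stopping rule and a recommendation rule, each a function of the
actions and rewards observed so far. -/
structure Policy where
  /-- the action to play next -/
  sample : History → ℕ
  /-- whether to stop -/
  shouldStop : History → Prop
  /-- the set of change points that is returned -/
  recommend : History → Finset ℕ

/-- The law of the noise: i.i.d. centred Gaussian variables of variance `σ ^ 2`. -/
noncomputable def noise (σ : ℝ) : Measure (ℕ → ℝ) :=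
  Measure.infinitePi fun _ => gaussianReal 0 (Real.toNNReal (σ ^ 2))

namespace Policy

/-- The history after `t` rounds: playing action `a` yields the reward `μ a` plus fresh noise. -/
noncomputable def history (π : Policy) (μ : ℕ → ℝ) (ε : ℕ → ℝ) : ℕ → History
  | 0 => []
  | t + 1 =>
    let h := history π μ ε t
    (π.sample h, μ (π.sample h) + ε t) :: h

/-- The stopping time `τ`: the first number of rounds after which the policy stops, `⊤` if it
never does. -/
noncomputable def stoppingTime (π : Policy) (μ : ℕ → ℝ) (ε : ℕ → ℝ) : ℕ∞ :=
  ⨅ t ∈ {t : ℕ | π.shouldStop (π.history μ ε t)}, (t : ℕ∞)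

/-- The returned set of change points (relevant only if `τ < ∞`). -/
noncomputable def output (π : Policy) (μ : ℕ → ℝ) (ε : ℕ → ℝ) : Finset ℕ :=
  π.recommend (π.history μ ε (π.stoppingTime μ ε).toNat)

/-- The expected sample complexity `E[τ]`, with values in `[0, ∞]`. -/
noncomputable def expectedTime (π : Policy) (σ : ℝ) (μ : ℕ → ℝ) : ℝ≥0∞ :=
  ∫⁻ ε, (π.stoppingTime μ ε : ℝ≥0∞) ∂(noise σ)

/-- Exact-`(N,δ)` policies. -/
def IsExact (π : Policy) (K : ℕ) (σ : ℝ) (N : ℕ) (δ : ℝ) : Prop :=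
  ∀ μ ∈ Env K N,
    1 - δ < (noise σ).real {ε | π.output μ ε = changePoints K μ} ∧
    ∀ᵐ ε ∂(noise σ), π.stoppingTime μ ε < ⊤

/-- Any-`(N,δ)` policies. -/
def IsAny (π : Policy) (K : ℕ) (σ : ℝ) (N : ℕ) (δ : ℝ) : Prop :=
  ∀ m, N ≤ m → ∀ μ ∈ Env K m,
    (∀ᵐ ε ∂(noise σ), (π.output μ ε).card = N) ∧
    1 - δ < (noise σ).real {ε | π.output μ ε ⊆ changePoints K μ} ∧
    ∀ᵐ ε ∂(noise σ), π.stoppingTime μ ε < ⊤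

end Policy

/-! ### Empirical quantities -/

/-- `T_a(t)`: the number of plays of the action `a`. -/
def plays (h : History) (a : ℕ) : ℕ := (h.map Prod.fst).count a

/-- `μ̂_a(t)`: the empirical mean of the rewards of the action `a`. -/
noncomputable def empMean (h : History) (a : ℕ) : ℝ :=
  (h.map fun p => if p.1 = a then p.2 else 0).sum / plays h a

/-- `|μ̂_a(t) - μ̂_{a+1}(t)|`: the empirical change at `a`. -/
noncomputable def empChange (h : History) (a : ℕ) : ℝ := |empMean h a - empMean h (a + 1)|

/-- The statistic `Z(t)` at the estimate `a`, for noise of variance `σ ^ 2`. -/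
noncomputable def statZ (σ : ℝ) (h : History) (a : ℕ) : ℝ :=
  (plays h a * plays h (a + 1) : ℝ) / (2 * σ ^ 2 * (plays h a + plays h (a + 1)))
    * empChange h a ^ 2

/-- The constant `γ = 2 e³ 9⁶ / log 3`. -/
noncomputable def gammaConst : ℝ := 2 * Real.exp 3 * 9 ^ 6 / Real.log 3

/-- The threshold `β(t, δ)`. -/
noncomputable def threshold (K t : ℕ) (δ : ℝ) : ℝ :=
  Real.log (t * gammaConst * (K - 1) / δ)
    + 8 * Real.log (Real.log (t * gammaConst * (K - 1) / δ))

/-- The radius `r(t)`, for `t ^ (1/4) > K`; it is `+∞` for the other `t`. -/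
noncomputable def radius (K t : ℕ) : ℝ :=
  Real.sqrt ((4 * Real.log t + 2 * Real.log (2 * Real.log t) + 1 / 2)
    / ((t : ℝ) ^ (1 / 4 : ℝ) - K))

/-- The condition for an update of the estimated change point: some empirical change exceeds
another one by more than `σ r(t)`. It fails where `r(t) = +∞`. -/
def UpdateCond (K : ℕ) (σ : ℝ) (h : History) : Prop :=
  (K : ℝ) < (h.length : ℝ) ^ (1 / 4 : ℝ) ∧
    ∃ i ∈ Finset.Icc 1 (K - 1), ∃ j ∈ Finset.Icc 1 (K - 1),
      empChange h j + σ * radius K h.length < empChange h i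

/-! ### The MCPI policy

Ties in an `argmax` or an `argmin` are broken by an arbitrary rule `tie`, which chooses an element
of the tied set and may depend on the round. -/

/-- `argmin_{i ∈ A} T_i(t)`. -/
noncomputable def leastPlayed (tie : ℕ → Finset ℕ → ℕ) (h : History) (A : Finset ℕ) : ℕ :=
  tie h.length (A.filter fun i => ∀ j ∈ A, plays h i ≤ plays h j)

/-- The estimator `x̂_t(S) = argmax_{a ∈ S} |μ̂_a(t) - μ̂_{a+1}(t)|`. -/
noncomputable def largestChange (tie : ℕ → Finset ℕ → ℕ) (h : History) (S : Finset ℕ) : ℕ :=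
  tie h.length (S.filter fun a => ∀ b ∈ S, empChange h b ≤ empChange h a)

/-- The variables of MCPI. -/
structure MCPIState where
  /-- the set `S` of potential change points -/
  cand : Finset ℕ
  /-- the change points identified so far, one for each completed phase -/
  found : Finset ℕ
  /-- the current estimate `x̂_t` (the label `0` stands for "none yet") -/
  est : ℕ

/-- The end of a phase: if fewer than `N` phases are completed and `Z(t) ≥ β(t, δ/N)`, then the
estimate `x̂_t` is recorded and removed from `S`, and the next phase starts with `x̂_t(S)`. -/
noncomputable def closePhase (K N : ℕ) (σ : ℝ) (tie : ℕ → Finset ℕ → ℕ) (δ : ℝ) (h : History)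
    (s : MCPIState) : MCPIState :=
  open Classical in
  if s.found.card < N ∧ threshold K h.length (δ / N) ≤ statZ σ h s.est then
    { cand := s.cand.erase s.est
      found := insert s.est s.found
      est := largestChange tie h (s.cand.erase s.est) }
  else s

/-- The update of the estimate: `x̂_t = x̂_t(S)` if the update condition holds (or if there is no
estimate in `S` yet), and `x̂_t = x̂_{t-1}` otherwise. -/
noncomputable def updateEst (K : ℕ) (σ : ℝ) (tie : ℕ → Finset ℕ → ℕ) (h : History)
    (s : MCPIState) : MCPIState :=
  open Classical in
  if UpdateCond K σ h ∨ s.est ∉ s.cand then { s with est := largestChange tie h s.cand } else s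

/-- The variables of MCPI after the rounds of the history. Nothing happens before each action has
been played once; afterwards, in each round the estimate is updated and then all the phases whose
stopping condition is met are closed, one after the other. -/
noncomputable def mcpiState (K N : ℕ) (σ : ℝ) (tie : ℕ → Finset ℕ → ℕ) (δ : ℝ) :
    History → MCPIState
  | [] => { cand := Finset.Icc 1 (K - 1), found := ∅, est := 0 }
  | p :: h =>
    if K ≤ (p :: h).length then
      (closePhase K N σ tie δ (p :: h))^[N]
        (updateEst K σ tie (p :: h) (mcpiState K N σ tie δ h))
    else mcpiState K N σ tie δ h

/-- The sampling rule of MCPI: each action once, then forced exploration if some action has been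
played fewer than `√t` times, and otherwise the less played of `x̂_t` and `x̂_t + 1`. -/
noncomputable def mcpiSample (K N : ℕ) (σ : ℝ) (tie : ℕ → Finset ℕ → ℕ) (δ : ℝ)
    (h : History) : ℕ :=
  open Classical in
  if h.length < K then h.length + 1
  else if ∃ i ∈ Finset.Icc 1 K, (plays h i : ℝ) < Real.sqrt h.length then
    leastPlayed tie h (Finset.Icc 1 K)
  else
    leastPlayed tie h
      {(mcpiState K N σ tie δ h).est, (mcpiState K N σ tie δ h).est + 1}

/-- Multiple Change Point Identification (MCPI) for `K` actions, noise variance `σ ^ 2`, `N`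
changes to look for and confidence `δ`; it stops as soon as `N` phases are completed. -/
noncomputable def mcpi (K N : ℕ) (σ : ℝ) (tie : ℕ → Finset ℕ → ℕ) (δ : ℝ) : Policy where
  sample := mcpiSample K N σ tie δ
  shouldStop h := (mcpiState K N σ tie δ h).found.card = N
  recommend h := (mcpiState K N σ tie δ h).found

end PiecewiseBandit

namespace PiecewiseBandit

/-! ### Resampling one coordinate of a product measure -/

section Resample

variable {ι : Type*} [DecidableEq ι] {E : Type*} [MeasurableSpace E]

/-! Correctness is a mixture-martingale argument. At a position `a` with `μ a = μ (a + 1)`, the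
statistic Z is at most the sum of the self-normalized squares of the noise sums of the two arms
(`statZ_le`). Averaging the exponential martingales of each noise sum over a Gaussian prior gives an
explicit martingale (`lintegral_gaussMixture`), and the product over the two arms is a martingale
under any sampling rule. With prior parameter A = log(γ(K-1)N/δ), crossing the threshold β forces
this product above exp A (`le_log_gaussMixture`): the terms log t and 8 log log pay for the two
normalizations. Ville's inequality and a union bound over at most K-1 positions give error at most
δ/(γN) < δ.

For the sample complexity the noise is read off a stack X(a,i), the noise of the i-th play of arm a;
the sequence read this way is again i.i.d. (`map_stackNoise`). Good events then concern random walks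
that depend neither on the policy nor on δ. Let u be the integer part of T^{1/8}. Forced exploration
gives every arm u plays after O(u²) rounds at a total cost O(√T), so with high probability all
empirical means are accurate from then on. The update condition then always holds, and the estimate
is a largest remaining change. An estimate with change Δ whose phase is still open satisfies Z < β,
which limits its rounds to about 8σ²β/Δ². Summing over all change points gives a crude bound
O(log(1/δ)), off events of summable probability.

The sharp constant needs only N terms, and the obstacle is a tie at Δ_(N): effort could be split
among more tied positions than will be recorded. With high probability each walk makes an adverse
excursion, a dip, between u⁵ and u⁶ plays, which lowers the empirical change by σ/u³, whereas after
u⁷ plays the means are accurate to σ/(2u³). Of two unrecorded tied positions that have both dipped,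
at least one stays low forever (`low_invariant`): a low position is played only if it is the
estimate, and then its rival is low as well. Hence they cannot both pass u⁷ plays
(`not_both_heavy`), and all but N of the relevant positions cost o(T) rounds (`rounds_le_sharp`).

The sharp event has probability tending to one without a rate; on its complement the crude bound
keeps the expectation at o(log(1/δ)). -/

theorem measurable_update_pair (i : ι) :
    Measurable fun p : (ι → E) × E => Function.update p.1 i p.2 := by
  refine measurable_pi_iff.2 fun j => ?_
  by_cases h : j = i
  · subst h
    simpa using measurable_snd
  · simp only [Function.update_of_ne h]
    exact (measurable_pi_apply j).comp measurable_fst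

/-- On a box both sides are the same finite product, the fresh variable supplying the `i`-th factor.
Integrating out one fresh coordinate is the substitute for conditional expectations in the maximal
inequality and in the stack coupling. -/
theorem map_update_infinitePi (μ : ι → Measure E) [∀ i, IsProbabilityMeasure (μ i)] (i : ι) :
    ((Measure.infinitePi μ).prod (μ i)).map (fun p => Function.update p.1 i p.2)
      = Measure.infinitePi μ := by
  refine Measure.eq_infinitePi _ fun s t ht => ?_
  rw [Measure.map_apply (measurable_update_pair i) (.pi s.countable_toSet fun j _ => ht j)]
  by_cases hi : i ∈ s
  · have : (fun p : (ι → E) × E => Function.update p.1 i p.2) ⁻¹' (Set.pi s t)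
        = (Set.pi (s.erase i : Finset ι) t) ×ˢ t i := by
      ext p
      simp only [Set.mem_preimage, Set.mem_pi, Set.mem_prod, Finset.coe_erase, Set.mem_sdiff,
        Finset.mem_coe, Set.mem_singleton_iff]
      constructor
      · intro h
        refine ⟨fun j hj => ?_, by simpa using h i hi⟩
        simpa [Function.update_of_ne hj.2] using h j hj.1
      · rintro ⟨h1, h2⟩ j hj
        by_cases hji : j = i
        · subst hji; simpa using h2
        · simpa [Function.update_of_ne hji] using h1 j ⟨hj, hji⟩
    rw [this, Measure.prod_prod, Measure.infinitePi_pi _ fun j _ => ht j,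
      Finset.prod_erase_mul _ _ hi]
  · have : (fun p : (ι → E) × E => Function.update p.1 i p.2) ⁻¹' (Set.pi s t)
        = (Set.pi s t) ×ˢ Set.univ := by
      ext p
      simp only [Set.mem_preimage, Set.mem_pi, Set.mem_prod, Finset.mem_coe, Set.mem_univ, and_true]
      refine forall₂_congr fun j hj => ?_
      rw [Function.update_of_ne (by rintro rfl; exact hi hj)]
    rw [this, Measure.prod_prod, Measure.infinitePi_pi _ fun j _ => ht j]
    simp

theorem lintegral_update_infinitePi (μ : ι → Measure E) [∀ i, IsProbabilityMeasure (μ i)] (i : ι)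
    {f : (ι → E) → ℝ≥0∞} (hf : Measurable f) :
    ∫⁻ x, f x ∂(Measure.infinitePi μ)
      = ∫⁻ x, ∫⁻ y, f (Function.update x i y) ∂(μ i) ∂(Measure.infinitePi μ) := by
  conv_lhs => rw [← map_update_infinitePi μ i]
  rw [lintegral_map hf (measurable_update_pair i),
    lintegral_prod (fun p : (ι → E) × E => f (Function.update p.1 i p.2))
      (hf.comp (measurable_update_pair i)).aemeasurable]

/-- An event which does not depend on a coordinate is independent of this coordinate. -/
theorem infinitePi_inter_of_update_invariant (μ : ι → Measure E) [∀ i, IsProbabilityMeasure (μ i)]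
    (i : ι) {A : Set (ι → E)} (hA : MeasurableSet A) {B : Set E} (hB : MeasurableSet B)
    (hinv : ∀ x y, Function.update x i y ∈ A ↔ x ∈ A) :
    Measure.infinitePi μ (A ∩ {x | x i ∈ B}) = Measure.infinitePi μ A * μ i B := by
  have hm : MeasurableSet (A ∩ {x | x i ∈ B}) := hA.inter (measurable_pi_apply i hB)
  conv_lhs => rw [← map_update_infinitePi μ i]
  rw [Measure.map_apply (measurable_update_pair i) hm, ← Measure.prod_prod]
  congr 1
  ext p
  simp [hinv]

end Resample

/-! ### Runs of a policy -/

section Runs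

theorem plays_nil (a : ℕ) : plays [] a = 0 := rfl

theorem plays_cons (p : ℕ × ℝ) (h : History) (a : ℕ) :
    plays (p :: h) a = plays h a + if p.1 = a then 1 else 0 := by
  simp [plays, List.count_cons]

/-- The sum of the rewards of an action. -/
noncomputable def rewardSum (h : History) (a : ℕ) : ℝ :=
  (h.map fun p => if p.1 = a then p.2 else 0).sum

theorem rewardSum_cons (p : ℕ × ℝ) (h : History) (a : ℕ) :
    rewardSum (p :: h) a = rewardSum h a + if p.1 = a then p.2 else 0 := by
  simp [rewardSum, add_comm]

theorem empMean_eq (h : History) (a : ℕ) : empMean h a = rewardSum h a / plays h a := rfl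

/-- The state consists of two finite sets and a number, so the discrete σ-algebra is compatible with
countable case distinctions. Histories themselves carry no σ-algebra here; only counts and reward
sums are tracked. -/
instance : MeasurableSpace MCPIState := ⊤

instance : MeasurableSingletonClass MCPIState := ⟨fun _ => trivial⟩

instance : Countable MCPIState :=
  Function.Injective.countable (f := fun s : MCPIState => (s.cand, s.found, s.est))
    (by rintro ⟨a, b, c⟩ ⟨a', b', c'⟩ h; simpa using h)

variable {Ω : Type*} [MeasurableSpace Ω]

/-- A random history for which the counts and the sums of rewards are random variables. -/
structure MeasHistory (H : Ω → History) : Prop where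
  length_const : ∀ ω ω', (H ω).length = (H ω').length
  plays : ∀ a, Measurable fun ω => plays (H ω) a
  rewardSum : ∀ a, Measurable fun ω => rewardSum (H ω) a

/-- Every decision of MCPI takes countably many values, so measurability need only be checked with
the decision frozen. -/
theorem measurable_comp_countable {S T : Type*} [MeasurableSpace S] [MeasurableSingletonClass S]
    [Countable S] [MeasurableSpace T] {f : Ω → S} (hf : Measurable f) {F : Ω → S → T}
    (hF : ∀ s, Measurable fun ω => F ω s) : Measurable fun ω => F ω (f ω) := by
  have : Measurable fun p : Ω × S => F p.1 p.2 := measurable_from_prod_countable_left hF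
  exact this.comp (measurable_id.prodMk hf)

/-- The filtered set is determined by finitely many bits, and any function of finitely many bits is
measurable. This makes an arbitrary tie-breaking rule harmless. -/
theorem measurable_filter {A : Finset ℕ} {P : Ω → ℕ → Prop} (hP : ∀ a, MeasurableSet {ω | P ω a})
    (g : Finset ℕ → ℕ) [∀ ω, DecidablePred (P ω)] : Measurable fun ω => g (A.filter (P ω)) := by
  have : Measurable fun ω => (fun a : A => decide (P ω a)) := by
    refine measurable_pi_iff.2 fun a => ?_
    refine measurable_to_bool ?_
    have : (fun ω => decide (P ω a)) ⁻¹' {true} = {ω | P ω a} := by ext; simp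
    rw [this]
    exact hP a
  have hg : Measurable fun b : A → Bool => g 
      ((A.attach.filter fun a => b a = true).map ⟨Subtype.val, Subtype.val_injective⟩) :=
    measurable_of_countable _
  convert hg.comp this using 2 with ω
  simp only [Function.comp]
  congr 1
  ext a
  simp [and_comm]

namespace MeasHistory

variable {H : Ω → History}

theorem empMean (hH : MeasHistory H) (a : ℕ) : Measurable fun ω => empMean (H ω) a := by
  have : Measurable fun ω => ((PiecewiseBandit.plays (H ω) a : ℕ) : ℝ) :=
    (measurable_from_top (f := fun n : ℕ => (n : ℝ))).comp (hH.plays a)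
  exact (hH.rewardSum a).div this

theorem empChange (hH : MeasHistory H) (a : ℕ) : Measurable fun ω => empChange (H ω) a := by
  have := ((hH.empMean a).sub (hH.empMean (a + 1)))
  exact this.abs

theorem statZ (hH : MeasHistory H) (σ : ℝ) (a : ℕ) : Measurable fun ω => statZ σ (H ω) a := by
  have h1 : ∀ a, Measurable fun ω => ((PiecewiseBandit.plays (H ω) a : ℕ) : ℝ) := fun a =>
    (measurable_from_top (f := fun n : ℕ => (n : ℝ))).comp (hH.plays a)
  exact (((h1 a).mul (h1 (a + 1))).div (measurable_const.mul ((h1 a).add (h1 (a + 1))))).mul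
    ((hH.empChange a).pow_const 2)

theorem largestChange (hH : MeasHistory H) (tie : ℕ → Finset ℕ → ℕ) (S : Finset ℕ) :
    Measurable fun ω => largestChange tie (H ω) S := by
  classical
  rcases isEmpty_or_nonempty Ω with hΩ | ⟨⟨ω₀⟩⟩
  · exact measurable_of_empty _
  simp only [PiecewiseBandit.largestChange]
  have : ∀ ω, (H ω).length = (H ω₀).length := fun ω => hH.length_const ω ω₀
  simp only [this]
  refine measurable_filter (P := fun ω a => ∀ b ∈ S, PiecewiseBandit.empChange (H ω) b ≤ PiecewiseBandit.empChange (H ω) a)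
    (fun a => ?_) (tie (H ω₀).length)
  have : {ω | ∀ b ∈ S, PiecewiseBandit.empChange (H ω) b ≤ PiecewiseBandit.empChange (H ω) a}
      = ⋂ b ∈ S, {ω | PiecewiseBandit.empChange (H ω) b ≤ PiecewiseBandit.empChange (H ω) a} := by
    ext; simp
  rw [this]
  exact Finset.measurableSet_biInter _ fun b _ => measurableSet_le (hH.empChange b) (hH.empChange a)

theorem leastPlayed (hH : MeasHistory H) (tie : ℕ → Finset ℕ → ℕ) (S : Finset ℕ) :
    Measurable fun ω => leastPlayed tie (H ω) S := by
  classical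
  rcases isEmpty_or_nonempty Ω with hΩ | ⟨⟨ω₀⟩⟩
  · exact measurable_of_empty _
  simp only [PiecewiseBandit.leastPlayed]
  have : ∀ ω, (H ω).length = (H ω₀).length := fun ω => hH.length_const ω ω₀
  simp only [this]
  refine measurable_filter (P := fun ω a => ∀ b ∈ S, PiecewiseBandit.plays (H ω) a ≤ PiecewiseBandit.plays (H ω) b)
    (fun a => ?_) (tie (H ω₀).length)
  have : {ω | ∀ b ∈ S, PiecewiseBandit.plays (H ω) a ≤ PiecewiseBandit.plays (H ω) b}
      = ⋂ b ∈ S, {ω | PiecewiseBandit.plays (H ω) a ≤ PiecewiseBandit.plays (H ω) b} := by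
    ext; simp
  rw [this]
  exact Finset.measurableSet_biInter _ fun b _ => measurableSet_le (hH.plays a) (hH.plays b)

theorem updateCond (hH : MeasHistory H) (K : ℕ) (σ : ℝ) :
    MeasurableSet {ω | UpdateCond K σ (H ω)} := by
  rcases isEmpty_or_nonempty Ω with hΩ | ⟨⟨ω₀⟩⟩
  · convert MeasurableSet.empty
    exact Set.eq_empty_of_isEmpty _
  have : ∀ ω, (H ω).length = (H ω₀).length := fun ω => hH.length_const ω ω₀
  simp only [UpdateCond, this]
  refine (MeasurableSet.const _).inter ?_
  have : {ω | ∃ i ∈ Finset.Icc 1 (K - 1), ∃ j ∈ Finset.Icc 1 (K - 1),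
      PiecewiseBandit.empChange (H ω) j + σ * radius K (H ω₀).length < PiecewiseBandit.empChange (H ω) i}
      = ⋃ i ∈ Finset.Icc 1 (K - 1), ⋃ j ∈ Finset.Icc 1 (K - 1),
        {ω | PiecewiseBandit.empChange (H ω) j + σ * radius K (H ω₀).length < PiecewiseBandit.empChange (H ω) i} := by
    ext; simp only [Set.mem_ofPred_eq, Set.mem_iUnion, exists_prop]
  change MeasurableSet {ω | ∃ i ∈ Finset.Icc 1 (K - 1), ∃ j ∈ Finset.Icc 1 (K - 1),
      PiecewiseBandit.empChange (H ω) j + σ * radius K (H ω₀).length < PiecewiseBandit.empChange (H ω) i}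
  rw [this]
  exact Finset.measurableSet_biUnion _ fun i _ => Finset.measurableSet_biUnion _ fun j _ =>
    measurableSet_lt ((hH.empChange j).add_const _) (hH.empChange i)

theorem mk_state {c f : Finset ℕ} {e : Ω → ℕ} (he : Measurable e) :
    Measurable fun ω => (⟨c, f, e ω⟩ : MCPIState) :=
  (measurable_from_top (f := fun n : ℕ => (⟨c, f, n⟩ : MCPIState))).comp he

theorem closePhase (hH : MeasHistory H) (K N : ℕ) (σ : ℝ) (tie : ℕ → Finset ℕ → ℕ) (δ : ℝ)
    {s : Ω → MCPIState} (hs : Measurable s) :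
    Measurable fun ω => closePhase K N σ tie δ (H ω) (s ω) := by
  classical
  rcases isEmpty_or_nonempty Ω with hΩ | ⟨⟨ω₀⟩⟩
  · exact measurable_of_empty _
  refine measurable_comp_countable hs fun s => ?_
  have : ∀ ω, (H ω).length = (H ω₀).length := fun ω => hH.length_const ω ω₀
  simp only [PiecewiseBandit.closePhase, this]
  refine Measurable.ite ?_ (mk_state (hH.largestChange tie _)) measurable_const
  exact (MeasurableSet.const _).inter (measurableSet_le measurable_const (hH.statZ σ _))

theorem closePhase_iterate (hH : MeasHistory H) (K N : ℕ) (σ : ℝ) (tie : ℕ → Finset ℕ → ℕ) (δ : ℝ)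
    (n : ℕ) {s : Ω → MCPIState} (hs : Measurable s) :
    Measurable fun ω => (PiecewiseBandit.closePhase K N σ tie δ (H ω))^[n] (s ω) := by
  induction n generalizing s with
  | zero => exact hs
  | succ n ih =>
    simp only [Function.iterate_succ, Function.comp]
    exact ih (hH.closePhase K N σ tie δ hs)

theorem updateEst (hH : MeasHistory H) (K : ℕ) (σ : ℝ) (tie : ℕ → Finset ℕ → ℕ)
    {s : Ω → MCPIState} (hs : Measurable s) :
    Measurable fun ω => updateEst K σ tie (H ω) (s ω) := by
  classical
  refine measurable_comp_countable hs fun s => ?_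
  simp only [PiecewiseBandit.updateEst]
  refine Measurable.ite ?_ (mk_state (hH.largestChange tie _)) measurable_const
  exact (hH.updateCond K σ).union (MeasurableSet.const _)

theorem mcpiSample (hH : MeasHistory H) (K N : ℕ) (σ : ℝ) (tie : ℕ → Finset ℕ → ℕ) (δ : ℝ)
    (hs : Measurable fun ω => mcpiState K N σ tie δ (H ω)) :
    Measurable fun ω => mcpiSample K N σ tie δ (H ω) := by
  classical
  rcases isEmpty_or_nonempty Ω with hΩ | ⟨⟨ω₀⟩⟩
  · exact measurable_of_empty _
  have : ∀ ω, (H ω).length = (H ω₀).length := fun ω => hH.length_const ω ω₀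
  simp only [PiecewiseBandit.mcpiSample, this]
  refine Measurable.ite (MeasurableSet.const _) measurable_const (Measurable.ite ?_
    (hH.leastPlayed tie _) ?_)
  · have : {ω | ∃ i ∈ Finset.Icc 1 K, (PiecewiseBandit.plays (H ω) i : ℝ) < √((H ω₀).length : ℝ)}
        = ⋃ i ∈ Finset.Icc 1 K, {ω | (PiecewiseBandit.plays (H ω) i : ℝ) < √((H ω₀).length : ℝ)} := by
      ext; simp
    rw [this]
    refine Finset.measurableSet_biUnion _ fun i _ => measurableSet_lt ?_ measurable_const
    exact (measurable_from_top (f := fun n : ℕ => (n : ℝ))).comp (hH.plays i)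
  · exact measurable_comp_countable
      (F := fun ω (s : MCPIState) => PiecewiseBandit.leastPlayed tie (H ω) {s.est, s.est + 1}) hs
      fun s => hH.leastPlayed tie _

theorem mcpiState_cons {a : Ω → ℕ} {r : Ω → ℝ} (K N : ℕ) (σ : ℝ) (tie : ℕ → Finset ℕ → ℕ) (δ : ℝ)
    (hH' : MeasHistory fun ω => (a ω, r ω) :: H ω)
    (hs : Measurable fun ω => mcpiState K N σ tie δ (H ω)) :
    Measurable fun ω => mcpiState K N σ tie δ ((a ω, r ω) :: H ω) := by
  classical
  rcases isEmpty_or_nonempty Ω with hΩ | ⟨⟨ω₀⟩⟩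
  · exact measurable_of_empty _
  simp only [mcpiState]
  have : ∀ ω, ((a ω, r ω) :: H ω).length = ((a ω₀, r ω₀) :: H ω₀).length :=
    fun ω => hH'.length_const ω ω₀
  simp only [this]
  split_ifs
  · exact hH'.closePhase_iterate K N σ tie δ N (hH'.updateEst K σ tie hs)
  · exact hs

theorem cons {a : Ω → ℕ} {r : Ω → ℝ} (hH : MeasHistory H) (ha : Measurable a) (hr : Measurable r) :
    MeasHistory fun ω => (a ω, r ω) :: H ω where
  length_const ω ω' := by simpa using hH.length_const ω ω'
  plays b := by
    simp only [plays_cons]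
    exact (hH.plays b).add (Measurable.ite (ha (measurableSet_singleton b)) measurable_const
      measurable_const)
  rewardSum b := by
    simp only [rewardSum_cons]
    exact (hH.rewardSum b).add (Measurable.ite (ha (measurableSet_singleton b)) hr
      measurable_const)

end MeasHistory

/-- The histories of MCPI are measurable if the noise is. -/
theorem measHistory_of_run (K N : ℕ) (σ : ℝ) (tie : ℕ → Finset ℕ → ℕ) (δ : ℝ) (μ : ℕ → ℝ)
    {H : ℕ → Ω → History} {e : ℕ → Ω → ℝ} (h0 : ∀ ω, H 0 ω = [])
    (hstep : ∀ t ω, H (t + 1) ω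
      = (mcpiSample K N σ tie δ (H t ω), μ (mcpiSample K N σ tie δ (H t ω)) + e t ω) :: H t ω)
    (he : ∀ t, MeasHistory (H t) → (Measurable fun ω => mcpiSample K N σ tie δ (H t ω)) →
      Measurable (e t)) (t : ℕ) :
    MeasHistory (H t) ∧ (Measurable fun ω => mcpiState K N σ tie δ (H t ω)) ∧
      (Measurable fun ω => mcpiSample K N σ tie δ (H t ω)) ∧ Measurable (e t) := by
  suffices h : MeasHistory (H t) ∧ (Measurable fun ω => mcpiState K N σ tie δ (H t ω)) from
    have hs := h.1.mcpiSample K N σ tie δ h.2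
    ⟨h.1, h.2, hs, he t h.1 hs⟩
  induction t with
  | zero =>
    have : H 0 = fun _ => [] := funext h0
    rw [this]
    exact ⟨⟨fun _ _ => rfl, fun _ => measurable_const, fun _ => measurable_const⟩,
      measurable_const⟩
  | succ t ih =>
    have hs := ih.1.mcpiSample K N σ tie δ ih.2
    have hr := ((measurable_from_top (f := μ)).comp hs).add (he t ih.1 hs)
    have hH := ih.1.cons hs hr
    have : H (t + 1) = fun ω => (mcpiSample K N σ tie δ (H t ω),
      μ (mcpiSample K N σ tie δ (H t ω)) + e t ω) :: H t ω := funext (hstep t)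
    rw [this]
    exact ⟨hH, MeasHistory.mcpiState_cons K N σ tie δ hH ih.2⟩

end Runs

/-! ### A maximal inequality for products -/

/-- Ville's inequality for a nonnegative supermartingale on a product space. -/
theorem ville_infinitePi (γ : Measure ℝ) [IsProbabilityMeasure γ] {M : ℕ → (ℕ → ℝ) → ℝ≥0∞}
    (hM : ∀ t, Measurable (M t)) (h0 : ∀ ε, M 0 ε ≤ 1)
    (hinv : ∀ t s ε y, t ≤ s → M t (Function.update ε s y) = M t ε)
    (hstep : ∀ t ε, ∫⁻ y, M (t + 1) (Function.update ε t y) ∂γ ≤ M t ε)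
    {x : ℝ≥0∞} (hx0 : x ≠ 0) (hx : x ≠ ⊤) :
    Measure.infinitePi (fun _ : ℕ => γ) {ε | ∃ t, x ≤ M t ε} ≤ x⁻¹ := by
  classical
  set P := Measure.infinitePi (fun _ : ℕ => γ)
  let A : ℕ → Set (ℕ → ℝ) := fun t => {ε | ∃ s ≤ t, x ≤ M s ε}
  have hA : ∀ t, MeasurableSet (A t) := fun t => by
    have : A t = ⋃ s, ⋃ (_ : s ≤ t), {ε | x ≤ M s ε} := by ext; simp [A]
    rw [this]
    exact .iUnion fun s => .iUnion fun _ => measurableSet_le measurable_const (hM s)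
  -- The process frozen at the value `x` from its first crossing on: its integral stays at most 1,
  -- and it equals `x` on `A t`.
  let W : ℕ → (ℕ → ℝ) → ℝ≥0∞ := fun t ε => if ε ∈ A t then x else M t ε
  have hW : ∀ t, Measurable (W t) := fun t => Measurable.ite (hA t) measurable_const (hM t)
  have hWint : ∀ t, ∫⁻ ε, W t ε ∂P ≤ 1 := by
    intro t
    induction t with
    | zero =>
      have : ∀ ε, W 0 ε ≤ 1 := fun ε => by
        simp only [W, A]
        split_ifs with h
        · obtain ⟨s, hs, h⟩ := h
          obtain rfl : s = 0 := by simpa using hs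
          exact h.trans (h0 ε)
        · exact h0 ε
      calc _ ≤ ∫⁻ _, 1 ∂P := lintegral_mono this
        _ = 1 := by simp
    | succ t ih =>
      refine le_trans ?_ ih
      rw [lintegral_update_infinitePi (fun _ => γ) t (hW (t + 1))]
      refine lintegral_mono fun ε => ?_
      by_cases h : ε ∈ A t
      · have h1 : ∀ y, Function.update ε t y ∈ A (t + 1) := fun y => by
          obtain ⟨s, hs, h⟩ := h
          exact ⟨s, hs.trans (Nat.le_succ t), by rwa [hinv s t ε y hs]⟩
        simp [W, h1, h]
      · have h1 : ∀ y, W (t + 1) (Function.update ε t y) ≤ M (t + 1) (Function.update ε t y) := by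
          intro y
          simp only [W]
          split_ifs with h2
          · obtain ⟨s, hs, h2⟩ := h2
            rcases Nat.lt_or_ge t s with h3 | h3
            · obtain rfl : s = t + 1 := by omega
              exact h2
            · exact absurd ⟨s, h3, by rwa [hinv s t ε y h3] at h2⟩ h
          · exact le_rfl
        calc _ ≤ ∫⁻ y, M (t + 1) (Function.update ε t y) ∂γ := lintegral_mono h1
          _ ≤ _ := by simpa [W, h] using hstep t ε
  have hbound : ∀ t, P (A t) ≤ x⁻¹ := fun t => by
    have h1 := mul_meas_ge_le_lintegral (μ := P) (hW t) x
    have h2 : P (A t) ≤ P {ε | x ≤ W t ε} := measure_mono fun ε h => by simp [W, h]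
    rw [← one_div, ENNReal.le_div_iff_mul_le (.inl hx0) (.inl hx), mul_comm]
    exact (by gcongr : x * P (A t) ≤ _).trans (h1.trans (hWint t))
  have hmono : Monotone A := fun s t hst ε ⟨r, hr, h⟩ => ⟨r, hr.trans hst, h⟩
  have : {ε | ∃ t, x ≤ M t ε} = ⋃ t, A t := by
    ext ε
    simp only [Set.mem_ofPred_eq, Set.mem_iUnion, A]
    exact ⟨fun ⟨t, h⟩ => ⟨t, t, le_rfl, h⟩, fun ⟨_, s, _, h⟩ => ⟨s, h⟩⟩
  rw [this, hmono.measure_iUnion]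
  exact iSup_le hbound

/-! ### Gaussian mixtures -/

/-- The mixture of the exponential martingales of a Gaussian random walk. -/
noncomputable def gaussMixture (c v : ℝ) (n : ℕ) (s : ℝ) : ℝ :=
  (√(1 + c * n))⁻¹ * Real.exp (c * s ^ 2 / (2 * v * (1 + c * n)))

theorem gaussMixture_nonneg (c v : ℝ) (n : ℕ) (s : ℝ) : 0 ≤ gaussMixture c v n s := by
  unfold gaussMixture; positivity

theorem gaussMixture_zero (c v : ℝ) : gaussMixture c v 0 0 = 1 := by simp [gaussMixture]

theorem measurable_gaussMixture (c v : ℝ) (n : ℕ) : Measurable (gaussMixture c v n) := by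
  unfold gaussMixture; fun_prop

/-- `gaussMixture c v n s` is the average of exp(λs - λ²vn/2) over λ distributed as N(0, c/v), hence
a martingale. In closed form, completing the square turns the noise density times the new value into
the old value times the density of a Gaussian with mean cs/d and variance vd'/d. -/
theorem lintegral_gaussMixture {c : ℝ} (hc : 0 ≤ c) {v : NNReal} (hv : v ≠ 0) (n : ℕ) (s : ℝ) :
    ∫⁻ y, ENNReal.ofReal (gaussMixture c v (n + 1) (s + y)) ∂(gaussianReal 0 v)
      = ENNReal.ofReal (gaussMixture c v n s) := by
  have hv0 : (0 : ℝ) < v := by positivity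
  set d : ℝ := 1 + c * n with hd
  set d' : ℝ := 1 + c * (n + 1) with hd'
  have hd0 : 0 < d := by positivity
  have hd0' : 0 < d' := by positivity
  let w : NNReal := ⟨v * d' / d, by positivity⟩
  have hw : (w : ℝ) = v * d' / d := rfl
  have hw0 : w ≠ 0 := by
    have : (0 : ℝ) < w := by rw [hw]; positivity
    exact_mod_cast this.ne'
  have key : ∀ y, gaussianPDFReal 0 v y * gaussMixture c v (n + 1) (s + y)
      = gaussMixture c v n s * gaussianPDFReal (c * s / d) w y := by
    intro y
    simp only [gaussianPDFReal, gaussMixture, hw]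
    push_cast
    rw [← hd, ← hd']
    have e1 : (√(2 * Real.pi * (v * d' / d)))⁻¹ = (√(2 * Real.pi * v))⁻¹ * (√d')⁻¹ * √d := by
      rw [show 2 * Real.pi * (v * d' / d) = 2 * Real.pi * v * d' / d by ring,
        Real.sqrt_div (by positivity), Real.sqrt_mul (by positivity)]
      field_simp
    rw [e1]
    have e2 : Real.exp (-(y - 0) ^ 2 / (2 * v)) * Real.exp (c * (s + y) ^ 2 / (2 * v * d'))
        = Real.exp (c * s ^ 2 / (2 * v * d)) * Real.exp (-(y - c * s / d) ^ 2 / (2 * (v * d' / d))) := by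
      rw [← Real.exp_add, ← Real.exp_add]
      congr 1
      have : d' = d + c := by rw [hd, hd']; ring
      rw [this] at hd0' ⊢
      field_simp
      ring
    have e3 : (√d)⁻¹ * √d = 1 := inv_mul_cancel₀ (by positivity)
    calc _ = (√(2 * Real.pi * v))⁻¹ * (√d')⁻¹ * (Real.exp (-(y - 0) ^ 2 / (2 * v)) * Real.exp (c * (s + y) ^ 2 / (2 * v * d'))) := by ring
      _ = ((√d)⁻¹ * √d) * ((√(2 * Real.pi * v))⁻¹ * (√d')⁻¹ * (Real.exp (c * s ^ 2 / (2 * v * d)) * Real.exp (-(y - c * s / d) ^ 2 / (2 * (v * d' / d))))) := by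
        rw [e2, e3, one_mul]
      _ = _ := by ring
  rw [gaussianReal_of_var_ne_zero 0 hv, lintegral_withDensity_eq_lintegral_mul _
    (measurable_gaussianPDF 0 v) (g := fun y => ENNReal.ofReal (gaussMixture c v (n + 1) (s + y)))
    ((measurable_gaussMixture c v (n + 1)).comp (measurable_const_add s)).ennreal_ofReal]
  have : ∀ y, (gaussianPDF 0 v * fun y => ENNReal.ofReal (gaussMixture c v (n + 1) (s + y))) y
      = ENNReal.ofReal (gaussMixture c v n s) * ENNReal.ofReal (gaussianPDFReal (c * s / d) w y) := by
    intro y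
    rw [Pi.mul_apply, gaussianPDF, ← ENNReal.ofReal_mul (gaussianPDFReal_nonneg _ _ _), key,
      ENNReal.ofReal_mul (gaussMixture_nonneg _ _ _ _)]
  simp only [this]
  rw [lintegral_const_mul _ (measurable_gaussianPDFReal _ _).ennreal_ofReal,
    lintegral_gaussianPDFReal_eq_one _ hw0, mul_one]

/-- The threshold exceeds the logarithm of the normalization of a mixture. -/
theorem le_log_gaussMixture {A t x₁ x₂ : ℝ} {n k : ℕ} (hA : 15 ≤ A) (hn : 1 ≤ n) (hk : 1 ≤ k)
    (hnk : (n + k : ℝ) ≤ t) (hx₁ : 0 ≤ x₁) (hx₂ : 0 ≤ x₂)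
    (hx : Real.log t + A + 8 * Real.log (Real.log t + A) ≤ x₁ + x₂) :
    A ≤ (x₁ * (A * n / (1 + A * n)) - Real.log (1 + A * n) / 2)
      + (x₂ * (A * k / (1 + A * k)) - Real.log (1 + A * k) / 2) := by
  -- The smaller count has the smaller factor 1 - 1/q, which can then be used for both terms.
  wlog hle : n ≤ k generalizing n k x₁ x₂
  · rw [add_comm]
    exact this hk hn (by linarith) hx₂ hx₁ (by linarith) (by omega)
  have hn1 : (1 : ℝ) ≤ n := by exact_mod_cast hn
  have hle' : (n : ℝ) ≤ k := by exact_mod_cast hle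
  have hlogt : 0 ≤ Real.log t := Real.log_nonneg (by linarith)
  set ℓ := Real.log t + A with hℓ
  have hℓ15 : 15 ≤ ℓ := by linarith
  have hlogℓ : 1 ≤ Real.log ℓ := by
    rw [Real.le_log_iff_exp_le (by linarith)]
    exact (Real.exp_one_lt_d9.le).trans (by linarith)
  set q := 1 + A * (n : ℝ) with hq
  have hq16 : 16 ≤ q := by nlinarith
  have mono : A * n / (1 + A * n) ≤ A * k / (1 + A * k) := by
    rw [div_le_div_iff₀ (by positivity) (by positivity)]
    nlinarith
  have e0 : A * n / (1 + A * n) = 1 - 1 / q := by rw [hq]; field_simp; ring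
  have l1 : Real.log (1 + A * n) ≤ Real.log (1 + A) + Real.log n := by
    rw [← Real.log_mul (by positivity) (by positivity)]
    exact Real.log_le_log (by positivity) (by nlinarith)
  have l2 : Real.log (1 + A * k) ≤ Real.log (1 + A) + Real.log t := by
    rw [← Real.log_mul (by positivity) (by linarith)]
    exact Real.log_le_log (by positivity) (by nlinarith)
  have l3 : Real.log (1 + A) ≤ 1 + Real.log ℓ := by
    have h2 : Real.log (1 + A) ≤ Real.log (2 * ℓ) := Real.log_le_log (by linarith) (by linarith)
    rw [Real.log_mul (by norm_num) (by linarith)] at h2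
    have := Real.log_two_lt_d9
    linarith
  have main : (x₁ + x₂) * (1 - 1 / q) ≤ x₁ * (A * n / (1 + A * n)) + x₂ * (A * k / (1 + A * k)) := by
    rw [← e0, add_mul]
    gcongr
  have hq1 : 1 / q ≤ 1 / 16 := one_div_le_one_div_of_le (by norm_num) hq16
  have hqpos : 0 < 1 / q := by positivity
  have main2 : (ℓ + 8 * Real.log ℓ) * (1 - 1 / q) ≤ (x₁ + x₂) * (1 - 1 / q) := by
    gcongr
    linarith
  have hAq : A * (1 / q) ≤ 1 := by
    rw [mul_one_div, div_le_one (by linarith)]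
    nlinarith
  have hlq : 8 * Real.log ℓ * (1 / q) ≤ Real.log ℓ / 2 := by nlinarith
  -- The shrinkage costs (log t)/q and the smaller count costs (log n)/2; together they may use only
  -- half of log t, the other half being due to the larger count. If log t ≤ n the first cost is at
  -- most 1; otherwise n ≤ log t, and log n is only of the order of an iterated logarithm.
  have hcase : Real.log t * (1 / q) + Real.log n / 2 ≤ Real.log t / 2 + 1 + Real.log ℓ / 2 := by
    rcases le_total (Real.log t) n with h | h
    · have h1 : Real.log t * (1 / q) ≤ 1 := by
        rw [mul_one_div, div_le_one (by linarith)]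
        nlinarith
      have h2 : Real.log n ≤ Real.log t := Real.log_le_log (by linarith) (by linarith)
      linarith
    · have h1 : Real.log t * (1 / q) ≤ Real.log t / 2 := by nlinarith
      have h2 : Real.log n ≤ Real.log ℓ := Real.log_le_log (by linarith) (by linarith)
      linarith
  have e1 : (ℓ + 8 * Real.log ℓ) * (1 - 1 / q)
      = ℓ + 8 * Real.log ℓ - Real.log t * (1 / q) - A * (1 / q) - 8 * Real.log ℓ * (1 / q) := by
    rw [hℓ]; ring
  linarith

/-! ### The variables of MCPI along a run -/

section State

variable {K N : ℕ} {σ : ℝ} {tie : ℕ → Finset ℕ → ℕ} {δ : ℝ}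

/-- A sequence of histories produced by MCPI. -/
structure IsRun (K N : ℕ) (σ : ℝ) (tie : ℕ → Finset ℕ → ℕ) (δ : ℝ) (H : ℕ → History) : Prop where
  zero : H 0 = []
  succ : ∀ t, ∃ y, H (t + 1) = (mcpiSample K N σ tie δ (H t), y) :: H t

/-- The invariants of the variables of MCPI. -/
structure StateInv (K N : ℕ) (s : MCPIState) : Prop where
  found_subset : s.found ⊆ Finset.Icc 1 (K - 1)
  cand_eq : s.cand = Finset.Icc 1 (K - 1) \ s.found
  card_le : s.found.card ≤ N

/-- The invariants of the variables of MCPI once there is an estimate. -/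
structure StateReady (K N : ℕ) (s : MCPIState) : Prop extends StateInv K N s where
  est_mem : s.found.card < N → s.est ∈ s.cand

theorem StateInv.cand_nonempty (hNK : N ≤ K - 1) {s : MCPIState} (hs : StateInv K N s)
    (h : s.found.card < N) : s.cand.Nonempty := by
  rw [hs.cand_eq, ← Finset.card_pos, Finset.card_sdiff_of_subset hs.found_subset]
  simp
  omega

theorem largestChange_mem_filter (htie : ∀ (t : ℕ) (s : Finset ℕ), s.Nonempty → tie t s ∈ s)
    (h : History) {S : Finset ℕ} (hS : S.Nonempty) :
    largestChange tie h S ∈ S ∧ ∀ b ∈ S, empChange h b ≤ empChange h (largestChange tie h S) := by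
  obtain ⟨a, ha, hmax⟩ := S.exists_max_image (empChange h) hS
  have := htie h.length (S.filter fun a => ∀ b ∈ S, empChange h b ≤ empChange h a)
    ⟨a, Finset.mem_filter.2 ⟨ha, hmax⟩⟩
  exact Finset.mem_filter.1 this

theorem leastPlayed_mem_filter (htie : ∀ (t : ℕ) (s : Finset ℕ), s.Nonempty → tie t s ∈ s)
    (h : History) {S : Finset ℕ} (hS : S.Nonempty) :
    leastPlayed tie h S ∈ S ∧ ∀ b ∈ S, plays h (leastPlayed tie h S) ≤ plays h b := by
  obtain ⟨a, ha, hmin⟩ := S.exists_min_image (plays h) hS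
  have := htie h.length (S.filter fun a => ∀ b ∈ S, plays h a ≤ plays h b)
    ⟨a, Finset.mem_filter.2 ⟨ha, hmin⟩⟩
  exact Finset.mem_filter.1 this

theorem closePhase_of_not {h : History} {s : MCPIState}
    (hs : ¬ (s.found.card < N ∧ threshold K h.length (δ / N) ≤ statZ σ h s.est)) :
    closePhase K N σ tie δ h s = s := by
  simp only [closePhase, if_neg hs]

theorem closePhase_of_cond {h : History} {s : MCPIState}
    (hs : s.found.card < N ∧ threshold K h.length (δ / N) ≤ statZ σ h s.est) :
    closePhase K N σ tie δ h s = ⟨s.cand.erase s.est, insert s.est s.found,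
      largestChange tie h (s.cand.erase s.est)⟩ := by
  simp only [closePhase, if_pos hs]

theorem StateReady.notMem_found {s : MCPIState} (hs : StateReady K N s) (h : s.found.card < N) :
    s.est ∉ s.found := by
  have := hs.est_mem h
  rw [hs.cand_eq] at this
  exact (Finset.mem_sdiff.1 this).2

theorem StateReady.closePhase (htie : ∀ (t : ℕ) (s : Finset ℕ), s.Nonempty → tie t s ∈ s)
    (hNK : N ≤ K - 1) (h : History) {s : MCPIState} (hs : StateReady K N s) :
    StateReady K N (closePhase K N σ tie δ h s) := by
  by_cases hc : s.found.card < N ∧ threshold K h.length (δ / N) ≤ statZ σ h s.est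
  · rw [closePhase_of_cond hc]
    have hmem := hs.est_mem hc.1
    rw [hs.cand_eq] at hmem
    have hI : StateInv K N ⟨s.cand.erase s.est, insert s.est s.found,
        largestChange tie h (s.cand.erase s.est)⟩ := by
      refine ⟨Finset.insert_subset (Finset.mem_sdiff.1 hmem).1 hs.found_subset, ?_, ?_⟩
      · simp only [hs.cand_eq]
        ext a
        simp
        tauto
      · exact (Finset.card_insert_le _ _).trans hc.1
    exact { hI with
      est_mem := fun h' => (largestChange_mem_filter htie h (hI.cand_nonempty hNK h')).1 }
  · rwa [closePhase_of_not hc]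

theorem StateInv.updateEst (htie : ∀ (t : ℕ) (s : Finset ℕ), s.Nonempty → tie t s ∈ s)
    (hNK : N ≤ K - 1) (h : History) {s : MCPIState} (hs : StateInv K N s) :
    StateReady K N (updateEst K σ tie h s) := by
  unfold PiecewiseBandit.updateEst
  split_ifs with hc
  · exact ⟨⟨hs.1, hs.2, hs.3⟩, fun h' =>
      (largestChange_mem_filter htie h (hs.cand_nonempty hNK h')).1⟩
  · exact ⟨hs, fun _ => by_contra fun h' => hc (.inr h')⟩

theorem iterate_induction {α : Type*} {P : α → Prop} {f : α → α} (hf : ∀ x, P x → P (f x)) (n : ℕ)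
    {x : α} (hx : P x) : P (f^[n] x) := by
  induction n generalizing x with
  | zero => exact hx
  | succ n ih => exact ih (hf x hx)

theorem mcpiState_cons_of_le {p : ℕ × ℝ} {h : History} (hK : K ≤ (p :: h).length) :
    mcpiState K N σ tie δ (p :: h) = (closePhase K N σ tie δ (p :: h))^[N]
      (updateEst K σ tie (p :: h) (mcpiState K N σ tie δ h)) := by
  rw [mcpiState, if_pos hK]

theorem mcpiState_cons_of_lt {p : ℕ × ℝ} {h : History} (hK : (p :: h).length < K) :
    mcpiState K N σ tie δ (p :: h) = mcpiState K N σ tie δ h := by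
  rw [mcpiState, if_neg hK.not_ge]

theorem stateInv_mcpiState (htie : ∀ (t : ℕ) (s : Finset ℕ), s.Nonempty → tie t s ∈ s)
    (hNK : N ≤ K - 1) (h : History) : StateInv K N (mcpiState K N σ tie δ h) := by
  induction h with
  | nil => exact ⟨by simp [mcpiState], by simp [mcpiState], by simp [mcpiState]⟩
  | cons p h ih =>
    rcases le_or_gt K (p :: h).length with hK | hK
    · rw [mcpiState_cons_of_le hK]
      exact (iterate_induction (fun s hs => StateReady.closePhase htie hNK (p :: h) hs) N
        (ih.updateEst htie hNK (p :: h))).toStateInv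
    · rwa [mcpiState_cons_of_lt hK]

theorem stateReady_mcpiState (htie : ∀ (t : ℕ) (s : Finset ℕ), s.Nonempty → tie t s ∈ s)
    (hNK : N ≤ K - 1) {p : ℕ × ℝ} {h : History} (hK : K ≤ (p :: h).length) :
    StateReady K N (mcpiState K N σ tie δ (p :: h)) := by
  rw [mcpiState_cons_of_le hK]
  exact iterate_induction (fun s hs => StateReady.closePhase htie hNK (p :: h) hs) N
    ((stateInv_mcpiState htie hNK h).updateEst htie hNK (p :: h))

theorem found_subset_closePhase (h : History) (s : MCPIState) :
    s.found ⊆ (closePhase K N σ tie δ h s).found := by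
  unfold closePhase
  split_ifs
  · exact Finset.subset_insert _ _
  · exact subset_rfl

theorem found_updateEst (h : History) (s : MCPIState) :
    (updateEst K σ tie h s).found = s.found := by
  unfold updateEst; split_ifs <;> rfl

theorem cand_updateEst (h : History) (s : MCPIState) :
    (updateEst K σ tie h s).cand = s.cand := by
  unfold updateEst; split_ifs <;> rfl

theorem found_subset_cons (p : ℕ × ℝ) (h : History) :
    (mcpiState K N σ tie δ h).found ⊆ (mcpiState K N σ tie δ (p :: h)).found := by
  rcases le_or_gt K (p :: h).length with hK | hK
  · rw [mcpiState_cons_of_le hK]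
    refine iterate_induction (P := fun s : MCPIState => (mcpiState K N σ tie δ h).found ⊆ s.found)
      (fun s hs => hs.trans (found_subset_closePhase _ _)) N ?_
    rw [found_updateEst]
  · rw [mcpiState_cons_of_lt hK]

/-- Either all the phases are completed, or the statistic is below the threshold. -/
theorem statZ_lt_of_card_lt (htie : ∀ (t : ℕ) (s : Finset ℕ), s.Nonempty → tie t s ∈ s)
    (hNK : N ≤ K - 1) {p : ℕ × ℝ} {h : History} (hK : K ≤ (p :: h).length)
    (hc : (mcpiState K N σ tie δ (p :: h)).found.card < N) :
    statZ σ (p :: h) (mcpiState K N σ tie δ (p :: h)).est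
      < threshold K (p :: h).length (δ / N) := by
  rw [mcpiState_cons_of_le hK] at hc ⊢
  set s₀ := updateEst K σ tie (p :: h) (mcpiState K N σ tie δ h)
  have h₀ : StateReady K N s₀ := (stateInv_mcpiState htie hNK h).updateEst htie hNK (p :: h)
  -- Each of the `N` iterations either closes a phase or has reached a fixed point, so after `N` of
  -- them no closable phase is left.
  have key : ∀ j, j ≤ ((closePhase K N σ tie δ (p :: h))^[j] s₀).found.card ∨
      ¬ (((closePhase K N σ tie δ (p :: h))^[j] s₀).found.card < N ∧
        threshold K (p :: h).length (δ / N)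
          ≤ statZ σ (p :: h) ((closePhase K N σ tie δ (p :: h))^[j] s₀).est) := by
    intro j
    induction j with
    | zero => simp
    | succ j ih =>
      have hr := iterate_induction (fun s hs => StateReady.closePhase (σ := σ) (δ := δ) htie hNK (p :: h) hs) j h₀
      rw [Function.iterate_succ_apply']
      set s := (closePhase K N σ tie δ (p :: h))^[j] s₀
      by_cases hcond : s.found.card < N ∧ threshold K (p :: h).length (δ / N) ≤ statZ σ (p :: h) s.est
      · left
        rw [closePhase_of_cond hcond]
        simp only
        rw [Finset.card_insert_of_notMem (hr.notMem_found hcond.1)]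
        have := ih.resolve_right (not_not.2 hcond)
        omega
      · right
        rwa [closePhase_of_not hcond]
  rcases key N with h1 | h1
  · omega
  · by_contra h2
    exact h1 ⟨hc, not_lt.1 h2⟩

/-- If the estimate is renewed then it is the best candidate. -/
theorem est_isMax (htie : ∀ (t : ℕ) (s : Finset ℕ), s.Nonempty → tie t s ∈ s)
    (hNK : N ≤ K - 1) {p : ℕ × ℝ} {h : History} (hK : K ≤ (p :: h).length)
    (hU : UpdateCond K σ (p :: h) ∨ K = 2)
    (hc : (mcpiState K N σ tie δ (p :: h)).found.card < N) :
    ∀ b ∈ (mcpiState K N σ tie δ (p :: h)).cand,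
      empChange (p :: h) b ≤ empChange (p :: h) (mcpiState K N σ tie δ (p :: h)).est := by
  rcases hU with hU | rfl
  · revert hc
    rw [mcpiState_cons_of_le hK]
    refine (iterate_induction (P := fun s : MCPIState => StateReady K N s ∧ (s.found.card < N → ∀ b ∈ s.cand,
      empChange (p :: h) b ≤ empChange (p :: h) s.est)) ?_ N ⟨?_, ?_⟩).2
    · rintro s ⟨hs, hs'⟩
      have hr := hs.closePhase (σ := σ) (δ := δ) htie hNK (p :: h)
      refine ⟨hr, fun hlt b hb => ?_⟩
      by_cases hcond : s.found.card < N ∧ threshold K (p :: h).length (δ / N) ≤ statZ σ (p :: h) s.est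
      · have hne := hr.cand_nonempty hNK hlt
        rw [closePhase_of_cond hcond] at hb hne ⊢
        exact (largestChange_mem_filter htie (p :: h) hne).2 b hb
      · rw [closePhase_of_not hcond] at hb hlt ⊢
        exact hs' hlt b hb
    · exact (stateInv_mcpiState htie hNK h).updateEst htie hNK (p :: h)
    · intro hlt b hb
      have hne := ((stateInv_mcpiState htie hNK h).updateEst (σ := σ) htie hNK (p :: h)).cand_nonempty
        hNK hlt
      rw [cand_updateEst] at hb hne
      have : updateEst K σ tie (p :: h) (mcpiState K N σ tie δ h)
          = { mcpiState K N σ tie δ h with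
              est := largestChange tie (p :: h) (mcpiState K N σ tie δ h).cand } := by
        unfold updateEst
        rw [if_pos (.inl hU)]
      rw [this]
      exact (largestChange_mem_filter htie (p :: h) hne).2 b hb
  -- For `K = 2` the update condition never holds, but there is only one candidate.
  · intro b hb
    have hr := stateReady_mcpiState (σ := σ) (δ := δ) htie hNK hK
    have he := hr.est_mem hc
    rw [hr.cand_eq] at he hb
    have h1 := (Finset.mem_sdiff.1 he).1
    have h2 := (Finset.mem_sdiff.1 hb).1
    simp at h1 h2
    rw [show b = (mcpiState 2 N σ tie δ (p :: h)).est by omega]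

/-- What has been recorded in a round met the stopping condition of its phase. -/
theorem found_cons (p : ℕ × ℝ) (h : History) {b : ℕ}
    (hb : b ∈ (mcpiState K N σ tie δ (p :: h)).found) :
    b ∈ (mcpiState K N σ tie δ h).found ∨
      K ≤ (p :: h).length ∧ threshold K (p :: h).length (δ / N) ≤ statZ σ (p :: h) b := by
  rcases le_or_gt K (p :: h).length with hK | hK
  · rw [mcpiState_cons_of_le hK] at hb
    refine iterate_induction (P := fun s : MCPIState => ∀ b ∈ s.found,
      b ∈ (mcpiState K N σ tie δ h).found ∨
      K ≤ (p :: h).length ∧ threshold K (p :: h).length (δ / N) ≤ statZ σ (p :: h) b) ?_ N ?_ b hb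
    · intro s hs b hb
      by_cases hcond : s.found.card < N ∧ threshold K (p :: h).length (δ / N) ≤ statZ σ (p :: h) s.est
      · rw [closePhase_of_cond hcond] at hb
        rcases Finset.mem_insert.1 hb with rfl | hb
        · exact .inr ⟨hK, hcond.2⟩
        · exact hs b hb
      · rw [closePhase_of_not hcond] at hb
        exact hs b hb
    · intro b hb
      rw [found_updateEst] at hb
      exact .inl hb
  · rw [mcpiState_cons_of_lt hK] at hb
    exact .inl hb

namespace IsRun

variable {H : ℕ → History}

theorem length_eq (hH : IsRun K N σ tie δ H) (t : ℕ) : (H t).length = t := by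
  induction t with
  | zero => rw [hH.zero]; rfl
  | succ t ih =>
    obtain ⟨y, hy⟩ := hH.succ t
    rw [hy]
    simp [ih]

theorem plays_succ (hH : IsRun K N σ tie δ H) (t a : ℕ) :
    plays (H (t + 1)) a = plays (H t) a + if mcpiSample K N σ tie δ (H t) = a then 1 else 0 := by
  obtain ⟨y, hy⟩ := hH.succ t
  rw [hy, plays_cons]

theorem plays_mono (hH : IsRun K N σ tie δ H) (a : ℕ) : Monotone fun t => plays (H t) a :=
  monotone_nat_of_le_succ fun t => by simp [hH.plays_succ]

theorem found_mono (hH : IsRun K N σ tie δ H) :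
    Monotone fun t => (mcpiState K N σ tie δ (H t)).found :=
  monotone_nat_of_le_succ fun t => by
    obtain ⟨y, hy⟩ := hH.succ t
    rw [hy]
    exact found_subset_cons _ _

theorem exists_threshold_le (hH : IsRun K N σ tie δ H) {t b : ℕ}
    (hb : b ∈ (mcpiState K N σ tie δ (H t)).found) :
    ∃ s ≤ t, K ≤ s ∧ threshold K s (δ / N) ≤ statZ σ (H s) b := by
  induction t with
  | zero => rw [hH.zero] at hb; simp [mcpiState] at hb
  | succ t ih =>
    obtain ⟨y, hy⟩ := hH.succ t
    have hl := hH.length_eq (t + 1)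
    rw [hy] at hb hl
    rcases found_cons _ _ hb with h | h
    · obtain ⟨s, hs, h⟩ := ih h
      exact ⟨s, hs.trans (Nat.le_succ t), h⟩
    · rw [hl, ← hy] at h
      exact ⟨t + 1, le_rfl, h⟩

theorem one_le_plays (hH : IsRun K N σ tie δ H) {a t : ℕ} (ha : a ∈ Finset.Icc 1 K) (ht : K ≤ t) :
    1 ≤ plays (H t) a := by
  obtain ⟨h1, h2⟩ := Finset.mem_Icc.1 ha
  have h3 : 1 ≤ plays (H ((a - 1) + 1)) a := by
    rw [hH.plays_succ]
    have : mcpiSample K N σ tie δ (H (a - 1)) = a := by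
      rw [mcpiSample, if_pos (by rw [hH.length_eq]; omega), hH.length_eq]
      omega
    rw [if_pos this]
    omega
  exact h3.trans (hH.plays_mono a (by omega))

theorem plays_add_plays_le (hH : IsRun K N σ tie δ H) {a b : ℕ} (hab : a ≠ b) (t : ℕ) :
    plays (H t) a + plays (H t) b ≤ t := by
  induction t with
  | zero => simp [hH.zero, plays_nil]
  | succ t ih =>
    rw [hH.plays_succ, hH.plays_succ]
    split_ifs <;> omega

end IsRun

theorem isRun_history (μ ε : ℕ → ℝ) :
    IsRun K N σ tie δ ((mcpi K N σ tie δ).history μ ε) where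
  zero := rfl
  succ _ := ⟨_, rfl⟩

end State

/-! ### Correctness of the recommendation -/

section Correct

variable {K N : ℕ} {σ : ℝ} {tie : ℕ → Finset ℕ → ℕ} {δ : ℝ}

theorem history_update (π : Policy) (μ ε : ℕ → ℝ) {t s : ℕ} (hts : t ≤ s) (y : ℝ) :
    π.history μ (Function.update ε s y) t = π.history μ ε t := by
  induction t with
  | zero => rfl
  | succ t ih =>
    simp only [Policy.history, ih (by omega)]
    rw [Function.update_of_ne (by omega)]

/-- From 9 ≥ e² one gets 9⁶ ≥ e¹², and 2/log 3 ≥ 1. This is what makes `logConst` at least 15, as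
the comparison of threshold and mixture requires. -/
theorem exp_le_gammaConst : Real.exp 15 ≤ gammaConst := by
  have h3 : Real.log 3 ≤ 2 := by
    have := Real.log_le_sub_one_of_pos (show (0 : ℝ) < 3 by norm_num)
    linarith
  have h3' : 0 < Real.log 3 := Real.log_pos (by norm_num)
  have h9 : Real.exp 2 ≤ 9 := by
    have := Real.exp_one_lt_d9
    rw [show (2 : ℝ) = 1 + 1 by norm_num, Real.exp_add]
    nlinarith [Real.exp_pos 1]
  have h12 : Real.exp 12 ≤ 9 ^ 6 := by
    rw [show (12 : ℝ) = (6 : ℕ) * 2 by norm_num, Real.exp_nat_mul]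
    gcongr
  rw [gammaConst, le_div_iff₀ h3', show (15 : ℝ) = 3 + 12 by norm_num, Real.exp_add]
  have := mul_le_mul_of_nonneg_left h12 (Real.exp_pos 3).le
  have h0 := mul_pos (Real.exp_pos 3) (Real.exp_pos 12)
  nlinarith

/-- The constant term of the threshold. -/
noncomputable def logConst (K N : ℕ) (δ : ℝ) : ℝ := Real.log (gammaConst * (K - 1) * N / δ)

theorem gammaConst_pos : 0 < gammaConst := (Real.exp_pos 15).trans_le exp_le_gammaConst

theorem gammaConst_le_arg (hK : 2 ≤ K) (hN : 1 ≤ N) (hδ : 0 < δ) (hδ1 : δ < 1) :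
    gammaConst ≤ gammaConst * (K - 1) * N / δ := by
  have hK' : (2 : ℝ) ≤ K := by exact_mod_cast hK
  have hN' : (1 : ℝ) ≤ N := by exact_mod_cast hN
  have := gammaConst_pos
  rw [le_div_iff₀ hδ]
  calc gammaConst * δ ≤ gammaConst * 1 := by gcongr
    _ ≤ gammaConst * ((K - 1) * N) := by
      gcongr
      nlinarith
    _ = _ := by ring

theorem le_logConst (hK : 2 ≤ K) (hN : 1 ≤ N) (hδ : 0 < δ) (hδ1 : δ < 1) :
    15 ≤ logConst K N δ := by
  have h := gammaConst_le_arg hK hN hδ hδ1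
  rw [logConst, Real.le_log_iff_exp_le (gammaConst_pos.trans_le h)]
  exact exp_le_gammaConst.trans h

theorem threshold_eq (hK : 2 ≤ K) (hN : 1 ≤ N) (hδ : 0 < δ) {t : ℕ} (ht : 1 ≤ t) :
    threshold K t (δ / N) = Real.log t + logConst K N δ
      + 8 * Real.log (Real.log t + logConst K N δ) := by
  have hK' : (2 : ℝ) ≤ K := by exact_mod_cast hK
  have hN' : (1 : ℝ) ≤ N := by exact_mod_cast hN
  have ht' : (1 : ℝ) ≤ t := by exact_mod_cast ht
  have hg := gammaConst_pos
  have : Real.log (t * gammaConst * (K - 1) / (δ / N)) = Real.log t + logConst K N δ := by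
    have h1 : (0 : ℝ) < K - 1 := by linarith
    rw [logConst, ← Real.log_mul (by positivity) (by positivity)]
    congr 1
    field_simp
  rw [threshold, this]

/-- The centred sum of the rewards of an action. -/
noncomputable def noiseSum (μ : ℕ → ℝ) (h : History) (a : ℕ) : ℝ :=
  rewardSum h a - plays h a * μ a

/-- With p, q the two noise sums and n, k the counts, the difference of the two sides is exactly (p
+ q)²/(2σ²(n + k)). -/
theorem statZ_le {μ : ℕ → ℝ} {a : ℕ} (ha : μ a = μ (a + 1)) {h : History}
    (h1 : 1 ≤ plays h a) (h2 : 1 ≤ plays h (a + 1)) :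
    statZ σ h a ≤ noiseSum μ h a ^ 2 / (2 * σ ^ 2 * plays h a)
      + noiseSum μ h (a + 1) ^ 2 / (2 * σ ^ 2 * plays h (a + 1)) := by
  rcases eq_or_ne σ 0 with rfl | hσ
  · simp [statZ]
  have h1' : (1 : ℝ) ≤ plays h a := by exact_mod_cast h1
  have h2' : (1 : ℝ) ≤ plays h (a + 1) := by exact_mod_cast h2
  have e1 : rewardSum h a = noiseSum μ h a + plays h a * μ a := by rw [noiseSum]; ring
  have e2 : rewardSum h (a + 1) = noiseSum μ h (a + 1) + plays h (a + 1) * μ a := by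
    rw [noiseSum, ha]; ring
  rw [statZ, empChange, sq_abs, empMean_eq, empMean_eq, e1, e2]
  set n : ℝ := (plays h a : ℝ)
  set k : ℝ := (plays h (a + 1) : ℝ)
  set p := noiseSum μ h a
  set q := noiseSum μ h (a + 1)
  rw [← sub_nonneg]
  have : p ^ 2 / (2 * σ ^ 2 * n) + q ^ 2 / (2 * σ ^ 2 * k)
      - n * k / (2 * σ ^ 2 * (n + k)) * ((p + n * μ a) / n - (q + k * μ a) / k) ^ 2
      = (p + q) ^ 2 / (2 * σ ^ 2 * (n + k)) := by
    field_simp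
    ring
  rw [this]
  positivity

/-- The mixture martingale at the pair of the actions `a` and `a + 1`. -/
noncomputable def pairMixture (c v : ℝ) (μ : ℕ → ℝ) (a : ℕ) (h : History) : ℝ≥0∞ :=
  ENNReal.ofReal (gaussMixture c v (plays h a) (noiseSum μ h a)) *
    ENNReal.ofReal (gaussMixture c v (plays h (a + 1)) (noiseSum μ h (a + 1)))

theorem noiseSum_cons (μ : ℕ → ℝ) (h : History) (a b : ℕ) (y : ℝ) :
    noiseSum μ ((b, μ b + y) :: h) a = noiseSum μ h a + if b = a then y else 0 := by
  simp only [noiseSum, rewardSum_cons, plays_cons]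
  split_ifs with hba
  · subst hba; push_cast; ring
  · simp

/-- One play changes at most one of the two factors, so the product is a martingale whichever arm
`b` is chosen from the past. -/
theorem lintegral_pairMixture_cons {c : ℝ} (hc : 0 ≤ c) {v : NNReal} (hv : v ≠ 0) (μ : ℕ → ℝ)
    (a b : ℕ) (h : History) :
    ∫⁻ y, pairMixture c v μ a ((b, μ b + y) :: h) ∂(gaussianReal 0 v) = pairMixture c v μ a h := by
  simp only [pairMixture, noiseSum_cons, plays_cons]
  rcases eq_or_ne b a with rfl | h1
  · simp only [if_true, if_neg (Nat.succ_ne_self b).symm, add_zero]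
    rw [lintegral_mul_const
      (f := fun y => ENNReal.ofReal (gaussMixture c v (plays h b + 1) (noiseSum μ h b + y))) _ ((measurable_gaussMixture c v _).comp
      (measurable_const_add _)).ennreal_ofReal, lintegral_gaussMixture hc hv]
  · rcases eq_or_ne b (a + 1) with rfl | h2
    · simp only [if_true, if_neg (Nat.succ_ne_self a), add_zero]
      rw [lintegral_const_mul (f := fun y => ENNReal.ofReal
        (gaussMixture c v (plays h (a + 1) + 1) (noiseSum μ h (a + 1) + y))) _ ((measurable_gaussMixture c v _).comp
        (measurable_const_add _)).ennreal_ofReal, lintegral_gaussMixture hc hv]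
    · simp [h1, h2]

theorem measurable_pairMixture {Ω : Type*} [MeasurableSpace Ω] {H : Ω → History}
    (hH : MeasHistory H) (c v : ℝ) (μ : ℕ → ℝ) (a : ℕ) :
    Measurable fun ω => pairMixture c v μ a (H ω) := by
  have h1 : ∀ a, Measurable fun ω =>
      ENNReal.ofReal (gaussMixture c v (plays (H ω) a) (noiseSum μ (H ω) a)) := fun a => by
    refine (measurable_comp_countable (F := fun ω n => gaussMixture c v n (noiseSum μ (H ω) a))
      (hH.plays a) fun n => (measurable_gaussMixture c v n).comp ?_).ennreal_ofReal
    exact (hH.rewardSum a).sub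
      (((measurable_from_top (f := fun n : ℕ => (n : ℝ))).comp (hH.plays a)).mul_const _)
  exact (h1 a).mul (h1 (a + 1))

theorem log_gaussMixture {c v s : ℝ} {n : ℕ} (hc : 0 ≤ c) (hv : 0 < v) (hn : 1 ≤ n) :
    gaussMixture c v n s = Real.exp (s ^ 2 / (2 * v * n) * (c * n / (1 + c * n))
      - Real.log (1 + c * n) / 2) := by
  have hn' : (1 : ℝ) ≤ n := by exact_mod_cast hn
  rw [gaussMixture, Real.exp_sub, Real.exp_half, Real.exp_log (by positivity), mul_comm,
    div_eq_mul_inv]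
  congr 2
  field_simp

/-- The prior parameter is tuned to the confidence level: with c = A, the logarithm of the required
level, shrinkage costs A at most 1 and normalization costs of order log A. -/
theorem threshold_le_statZ_subset (hK : 2 ≤ K) (hN : 1 ≤ N) (hσ : 0 < σ) (hδ : 0 < δ) (hδ1 : δ < 1)
    {μ : ℕ → ℝ} {a : ℕ} (hμ : μ a = μ (a + 1)) {h : History} {t : ℕ} (hKt : K ≤ t)
    (h1 : 1 ≤ plays h a) (h2 : 1 ≤ plays h (a + 1)) (h12 : plays h a + plays h (a + 1) ≤ t)
    (hZ : threshold K t (δ / N) ≤ statZ σ h a) :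
    ENNReal.ofReal (gammaConst * (K - 1) * N / δ)
      ≤ pairMixture (logConst K N δ) (σ ^ 2) μ a h := by
  have hA := le_logConst hK hN hδ hδ1
  rw [threshold_eq hK hN hδ (by omega)] at hZ
  have hZ' := hZ.trans (statZ_le hμ h1 h2)
  have key := le_log_gaussMixture hA h1 h2 (by exact_mod_cast h12) (by positivity) (by positivity) hZ'
  have hpos := gammaConst_pos.trans_le (gammaConst_le_arg hK hN hδ hδ1)
  rw [pairMixture, ← ENNReal.ofReal_mul (gaussMixture_nonneg _ _ _ _)]
  refine ENNReal.ofReal_le_ofReal ?_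
  rw [log_gaussMixture (by linarith) (by positivity) h1,
    log_gaussMixture (by linarith) (by positivity) h2, ← Real.exp_add,
    ← Real.log_le_iff_le_exp hpos]
  exact key

instance (σ : ℝ) : IsProbabilityMeasure (noise σ) := by unfold noise; infer_instance

/-- The runs of MCPI against the noise of the model are measurable. -/
theorem measHistory_history (K N : ℕ) (σ : ℝ) (tie : ℕ → Finset ℕ → ℕ) (δ : ℝ) (μ : ℕ → ℝ) (t : ℕ) :
    MeasHistory (fun ε => (mcpi K N σ tie δ).history μ ε t) ∧
    (Measurable fun ε => mcpiState K N σ tie δ ((mcpi K N σ tie δ).history μ ε t)) := by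
  have := measHistory_of_run K N σ tie δ μ (H := fun t ε => (mcpi K N σ tie δ).history μ ε t)
    (e := fun t ε => ε t) (fun _ => rfl) (fun _ _ => rfl) (fun t _ _ => measurable_pi_apply t) t
  exact ⟨this.1, this.2.1⟩

/-- The probability that an action which is not a change point ever meets the stopping condition. -/
theorem noise_exists_threshold_le (hK : 2 ≤ K) (hN : 1 ≤ N) (hσ : 0 < σ) (hδ : 0 < δ) (hδ1 : δ < 1)
    {μ : ℕ → ℝ} {a : ℕ} (ha : a ∈ Finset.Icc 1 (K - 1)) (hμ : μ a = μ (a + 1)) :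
    noise σ {ε | ∃ t, K ≤ t ∧ threshold K t (δ / N)
      ≤ statZ σ ((mcpi K N σ tie δ).history μ ε t) a}
      ≤ (ENNReal.ofReal (gammaConst * (K - 1) * N / δ))⁻¹ := by
  have hpos := gammaConst_pos.trans_le (gammaConst_le_arg hK hN hδ hδ1)
  have hA := le_logConst hK hN hδ hδ1
  set c := logConst K N δ
  set π := mcpi K N σ tie δ
  have hv : (Real.toNNReal (σ ^ 2) : ℝ) = σ ^ 2 := Real.coe_toNNReal _ (by positivity)
  have hv0 : Real.toNNReal (σ ^ 2) ≠ 0 := by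
    rw [← NNReal.coe_ne_zero, hv]; positivity
  refine le_trans (measure_mono fun ε hε => ?_) (ville_infinitePi
    (gaussianReal 0 (Real.toNNReal (σ ^ 2)))
    (M := fun t ε => pairMixture c (σ ^ 2) μ a ((mcpi K N σ tie δ).history μ ε t))
    (fun t => measurable_pairMixture (measHistory_history K N σ tie δ μ t).1 _ _ _ _)
    (fun ε => ?_) (fun t s ε y hts => by simp only [history_update _ _ _ hts])
    (fun t ε => ?_) (x := ENNReal.ofReal (gammaConst * (K - 1) * N / δ)) ?_ ENNReal.ofReal_ne_top)
  · obtain ⟨t, hKt, hZ⟩ := hε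
    have hrun := isRun_history (K := K) (N := N) (σ := σ) (tie := tie) (δ := δ) μ ε
    have ha' := Finset.mem_Icc.1 ha
    exact ⟨t, threshold_le_statZ_subset hK hN hσ hδ hδ1 hμ hKt
      (hrun.one_le_plays (Finset.mem_Icc.2 ⟨ha'.1, by omega⟩) hKt)
      (hrun.one_le_plays (Finset.mem_Icc.2 ⟨by omega, by omega⟩) hKt)
      (hrun.plays_add_plays_le (by omega) t) hZ⟩
  · simp [pairMixture, Policy.history, noiseSum, rewardSum, plays_nil, gaussMixture_zero]
  · simp only [Policy.history, history_update _ _ _ le_rfl, Function.update_self]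
    have := lintegral_pairMixture_cons (c := c) (by linarith) hv0 μ a
      (π.sample (π.history μ ε t)) (π.history μ ε t)
    rw [hv] at this
    exact this.le
  · simpa using hpos

theorem output_subset_probability (hN : 1 ≤ N) (hσ : 0 < σ)
    (htie : ∀ (t : ℕ) (s : Finset ℕ), s.Nonempty → tie t s ∈ s)
    (hδ : 0 < δ) (hδ1 : δ < 1) (hNK : N ≤ K - 1) (μ : ℕ → ℝ) :
    1 - δ < (noise σ).real {ε | (mcpi K N σ tie δ).output μ ε ⊆ changePoints K μ} := by
  have hK : 2 ≤ K := by omega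
  have hK' : (2 : ℝ) ≤ K := by exact_mod_cast hK
  have hN' : (1 : ℝ) ≤ N := by exact_mod_cast hN
  have hpos := gammaConst_pos.trans_le (gammaConst_le_arg hK hN hδ hδ1)
  set y := gammaConst * (K - 1) * N / δ with hy
  set π := mcpi K N σ tie δ
  let B : ℕ → Set (ℕ → ℝ) := fun a =>
    {ε | ∃ t, K ≤ t ∧ threshold K t (δ / N) ≤ statZ σ (π.history μ ε t) a}
  let S := (Finset.Icc 1 (K - 1)).filter fun a => μ a = μ (a + 1)
  set good := {ε | π.output μ ε ⊆ changePoints K μ}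
  -- Every recorded position has crossed the threshold at some time. This holds for any history, so
  -- runs that never stop need no separate treatment.
  have hcover : Set.univ ⊆ good ∪ ⋃ a ∈ S, B a := by
    intro ε _
    by_contra hε
    simp only [Set.mem_union, not_or] at hε
    refine hε.1 fun a ha => ?_
    have hrun := isRun_history (K := K) (N := N) (σ := σ) (tie := tie) (δ := δ) μ ε
    have ha1 := (stateInv_mcpiState htie hNK _).found_subset ha
    obtain ⟨s, _, hs⟩ := hrun.exists_threshold_le ha
    refine Finset.mem_filter.2 ⟨ha1, fun hμ => hε.2 ?_⟩
    exact Set.mem_biUnion (x := a) (Finset.mem_coe.2 (Finset.mem_filter.2 ⟨ha1, hμ⟩)) ⟨s, hs⟩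
  have hB : (noise σ).real (⋃ a ∈ S, B a) < δ := by
    have hle : ∀ a ∈ S, (noise σ).real (B a) ≤ y⁻¹ := fun a ha => by
      obtain ⟨h1, h2⟩ := Finset.mem_filter.1 ha
      have := noise_exists_threshold_le (tie := tie) hK hN hσ hδ hδ1 h1 h2
      rw [← ENNReal.ofReal_inv_of_pos hpos] at this
      exact ENNReal.toReal_le_of_le_ofReal (by positivity) this
    have hcard : (S.card : ℝ) ≤ K - 1 := by
      have h1 : S.card ≤ K - 1 := by
        simpa using Finset.card_filter_le (Finset.Icc 1 (K - 1)) fun a => μ a = μ (a + 1)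
      have h2 : (S.card : ℝ) ≤ ((K - 1 : ℕ) : ℝ) := by exact_mod_cast h1
      rwa [Nat.cast_sub (by omega), Nat.cast_one] at h2
    -- The union bound leaves δ/(γN); the strict inequality comes from γ > 1.
    have hg1 : 1 < gammaConst := lt_of_lt_of_le (by simp) exp_le_gammaConst
    calc (noise σ).real (⋃ a ∈ S, B a) ≤ ∑ a ∈ S, (noise σ).real (B a) :=
          measureReal_biUnion_finset_le _ _
      _ ≤ ∑ a ∈ S, y⁻¹ := Finset.sum_le_sum hle
      _ = S.card * y⁻¹ := by simp
      _ ≤ (K - 1) * y⁻¹ := by gcongr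
      _ = δ / (gammaConst * N) := by
        rw [hy]
        have : (K : ℝ) - 1 ≠ 0 := by linarith
        field_simp
      _ < δ := by
        rw [div_lt_iff₀ (by positivity)]
        nlinarith [one_lt_mul_of_lt_of_le hg1 hN']
  have h1 : (1 : ℝ) ≤ (noise σ).real good + (noise σ).real (⋃ a ∈ S, B a) := by
    calc (1 : ℝ) = (noise σ).real Set.univ := by simp
      _ ≤ (noise σ).real (good ∪ ⋃ a ∈ S, B a) := measureReal_mono hcover
      _ ≤ _ := measureReal_union_le _ _
  linarith

/-- If MCPI stops then it has stopped after `N` phases. -/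
theorem card_output {μ ε : ℕ → ℝ} (h : (mcpi K N σ tie δ).stoppingTime μ ε < ⊤) :
    ((mcpi K N σ tie δ).output μ ε).card = N := by
  set π := mcpi K N σ tie δ
  have hne : {t : ℕ | π.shouldStop (π.history μ ε t)}.Nonempty := by
    by_contra hne
    rw [Set.not_nonempty_iff_eq_empty] at hne
    rw [Policy.stoppingTime, hne] at h
    simp at h
  have hmin : π.stoppingTime μ ε = (sInf {t : ℕ | π.shouldStop (π.history μ ε t)} : ℕ) := by
    rw [Policy.stoppingTime]
    refine le_antisymm (iInf₂_le _ (Nat.sInf_mem hne)) (le_iInf₂ fun t ht => ?_)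
    exact_mod_cast Nat.sInf_le ht
  have := Nat.sInf_mem hne
  rw [Policy.output, hmin, ENat.toNat_natCast]
  exact this

end Correct

/-! ### The stack of rewards -/

section Stack

/-- The law of the noise of all the plays `(a, i)`: the `i`-th play of the action `a`. -/
noncomputable def stackLaw (σ : ℝ) : Measure (ℕ × ℕ → ℝ) :=
  Measure.infinitePi fun _ => gaussianReal 0 (Real.toNNReal (σ ^ 2))

instance (σ : ℝ) : IsProbabilityMeasure (stackLaw σ) := by unfold stackLaw; infer_instance

/-- The history after `t` rounds if the noise is read off a stack of rewards. -/
noncomputable def stackHistory (π : Policy) (μ : ℕ → ℝ) (X : ℕ × ℕ → ℝ) : ℕ → History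
  | 0 => []
  | t + 1 =>
    let h := stackHistory π μ X t
    (π.sample h, μ (π.sample h) + X (π.sample h, plays h (π.sample h))) :: h

/-- The noise sequence that is read off a stack of rewards. -/
noncomputable def stackNoise (π : Policy) (μ : ℕ → ℝ) (X : ℕ × ℕ → ℝ) (t : ℕ) : ℝ :=
  X (π.sample (stackHistory π μ X t), plays (stackHistory π μ X t) (π.sample (stackHistory π μ X t)))

theorem history_stackNoise (π : Policy) (μ : ℕ → ℝ) (X : ℕ × ℕ → ℝ) (t : ℕ) :
    π.history μ (stackNoise π μ X) t = stackHistory π μ X t := by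
  induction t with
  | zero => rfl
  | succ t ih => simp only [Policy.history, stackHistory, ih, stackNoise]

/-- Plays are numbered from 0, so the entry `(a, k)` is read only when arm `a` already has exactly
`k` plays. -/
theorem stackHistory_update (π : Policy) (μ : ℕ → ℝ) (X : ℕ × ℕ → ℝ) {t a k : ℕ}
    (h : plays (stackHistory π μ X t) a ≤ k) (y : ℝ) :
    stackHistory π μ (Function.update X (a, k) y) t = stackHistory π μ X t := by
  induction t with
  | zero => rfl
  | succ t ih =>
    simp only [stackHistory, plays_cons] at h ⊢
    rw [ih (by omega), Function.update_of_ne]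
    rintro h'
    obtain ⟨h1, h2⟩ := Prod.mk.inj h'
    rw [h1, if_pos rfl] at h
    rw [h1] at h2
    omega

/-- Resetting the changed entry to its old value gives the converse direction. -/
theorem plays_stackHistory_update (π : Policy) (μ : ℕ → ℝ) (X : ℕ × ℕ → ℝ) (t a k : ℕ) (y : ℝ) :
    plays (stackHistory π μ (Function.update X (a, k) y) t) a ≤ k ↔
      plays (stackHistory π μ X t) a ≤ k := by
  constructor
  · intro h
    have := stackHistory_update π μ (Function.update X (a, k) y) h (X (a, k))
    rw [Function.update_idem, Function.update_eq_self] at this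
    rwa [this]
  · intro h
    rwa [stackHistory_update π μ X h]

variable {K N : ℕ} {σ : ℝ} {tie : ℕ → Finset ℕ → ℕ} {δ : ℝ}

theorem measHistory_stackHistory (K N : ℕ) (σ : ℝ) (tie : ℕ → Finset ℕ → ℕ) (δ : ℝ) (μ : ℕ → ℝ)
    (t : ℕ) : MeasHistory (fun X => stackHistory (mcpi K N σ tie δ) μ X t) ∧
      (Measurable fun X => mcpiSample K N σ tie δ (stackHistory (mcpi K N σ tie δ) μ X t)) ∧
      Measurable fun X => stackNoise (mcpi K N σ tie δ) μ X t := by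
  have := measHistory_of_run K N σ tie δ μ
    (H := fun t X => stackHistory (mcpi K N σ tie δ) μ X t)
    (e := fun t X => stackNoise (mcpi K N σ tie δ) μ X t) (fun _ => rfl) (fun _ _ => rfl)
    (fun t hH hs => ?_) t
  · exact ⟨this.1, this.2.2⟩
  · have h1 := measurable_comp_countable
      (F := fun X a => plays (stackHistory (mcpi K N σ tie δ) μ X t) a) hs fun a => hH.plays a
    exact measurable_comp_countable (F := fun (X : ℕ × ℕ → ℝ) (p : ℕ × ℕ) => X p)
      (hs.prodMk h1) fun p => measurable_pi_apply p

theorem measurable_stackNoise (K N : ℕ) (σ : ℝ) (tie : ℕ → Finset ℕ → ℕ) (δ : ℝ) (μ : ℕ → ℝ) :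
    Measurable (stackNoise (mcpi K N σ tie δ) μ) :=
  measurable_pi_iff.2 fun t => (measHistory_stackHistory K N σ tie δ μ t).2.2

/-- The noise which MCPI reads off a stack of rewards is i.i.d. -/
theorem map_stackNoise (K N : ℕ) (σ : ℝ) (tie : ℕ → Finset ℕ → ℕ) (δ : ℝ) (μ : ℕ → ℝ) :
    (stackLaw σ).map (stackNoise (mcpi K N σ tie δ) μ) = noise σ := by
  set π := mcpi K N σ tie δ
  set γ := gaussianReal 0 (Real.toNNReal (σ ^ 2))
  have hm := measurable_stackNoise K N σ tie δ μ
  have key : ∀ (t : ℕ → Set ℝ), (∀ i, MeasurableSet (t i)) → ∀ n,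
      stackLaw σ {X | ∀ i < n, stackNoise π μ X i ∈ t i} = ∏ i ∈ Finset.range n, γ (t i) := by
    intro t ht n
    induction n with
    | zero => simp
    | succ n ih =>
      obtain ⟨hH, hs, -⟩ := measHistory_stackHistory K N σ tie δ μ n
      let pos : (ℕ × ℕ → ℝ) → ℕ × ℕ := fun X => (π.sample (stackHistory π μ X n),
        plays (stackHistory π μ X n) (π.sample (stackHistory π μ X n)))
      have hpos : Measurable pos := hs.prodMk (measurable_comp_countable
        (F := fun X a => plays (stackHistory π μ X n) a) hs fun a => hH.plays a)
      let A : Set (ℕ × ℕ → ℝ) := {X | ∀ i < n, stackNoise π μ X i ∈ t i}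
      have hA : MeasurableSet A := by
        have : A = ⋂ i, ⋂ (_ : i < n), {X | stackNoise π μ X i ∈ t i} := by ext; simp [A]
        rw [this]
        exact .iInter fun i => .iInter fun _ => (measurable_pi_iff.1 hm i) (ht i)
      -- The position read in round `n` is selected by entries read earlier. Given that it is `p`,
      -- the entry at `p` is still unread, hence independent of the past.
      have hsplit : ∀ p, stackLaw σ ((A ∩ {X | pos X = p}) ∩ {X | X p ∈ t n})
          = stackLaw σ (A ∩ {X | pos X = p}) * γ (t n) := by
        intro p
        refine infinitePi_inter_of_update_invariant _ p
          (hA.inter (hpos (measurableSet_singleton p))) (ht n) fun X y => ?_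
        have hinv : plays (stackHistory π μ X n) p.1 ≤ p.2 →
            (Function.update X p y ∈ A ∩ {X | pos X = p} ↔ X ∈ A ∩ {X | pos X = p}) := by
          intro hle
          have e1 : ∀ i ≤ n, stackHistory π μ (Function.update X p y) i = stackHistory π μ X i := by
            intro i hi
            refine stackHistory_update π μ X (le_trans ?_ hle) y
            have hmono : Monotone fun i => plays (stackHistory π μ X i) p.1 :=
              monotone_nat_of_le_succ fun i => by simp [stackHistory, plays_cons]
            exact hmono hi
          have e2 : ∀ i < n, stackNoise π μ (Function.update X p y) i = stackNoise π μ X i := by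
            intro i hi
            have := e1 (i + 1) hi
            simp only [stackHistory, e1 i hi.le, List.cons.injEq, Prod.mk.injEq, and_true,
              true_and, add_right_inj] at this
            simpa only [stackNoise, e1 i hi.le] using this
          refine and_congr (forall₂_congr fun i hi => by rw [e2 i hi]) ?_
          simp only [Set.mem_ofPred_eq, pos, e1 n le_rfl]
        by_cases hle : plays (stackHistory π μ X n) p.1 ≤ p.2
        · exact hinv hle
        -- If arm `p.1` has already had more than `p.2` plays, then `p` is not the next position,
        -- before or after the update, and both sides are false.
        · have h1 : X ∉ A ∩ {X | pos X = p} := by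
            rintro ⟨-, h⟩
            refine hle ?_
            rw [← (h : pos X = p)]
          have h2 : Function.update X p y ∉ A ∩ {X | pos X = p} := by
            rintro ⟨-, h⟩
            refine hle ((plays_stackHistory_update π μ X n p.1 p.2 y).1 ?_)
            have h' := congrArg Prod.snd (h : pos _ = p)
            have h'' := congrArg Prod.fst (h : pos _ = p)
            simp only [pos] at h' h''
            rw [h''] at h'
            exact h'.le
          exact iff_of_false h2 h1
      have hdecomp : {X | ∀ i < n + 1, stackNoise π μ X i ∈ t i}
          = ⋃ p, (A ∩ {X | pos X = p}) ∩ {X | X p ∈ t n} := by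
        ext X
        simp only [Set.mem_ofPred_eq, Set.mem_iUnion, Set.mem_inter_iff]
        constructor
        · intro h
          exact ⟨pos X, ⟨fun i hi => h i (by omega), rfl⟩, h n (by omega)⟩
        · rintro ⟨p, ⟨h1, h2⟩, h3⟩ i hi
          rcases Nat.lt_or_ge i n with h | h
          · exact h1 i h
          · obtain rfl : i = n := by omega
            rw [← h2] at h3
            exact h3
      have hdisj : Pairwise (Function.onFun Disjoint fun p => A ∩ {X | pos X = p}) := by
        intro p q hpq
        refine Set.disjoint_left.2 fun X h1 h2 => hpq ?_
        exact h1.2.symm.trans h2.2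
      have hmeas : ∀ p, MeasurableSet (A ∩ {X | pos X = p}) := fun p =>
        hA.inter (hpos (measurableSet_singleton p))
      have hmeas' : ∀ p, MeasurableSet ((A ∩ {X | pos X = p}) ∩ {X | X p ∈ t n}) := fun p =>
        (hmeas p).inter (measurable_pi_apply p (ht n))
      rw [hdecomp, measure_iUnion
        (fun p q hpq => (hdisj hpq).mono Set.inter_subset_left Set.inter_subset_left)
        hmeas']
      simp only [hsplit]
      rw [ENNReal.tsum_mul_right, ← measure_iUnion hdisj hmeas, Finset.prod_range_succ, ← ih]
      congr 2
      ext X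
      simp [A]
  refine Measure.eq_infinitePi _ fun s t ht => ?_
  rw [Measure.map_apply hm (.pi s.countable_toSet fun j _ => ht j)]
  let t' : ℕ → Set ℝ := fun i => if i ∈ s then t i else Set.univ
  have ht' : ∀ i, MeasurableSet (t' i) := fun i => by
    simp only [t']; split_ifs; exacts [ht i, .univ]
  obtain ⟨n, hn⟩ : ∃ n, s ⊆ Finset.range n := ⟨s.sup id + 1, fun i hi =>
    Finset.mem_range.2 (Nat.lt_succ_of_le (Finset.le_sup (f := id) hi))⟩
  have h1 : stackNoise π μ ⁻¹' (Set.pi s t) = {X | ∀ i < n, stackNoise π μ X i ∈ t' i} := by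
    ext X
    simp only [Set.mem_preimage, Set.mem_pi, Finset.mem_coe, Set.mem_ofPred_eq, t']
    constructor
    · intro h i _
      split_ifs with hi
      exacts [h i hi, trivial]
    · intro h i hi
      simpa [hi] using h i (Finset.mem_range.1 (hn hi))
  rw [h1, key t' ht' n, ← Finset.prod_subset hn]
  · exact Finset.prod_congr rfl fun i hi => by simp [t', hi, γ]
  · intro i _ hi
    simp [t', hi]

/-- The sum of the first `n` rewards of the action `a` in a stack. -/
def walk (X : ℕ × ℕ → ℝ) (a n : ℕ) : ℝ := ∑ i ∈ Finset.range n, X (a, i)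

theorem empMean_stackHistory (π : Policy) (μ : ℕ → ℝ) (X : ℕ × ℕ → ℝ) (t a : ℕ)
    (h : plays (stackHistory π μ X t) a ≠ 0) :
    empMean (stackHistory π μ X t) a = μ a
      + walk X a (plays (stackHistory π μ X t) a) / plays (stackHistory π μ X t) a := by
  have key : rewardSum (stackHistory π μ X t) a = plays (stackHistory π μ X t) a * μ a
      + walk X a (plays (stackHistory π μ X t) a) := by
    clear h
    induction t with
    | zero => simp [stackHistory, rewardSum, plays_nil, walk]
    | succ t ih =>
      simp only [stackHistory, rewardSum_cons, plays_cons, ih]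
      split_ifs with h
      · rw [h, walk, walk, Finset.sum_range_succ]
        push_cast
        ring
      · simp
  have : (plays (stackHistory π μ X t) a : ℝ) ≠ 0 := by exact_mod_cast h
  rw [empMean_eq, key]
  field_simp

theorem isRun_stackHistory (μ : ℕ → ℝ) (X : ℕ × ℕ → ℝ) :
    IsRun K N σ tie δ (stackHistory (mcpi K N σ tie δ) μ X) where
  zero := rfl
  succ _ := ⟨_, rfl⟩

end Stack

/-! ### Gaussian random walks -/

section Walks

/-- Extending by zero the coordinates outside a finite set turns invariance into being a cylinder
event; disjoint families of coordinates are independent. -/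
theorem measure_inter_of_dependsOn {ι : Type*} (μ : ι → Measure ℝ)
    [∀ i, IsProbabilityMeasure (μ i)] {S T : Finset ι} (hST : Disjoint S T) {A B : Set (ι → ℝ)}
    (hA : MeasurableSet A) (hB : MeasurableSet B)
    (hAS : ∀ X Y : ι → ℝ, (∀ i ∈ S, X i = Y i) → X ∈ A → Y ∈ A)
    (hBT : ∀ X Y : ι → ℝ, (∀ i ∈ T, X i = Y i) → X ∈ B → Y ∈ B) :
    Measure.infinitePi μ (A ∩ B) = Measure.infinitePi μ A * Measure.infinitePi μ B := by
  classical
  have hind := (iIndepFun_infinitePi (P := μ) (X := fun _ x => x) (fun _ => measurable_id)).indepFun_finset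
    S T hST (fun i => measurable_pi_apply i)
  have key : ∀ (U : Finset ι) (C : Set (ι → ℝ)), MeasurableSet C →
      (∀ X Y : ι → ℝ, (∀ i ∈ U, X i = Y i) → X ∈ C → Y ∈ C) →
      ∃ D : Set (U → ℝ), MeasurableSet D ∧ C = (fun (X : ι → ℝ) (i : U) => X i) ⁻¹' D := by
    intro U C hC hCU
    let ext : (U → ℝ) → ι → ℝ := fun x i => if h : i ∈ U then x ⟨i, h⟩ else 0
    have hext : Measurable ext := measurable_pi_iff.2 fun i => by
      by_cases h : i ∈ U
      · simpa [ext, h] using measurable_pi_apply (⟨i, h⟩ : U)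
      · simp [ext, h]
    refine ⟨ext ⁻¹' C, hext hC, ?_⟩
    ext X
    constructor
    · exact hCU _ _ fun i hi => by simp [ext, hi]
    · exact hCU _ _ fun i hi => by simp [ext, hi]
  obtain ⟨A', hA', rfl⟩ := key S A hA hAS
  obtain ⟨B', hB', rfl⟩ := key T B hB hBT
  exact hind.measure_inter_preimage_eq_mul _ _ hA' hB'

theorem map_sum_infinitePi_gaussian {ι : Type*} (v : NNReal) (s : Finset ι) (c : ι → ℝ) :
    (Measure.infinitePi fun _ : ι => gaussianReal 0 v).map (fun X => ∑ i ∈ s, c i * X i)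
      = gaussianReal 0 (∑ i ∈ s, Real.toNNReal (c i ^ 2) * v) := by
  classical
  set P := Measure.infinitePi fun _ : ι => gaussianReal 0 v
  have hind : iIndepFun (fun i (X : ι → ℝ) => c i * X i) P :=
    iIndepFun_infinitePi (P := fun _ : ι => gaussianReal 0 v) (X := fun i x => c i * x)
      (fun i => measurable_const_mul _)
  induction s using Finset.induction_on with
  | empty => simp [Measure.map_const, gaussianReal_zero_var]
  | insert i s hi ih =>
    have h1 : P.map (fun X => c i * X i) = gaussianReal 0 (Real.toNNReal (c i ^ 2) * v) := by
      have : (fun X : ι → ℝ => c i * X i) = (fun x => c i * x) ∘ fun X => X i := rfl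
      have hm : Measurable fun X : ι → ℝ => X i := measurable_pi_apply i
      rw [this, ← Measure.map_map (measurable_const_mul _) hm,
        Measure.infinitePi_map_eval, gaussianReal_map_const_mul, mul_zero]
      congr 2
      ext
      simp [sq_nonneg]
    have h2 := hind.indepFun_finsetSum_of_notMem
      (fun i => (measurable_pi_apply i).const_mul _) hi
    have e : (∑ j ∈ s, fun X : ι → ℝ => c j * X j) = fun X => ∑ j ∈ s, c j * X j := by
      ext X; simp
    rw [e] at h2
    have h3 := gaussianReal_add_gaussianReal_of_indepFun h2 ih h1
    rw [Finset.sum_insert hi, add_comm]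
    simp only [Finset.sum_insert hi]
    rw [add_zero] at h3
    rw [← h3]
    congr 1
    ext X
    simp [add_comm]

theorem gaussianReal_ge_le (w : NNReal) {y : ℝ} (hy : 0 ≤ y) :
    (gaussianReal 0 w).real (Set.Ici y) ≤ Real.exp (-(y ^ 2 / (2 * w))) := by
  rcases eq_or_ne w 0 with rfl | hw
  · simp
  have hw' : (0 : ℝ) < w := by positivity
  have h := measure_ge_le_exp_mul_mgf (μ := gaussianReal 0 w) (X := id) y
    (t := y / w) (by positivity) (integrable_exp_mul_gaussianReal _)
  refine h.trans_eq ?_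
  rw [mgf_id_gaussianReal, ← Real.exp_add]
  congr 1
  field_simp
  ring

theorem gaussianReal_abs_ge_le (w : NNReal) {y : ℝ} (hy : 0 ≤ y) :
    (gaussianReal 0 w).real {x | y ≤ |x|} ≤ 2 * Real.exp (-(y ^ 2 / (2 * w))) := by
  have h1 := gaussianReal_ge_le w hy
  have h2 : (gaussianReal 0 w).real (Set.Iic (-y)) = (gaussianReal 0 w).real (Set.Ici y) := by
    have : gaussianReal 0 w = (gaussianReal 0 w).map (fun x => -x) := by
      rw [gaussianReal_map_neg, neg_zero]
    conv_rhs => rw [this]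
    rw [map_measureReal_apply measurable_neg measurableSet_Ici]
    congr 1
    ext x
    simp
  have h3 : {x : ℝ | y ≤ |x|} ⊆ Set.Ici y ∪ Set.Iic (-y) := fun x hx => by
    rcases le_abs.1 (show y ≤ |x| from hx) with h | h
    · exact .inl h
    · exact .inr (show x ≤ -y by linarith)
  have := (measureReal_mono h3).trans (measureReal_union_le (μ := gaussianReal 0 w) _ _)
  linarith

/-- By scaling: the standard deviation is at least `y`, so falling two standard deviations below
zero is enough. -/
theorem le_gaussianReal_le (w : NNReal) {y : ℝ} (hy : 0 ≤ y) (hyw : y ^ 2 ≤ w) :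
    (gaussianReal 0 1).real (Set.Iic (-2)) ≤ (gaussianReal 0 w).real (Set.Iic (-(2 * y))) := by
  have h : gaussianReal 0 w = (gaussianReal 0 1).map (fun x => √w * x) := by
    rw [gaussianReal_map_const_mul, mul_zero, mul_one]
    congr 1
    ext
    simp
  rw [h, map_measureReal_apply (measurable_const_mul _) measurableSet_Iic]
  refine measureReal_mono fun x hx => ?_
  have h1 : y ≤ √w := Real.le_sqrt_of_sq_le hyw
  have h2 : x ≤ -2 := hx
  change √w * x ≤ -(2 * y)
  nlinarith

variable {σ : ℝ}

theorem coe_toNNReal_sq (σ : ℝ) : (Real.toNNReal (σ ^ 2) : ℝ) = σ ^ 2 :=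
  Real.coe_toNNReal _ (sq_nonneg _)

@[fun_prop]
theorem measurable_walk (a n : ℕ) : Measurable fun X => walk X a n := by
  unfold walk; fun_prop

theorem map_walk (σ : ℝ) (a n : ℕ) :
    (stackLaw σ).map (fun X => walk X a n) = gaussianReal 0 (n * Real.toNNReal (σ ^ 2)) := by
  have := map_sum_infinitePi_gaussian (Real.toNNReal (σ ^ 2))
    ((Finset.range n).map ⟨fun i => (a, i), fun i j h => (Prod.mk.inj h).2⟩) fun _ => 1
  simp only [one_mul, Finset.sum_map, one_pow, Real.toNNReal_one,
    Finset.sum_const, Finset.card_map, Finset.card_range, nsmul_eq_mul] at this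
  exact this

theorem walk_ge_le (hσ : 0 < σ) (a n : ℕ) {x : ℝ} (hx : 0 ≤ x) :
    (stackLaw σ).real {X | x * n ≤ |walk X a n|} ≤ 2 * Real.exp (-(x ^ 2 / (2 * σ ^ 2))) ^ n := by
  rcases eq_or_ne n 0 with rfl | hn
  · simp only [pow_zero, mul_one]
    exact measureReal_le_one.trans (by norm_num)
  have h := gaussianReal_abs_ge_le (n * Real.toNNReal (σ ^ 2)) (y := x * n) (by positivity)
  rw [← map_walk σ a n, map_measureReal_apply (measurable_walk a n)
    (measurableSet_le measurable_const measurable_norm : MeasurableSet {z : ℝ | x * n ≤ |z|})] at h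
  refine h.trans_eq ?_
  rw [← Real.exp_nat_mul, NNReal.coe_mul, coe_toNNReal_sq]
  congr 2
  have : (n : ℝ) ≠ 0 := by exact_mod_cast hn
  simp only [NNReal.coe_natCast]
  field_simp

/-- All the averages of at least `n₀` rewards of an action are accurate. -/
def Accurate (x : ℝ) (a n₀ : ℕ) : Set (ℕ × ℕ → ℝ) := {X | ∀ n, n₀ ≤ n → |walk X a n| < x * n}

theorem measurableSet_accurate (x : ℝ) (a n₀ : ℕ) : MeasurableSet (Accurate x a n₀) := by
  have : Accurate x a n₀ = ⋂ n, ⋂ (_ : n₀ ≤ n), {X | |walk X a n| < x * n} := by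
    ext; simp [Accurate]
  rw [this]
  exact .iInter fun n => .iInter fun _ =>
    measurableSet_lt (measurable_walk a n).abs measurable_const

/-- A union bound over the sample sizes from `n₀` on; the Gaussian tails for deviations linear in
the sample size form a geometric series. -/
theorem accurate_compl_le (hσ : 0 < σ) {x : ℝ} (hx : 0 < x) (a n₀ : ℕ) :
    (stackLaw σ).real (Accurate x a n₀)ᶜ ≤ 2 * (1 - Real.exp (-(x ^ 2 / (2 * σ ^ 2))))⁻¹
      * Real.exp (-(x ^ 2 / (2 * σ ^ 2))) ^ n₀ := by
  set ρ := Real.exp (-(x ^ 2 / (2 * σ ^ 2)))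
  have hρ0 : 0 ≤ ρ := (Real.exp_pos _).le
  have hρ1 : ρ < 1 := Real.exp_lt_one_iff.2 (by rw [neg_lt_zero]; positivity)
  have hsub : (Accurate x a n₀)ᶜ ⊆ ⋃ n, {X | x * (n₀ + n : ℕ) ≤ |walk X a (n₀ + n)|} := by
    intro X hX
    simp only [Accurate, Set.mem_compl_iff, Set.mem_ofPred_eq, not_forall, not_lt] at hX
    obtain ⟨n, hn, h⟩ := hX
    exact Set.mem_iUnion.2 ⟨n - n₀, by rwa [Nat.add_sub_cancel' hn]⟩
  have hsum : Summable fun n => 2 * ρ ^ n₀ * ρ ^ n :=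
    (summable_geometric_of_lt_one hρ0 hρ1).mul_left _
  have h1 : stackLaw σ (Accurate x a n₀)ᶜ ≤ ENNReal.ofReal (∑' n, 2 * ρ ^ n₀ * ρ ^ n) := by
    calc _ ≤ ∑' n, stackLaw σ {X | x * (n₀ + n : ℕ) ≤ |walk X a (n₀ + n)|} :=
          (measure_mono hsub).trans (measure_iUnion_le _)
      _ ≤ ∑' n, ENNReal.ofReal (2 * ρ ^ n₀ * ρ ^ n) := by
        refine ENNReal.tsum_le_tsum fun n => ?_
        rw [← ENNReal.ofReal_toReal (measure_ne_top (stackLaw σ) _)]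
        refine ENNReal.ofReal_le_ofReal ?_
        rw [mul_assoc, ← pow_add]
        exact walk_ge_le hσ a (n₀ + n) hx.le
      _ = _ := (ENNReal.ofReal_tsum_of_nonneg (fun n => by positivity) hsum).symm
  refine (ENNReal.toReal_le_of_le_ofReal (tsum_nonneg fun n => by positivity) h1).trans_eq ?_
  rw [tsum_mul_left, tsum_geometric_of_lt_one hρ0 hρ1]
  ring

/-- The increment of the signed difference of two neighbouring walks. -/
def pairSum (s : ℝ) (a m n : ℕ) (X : ℕ × ℕ → ℝ) : ℝ :=
  ∑ i ∈ Finset.Ico m n, s * (X (a, i) - X (a + 1, i))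

theorem pairSum_zero (s : ℝ) (a n : ℕ) (X : ℕ × ℕ → ℝ) :
    pairSum s a 0 n X = s * (walk X a n - walk X (a + 1) n) := by
  rw [pairSum, ← Finset.mul_sum, Finset.sum_sub_distrib, Nat.Ico_zero_eq_range]
  rfl

theorem pairSum_add (s : ℝ) (a : ℕ) {l m n : ℕ} (h1 : l ≤ m) (h2 : m ≤ n) (X : ℕ × ℕ → ℝ) :
    pairSum s a l m X + pairSum s a m n X = pairSum s a l n X :=
  Finset.sum_Ico_consecutive _ h1 h2

@[fun_prop]
theorem measurable_pairSum (s : ℝ) (a m n : ℕ) : Measurable (pairSum s a m n) := by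
  unfold pairSum; fun_prop

theorem map_pairSum (σ : ℝ) {s : ℝ} (hs : s ^ 2 = 1) (a m n : ℕ) :
    (stackLaw σ).map (pairSum s a m n)
      = gaussianReal 0 (2 * (n - m : ℕ) * Real.toNNReal (σ ^ 2)) := by
  have := map_sum_infinitePi_gaussian (Real.toNNReal (σ ^ 2))
    (({a, a + 1} : Finset ℕ) ×ˢ Finset.Ico m n) fun p => if p.1 = a then s else -s
  have e1 : (fun X : ℕ × ℕ → ℝ => ∑ i ∈ ({a, a + 1} : Finset ℕ) ×ˢ Finset.Ico m n,
      (if i.1 = a then s else -s) * X i) = pairSum s a m n := by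
    ext X
    rw [Finset.sum_product, Finset.sum_pair (by omega)]
    simp only [if_true, Nat.succ_ne_self, if_false, pairSum]
    rw [← Finset.sum_add_distrib]
    exact Finset.sum_congr rfl fun i _ => by ring
  have e2 : ∑ i ∈ ({a, a + 1} : Finset ℕ) ×ˢ Finset.Ico m n,
      Real.toNNReal ((if i.1 = a then s else -s) ^ 2) * Real.toNNReal (σ ^ 2)
      = 2 * (n - m : ℕ) * Real.toNNReal (σ ^ 2) := by
    have : ∀ i : ℕ × ℕ, (if i.1 = a then s else -s) ^ 2 = 1 := fun i => by
      split_ifs <;> simp [hs]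
    simp [this, Finset.card_product]
  rw [e1, e2] at this
  exact this

/-- The signed difference of two neighbouring walks is at least a standard deviation below zero
at some time in `[n, m]`. -/
def Dips (σ s : ℝ) (a n m : ℕ) : Set (ℕ × ℕ → ℝ) :=
  {X | ∃ k, n ≤ k ∧ k ≤ m ∧ s * (walk X a k - walk X (a + 1) k) ≤ -(σ * √k)}

theorem measurableSet_dips (σ s : ℝ) (a n m : ℕ) : MeasurableSet (Dips σ s a n m) := by
  have : Dips σ s a n m = ⋃ k, ⋃ (_ : n ≤ k), ⋃ (_ : k ≤ m),
      {X | s * (walk X a k - walk X (a + 1) k) ≤ -(σ * √k)} := by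
    ext; simp only [Dips, Set.mem_ofPred_eq, Set.mem_iUnion, exists_prop]
  rw [this]
  exact .iUnion fun k => .iUnion fun _ => .iUnion fun _ =>
    measurableSet_le (((measurable_walk a k).sub (measurable_walk (a + 1) k)).const_mul s)
      measurable_const

/-- Increments over disjoint blocks are independent. As M ≥ 2, a block contains at least half of the
plays up to its end, so the variance of its increment is at least σ²nM^{j+1}; each block thus misses
the large drop with probability at most 1 - P(N(0,1) ≤ -2). -/
theorem blocks_le (hσ : 0 < σ) {s : ℝ} (hs : s ^ 2 = 1) (a : ℕ) {n M : ℕ} (hM : 2 ≤ M) (J : ℕ) :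
    (stackLaw σ).real {X | ∀ j < J, -(2 * (σ * √(n * M ^ (j + 1) : ℕ)))
        < pairSum s a (n * M ^ j) (n * M ^ (j + 1)) X}
      ≤ (1 - (gaussianReal 0 1).real (Set.Iic (-2))) ^ J := by
  set p := (gaussianReal 0 1).real (Set.Iic (-2))
  have hp : p ≤ 1 := measureReal_le_one
  have hmono : Monotone fun j => n * M ^ j := fun i j hij =>
    Nat.mul_le_mul_left _ (Nat.pow_le_pow_right (by omega) hij)
  let B : ℕ → Set (ℕ × ℕ → ℝ) := fun j => {X | -(2 * (σ * √(n * M ^ (j + 1) : ℕ)))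
        < pairSum s a (n * M ^ j) (n * M ^ (j + 1)) X}
  have hB : ∀ j, MeasurableSet (B j) := fun j =>
    measurableSet_lt measurable_const (measurable_pairSum _ _ _ _)
  have hBp : ∀ j, (stackLaw σ).real (B j) ≤ 1 - p := by
    intro j
    have hc : (B j)ᶜ = pairSum s a (n * M ^ j) (n * M ^ (j + 1)) ⁻¹'
        Set.Iic (-(2 * (σ * √(n * M ^ (j + 1) : ℕ)))) := by
      ext X; simp [B]
    have h1 : p ≤ (stackLaw σ).real (B j)ᶜ := by
      rw [hc, ← map_measureReal_apply (measurable_pairSum _ _ _ _) measurableSet_Iic,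
        map_pairSum σ hs]
      refine le_gaussianReal_le _ (by positivity) ?_
      rw [mul_pow, Real.sq_sqrt (by positivity)]
      simp only [NNReal.coe_mul, NNReal.coe_natCast, NNReal.coe_ofNat, coe_toNNReal_sq]
      have h2 : (n * M ^ (j + 1) : ℕ) ≤ 2 * (n * M ^ (j + 1) - n * M ^ j) := by
        have : 2 * (n * M ^ j) ≤ n * M ^ (j + 1) := by
          rw [pow_succ]
          calc 2 * (n * M ^ j) ≤ M * (n * M ^ j) := Nat.mul_le_mul_right _ hM
            _ = _ := by ring
        omega
      have h3 : ((n * M ^ (j + 1) : ℕ) : ℝ) ≤ 2 * ((n * M ^ (j + 1) - n * M ^ j : ℕ) : ℝ) := by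
        exact_mod_cast h2
      nlinarith [sq_nonneg σ]
    have h2 := probReal_compl_eq_one_sub (μ := stackLaw σ) (hB j)
    linarith
  have hC : ∀ J, {X | ∀ j < J, X ∈ B j} = ⋂ j, ⋂ (_ : j < J), B j := fun J => by ext; simp
  change (stackLaw σ).real {X | ∀ j < J, X ∈ B j} ≤ _
  induction J with
  | zero => simp
  | succ J ih =>
    have hsplit : {X | ∀ j < J + 1, X ∈ B j} = {X | ∀ j < J, X ∈ B j} ∩ B J := by
      ext X
      simp only [Set.mem_ofPred_eq, Set.mem_inter_iff]
      constructor
      · exact fun h => ⟨fun j hj => h j (by omega), h J (by omega)⟩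
      · rintro ⟨h1, h2⟩ j hj
        rcases Nat.lt_succ_iff_lt_or_eq.1 hj with h | rfl
        exacts [h1 j h, h2]
    have hind := measure_inter_of_dependsOn (fun _ : ℕ × ℕ => gaussianReal 0 (Real.toNNReal (σ ^ 2)))
      (S := ({a, a + 1} : Finset ℕ) ×ˢ Finset.range (n * M ^ J))
      (T := ({a, a + 1} : Finset ℕ) ×ˢ Finset.Ico (n * M ^ J) (n * M ^ (J + 1)))
      (A := {X | ∀ j < J, X ∈ B j}) (B := B J) ?_ ?_ (hB J) ?_ ?_
    · have hr : (stackLaw σ).real ({X | ∀ j < J, X ∈ B j} ∩ B J)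
          = (stackLaw σ).real {X | ∀ j < J, X ∈ B j} * (stackLaw σ).real (B J) := by
        simp only [measureReal_def, ← ENNReal.toReal_mul]
        exact congrArg _ hind
      rw [hsplit, hr, pow_succ]
      exact mul_le_mul ih (hBp J) measureReal_nonneg (pow_nonneg (by linarith) _)
    · rw [Finset.disjoint_left]
      intro x hx hx'
      simp only [Finset.mem_product, Finset.mem_range, Finset.mem_Ico] at hx hx'
      omega
    · rw [hC]
      exact .iInter fun j => .iInter fun _ => hB j
    · intro X Y hXY hX j hj
      have h1 : pairSum s a (n * M ^ j) (n * M ^ (j + 1)) Y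
          = pairSum s a (n * M ^ j) (n * M ^ (j + 1)) X := by
        refine Finset.sum_congr rfl fun i hi => ?_
        have hi' : i ∈ Finset.range (n * M ^ J) :=
          Finset.mem_range.2 ((Finset.mem_Ico.1 hi).2.trans_le (hmono hj))
        rw [hXY (a, i) (Finset.mk_mem_product (by simp) hi'),
          hXY (a + 1, i) (Finset.mk_mem_product (by simp) hi')]
      have := hX j hj
      simp only [B, Set.mem_ofPred_eq] at this ⊢
      rwa [h1]
    · intro X Y hXY hX
      have h1 : pairSum s a (n * M ^ J) (n * M ^ (J + 1)) Y
          = pairSum s a (n * M ^ J) (n * M ^ (J + 1)) X := by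
        refine Finset.sum_congr rfl fun i hi => ?_
        rw [hXY (a, i) (Finset.mk_mem_product (by simp) hi),
          hXY (a + 1, i) (Finset.mk_mem_product (by simp) hi)]
      simp only [B, Set.mem_ofPred_eq] at hX ⊢
      rwa [h1]

/-- Let L = σ√(nM^{j+1}). A drop of 2L over a block that starts below L ends at most at -L, which is
a dip. Starting at L or above has probability at most exp(-M/4), because the plays before the block
are fewer by the factor M. -/
theorem dips_compl_le (hσ : 0 < σ) {s : ℝ} (hs : s ^ 2 = 1) (a : ℕ) {n M : ℕ} (hn : 1 ≤ n)
    (hM : 2 ≤ M) (J : ℕ) {m : ℕ} (hm : n * M ^ J ≤ m) :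
    (stackLaw σ).real (Dips σ s a n m)ᶜ
      ≤ (1 - (gaussianReal 0 1).real (Set.Iic (-2))) ^ J + J * Real.exp (-(M / 4)) := by
  have hmono : Monotone fun j => n * M ^ j := fun i j hij =>
    Nat.mul_le_mul_left _ (Nat.pow_le_pow_right (by omega) hij)
  let E : ℕ → Set (ℕ × ℕ → ℝ) := fun j =>
    {X | σ * √(n * M ^ (j + 1) : ℕ) ≤ pairSum s a 0 (n * M ^ j) X}
  have hsub : (Dips σ s a n m)ᶜ ⊆ {X | ∀ j < J, -(2 * (σ * √(n * M ^ (j + 1) : ℕ)))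
        < pairSum s a (n * M ^ j) (n * M ^ (j + 1)) X} ∪ ⋃ j ∈ Finset.range J, E j := by
    intro X hX
    by_contra hcon
    simp only [Set.mem_union, Set.mem_ofPred_eq, Set.mem_iUnion, Finset.mem_range, not_or,
      not_forall, not_exists, not_lt] at hcon
    obtain ⟨⟨j, hj, h1⟩, h2⟩ := hcon
    have h3 := not_le.1 (show ¬ σ * √(n * M ^ (j + 1) : ℕ) ≤ pairSum s a 0 (n * M ^ j) X from h2 j hj)
    refine hX ⟨n * M ^ (j + 1), ?_, (hmono hj).trans hm, ?_⟩
    · exact Nat.le_mul_of_pos_right _ (by positivity)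
    · rw [← pairSum_zero, ← pairSum_add s a (Nat.zero_le _) (hmono (Nat.le_succ j))]
      simp only [Nat.succ_eq_add_one]
      linarith
  have hE : ∀ j ∈ Finset.range J, (stackLaw σ).real (E j) ≤ Real.exp (-(M / 4)) := by
    intro j _
    have h1 : E j = pairSum s a 0 (n * M ^ j) ⁻¹' Set.Ici (σ * √(n * M ^ (j + 1) : ℕ)) := rfl
    rw [h1, ← map_measureReal_apply (measurable_pairSum _ _ _ _) measurableSet_Ici,
      map_pairSum σ hs]
    refine (gaussianReal_ge_le _ (by positivity)).trans_eq ?_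
    rw [mul_pow, Real.sq_sqrt (by positivity)]
    simp only [NNReal.coe_mul, NNReal.coe_natCast, NNReal.coe_ofNat, coe_toNNReal_sq, Nat.sub_zero]
    push_cast
    congr 2
    have : (n : ℝ) ≠ 0 := by positivity
    have : (M : ℝ) ≠ 0 := by positivity
    field_simp
    ring
  calc _ ≤ _ := (measureReal_mono hsub).trans (measureReal_union_le _ _)
    _ ≤ (1 - (gaussianReal 0 1).real (Set.Iic (-2))) ^ J + J * Real.exp (-(M / 4)) := by
      refine add_le_add (blocks_le hσ hs a hM J) ?_
      refine (measureReal_biUnion_finset_le _ _).trans ((Finset.sum_le_sum hE).trans_eq ?_)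
      simp

/-- Long windows contain a dip with high probability. -/
theorem exists_dips_compl_le (hσ : 0 < σ) {η : ℝ} (hη : 0 < η) :
    ∃ u₀, ∀ u, u₀ ≤ u → ∀ n, 1 ≤ n → ∀ (a : ℕ) (s : ℝ), s ^ 2 = 1 →
      (stackLaw σ).real (Dips σ s a n (n * u))ᶜ ≤ η := by
  set p := (gaussianReal 0 1).real (Set.Iic (-2)) with hp
  have hp0 : 0 < p := by
    rw [hp, measureReal_def]
    refine ENNReal.toReal_pos ?_ (measure_ne_top _ _)
    intro h
    have := gaussianReal_absolutelyContinuous' 0 (v := 1) one_ne_zero h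
    simp at this
  have hp1 : p ≤ 1 := measureReal_le_one
  -- The number of blocks is fixed first, so that a large ratio M can then absorb the factor J in J
  -- exp(-M/4). The window ratio M^J does not depend on `n`.
  obtain ⟨J, hJ⟩ := exists_pow_lt_of_lt_one (half_pos hη) (show 1 - p < 1 by linarith)
  have hlim : Tendsto (fun M : ℕ => (J : ℝ) * Real.exp (-((M : ℝ) / 4))) atTop (𝓝 (J * 0)) := by
    refine Tendsto.const_mul _ (Real.tendsto_exp_atBot.comp (tendsto_neg_atTop_atBot.comp ?_))
    exact tendsto_natCast_atTop_atTop.atTop_div_const (by norm_num)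
  rw [mul_zero] at hlim
  obtain ⟨M, hM, hM2⟩ := ((hlim.eventually (gt_mem_nhds (half_pos hη))).and
    (eventually_ge_atTop 2)).exists
  refine ⟨M ^ J, fun u hu n hn a s hs => ?_⟩
  have := dips_compl_le hσ hs a hn hM2 J (m := n * u) (Nat.mul_le_mul_left _ hu)
  linarith

end Walks

/-! ### Exploration -/

section Exploration

variable {K N : ℕ} {σ : ℝ} {tie : ℕ → Finset ℕ → ℕ} {δ : ℝ} {H : ℕ → History}

/-- The condition for a round of forced exploration. -/
def Forced (K : ℕ) (h : History) : Prop :=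
  ∃ i ∈ Finset.Icc 1 K, (plays h i : ℝ) < Real.sqrt h.length

namespace IsRun

theorem sample_of_forced (hH : IsRun K N σ tie δ H)
    (htie : ∀ (t : ℕ) (s : Finset ℕ), s.Nonempty → tie t s ∈ s) {t : ℕ} (hKt : K ≤ t)
    (hF : Forced K (H t)) :
    mcpiSample K N σ tie δ (H t) ∈ Finset.Icc 1 K ∧
      (∀ b ∈ Finset.Icc 1 K, plays (H t) (mcpiSample K N σ tie δ (H t)) ≤ plays (H t) b) ∧
      (plays (H t) (mcpiSample K N σ tie δ (H t)) : ℝ) < √t := by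
  obtain ⟨i, hi, hlt⟩ := id hF
  have hs : mcpiSample K N σ tie δ (H t) = leastPlayed tie (H t) (Finset.Icc 1 K) := by
    rw [mcpiSample, if_neg (by rw [hH.length_eq]; omega), if_pos (show ∃ i ∈ Finset.Icc 1 K, (plays (H t) i : ℝ) < Real.sqrt (H t).length from hF)]
  obtain ⟨h1, h2⟩ := leastPlayed_mem_filter htie (H t) ⟨i, hi⟩
  rw [hs]
  rw [hH.length_eq] at hlt
  exact ⟨h1, h2, lt_of_le_of_lt (by exact_mod_cast h2 i hi) hlt⟩

theorem sample_of_not_forced (hH : IsRun K N σ tie δ H)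
    (htie : ∀ (t : ℕ) (s : Finset ℕ), s.Nonempty → tie t s ∈ s) {t e : ℕ} (hKt : K ≤ t)
    (hF : ¬ Forced K (H t)) (he : (mcpiState K N σ tie δ (H t)).est = e) :
    (mcpiSample K N σ tie δ (H t) = e ∧ plays (H t) e ≤ plays (H t) (e + 1)) ∨
      (mcpiSample K N σ tie δ (H t) = e + 1 ∧ plays (H t) (e + 1) ≤ plays (H t) e) := by
  have hs : mcpiSample K N σ tie δ (H t) = leastPlayed tie (H t) {e, e + 1} := by
    rw [mcpiSample, if_neg (by rw [hH.length_eq]; omega), 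
      if_neg (show ¬ ∃ i ∈ Finset.Icc 1 K, (plays (H t) i : ℝ) < Real.sqrt (H t).length from hF), he]
  obtain ⟨h1, h2⟩ := leastPlayed_mem_filter htie (H t) (S := {e, e + 1}) ⟨e, by simp⟩
  rw [hs]
  rcases Finset.mem_insert.1 h1 with h | h
  · left
    rw [h] at h2
    exact ⟨h, h2 _ (by simp)⟩
  · right
    rw [Finset.mem_singleton] at h
    rw [h] at h2
    exact ⟨h, h2 _ (by simp)⟩

/-- From round n² + K on, an arm with fewer than `n` plays triggers forced exploration, which raises
Φ, the sum of the counts truncated at `n`. As Φ is at most Kn, this lasts at most Kn rounds. -/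
theorem le_plays (hH : IsRun K N σ tie δ H)
    (htie : ∀ (t : ℕ) (s : Finset ℕ), s.Nonempty → tie t s ∈ s) {n t a : ℕ}
    (ht : n ^ 2 + K + K * n ≤ t) (ha : a ∈ Finset.Icc 1 K) : n ≤ plays (H t) a := by
  let Φ : ℕ → ℕ := fun t => ∑ i ∈ Finset.Icc 1 K, min (plays (H t) i) n
  have key : ∀ s, (∀ a ∈ Finset.Icc 1 K, n ≤ plays (H (n ^ 2 + K + s)) a) ∨
      s ≤ Φ (n ^ 2 + K + s) := by
    intro s
    induction s with
    | zero => right; simp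
    | succ s ih =>
      rcases ih with ih | ih
      · left
        exact fun a ha => (ih a ha).trans (hH.plays_mono a (by omega))
      · by_cases hall : ∀ a ∈ Finset.Icc 1 K, n ≤ plays (H (n ^ 2 + K + s)) a
        · left
          exact fun a ha => (hall a ha).trans (hH.plays_mono a (by omega))
        · right
          push Not at hall
          obtain ⟨i, hi, hlt⟩ := hall
          set t := n ^ 2 + K + s with ht
          have hF : Forced K (H t) := by
            refine ⟨i, hi, ?_⟩
            rw [hH.length_eq]
            refine Real.lt_sqrt_of_sq_lt ?_
            have h1 : plays (H t) i ^ 2 < n ^ 2 := Nat.pow_lt_pow_left hlt two_ne_zero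
            have h2 : plays (H t) i ^ 2 < t := by omega
            exact_mod_cast h2
          obtain ⟨h1, h2, -⟩ := hH.sample_of_forced htie (by omega) hF
          have h3 := (h2 i hi).trans_lt hlt
          have h4 : Φ t < Φ (t + 1) := by
            refine Finset.sum_lt_sum (fun j _ => min_le_min_right _ (hH.plays_mono j (Nat.le_succ t)))
              ⟨_, h1, ?_⟩
            rw [hH.plays_succ, if_pos rfl]
            omega
          have e : n ^ 2 + K + (s + 1) = t + 1 := by omega
          rw [e]
          omega
  have hfin : ∀ a ∈ Finset.Icc 1 K, n ≤ plays (H (n ^ 2 + K + K * n)) a := by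
    rcases key (K * n) with h | h
    · exact h
    · intro a ha
      by_contra hlt
      have h1 : Φ (n ^ 2 + K + K * n) < ∑ i ∈ Finset.Icc 1 K, n :=
        Finset.sum_lt_sum (fun j _ => min_le_right _ _) ⟨a, ha, by omega⟩
      simp at h1
      omega
  exact (hfin a ha).trans (hH.plays_mono a ht)

-- A forced round plays an arm with fewer than √T plays, so each arm is forced at most √T + 1 times.
open Classical in
theorem card_forced_le (hH : IsRun K N σ tie δ H)
    (htie : ∀ (t : ℕ) (s : Finset ℕ), s.Nonempty → tie t s ∈ s) (T : ℕ) :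
    (((Finset.range T).filter fun s => K ≤ s ∧ Forced K (H s)).card : ℝ) ≤ K * (√T + 1) := by
  have key : ∀ i, ∀ t ≤ T, ((Finset.range t).filter fun s => (K ≤ s ∧ Forced K (H s)) ∧
      mcpiSample K N σ tie δ (H s) = i).card ≤ plays (H t) i ∧
      (((Finset.range t).filter fun s => (K ≤ s ∧ Forced K (H s)) ∧
      mcpiSample K N σ tie δ (H s) = i).card : ℝ) ≤ √T + 1 := by
    intro i t
    induction t with
    | zero => intro _; simp; positivity
    | succ t ih =>
      intro ht
      obtain ⟨ih1, ih2⟩ := ih (by omega)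
      have hmono := hH.plays_mono i (Nat.le_succ t)
      rw [Finset.range_add_one, Finset.filter_insert]
      split_ifs with hc
      · rw [Finset.card_insert_of_notMem (by simp)]
        obtain ⟨-, -, h3⟩ := hH.sample_of_forced htie hc.1.1 hc.1.2
        rw [hc.2] at h3
        constructor
        · rw [hH.plays_succ, if_pos hc.2]
          omega
        · push_cast
          have h4 : (((Finset.range t).filter fun s => (K ≤ s ∧ Forced K (H s)) ∧
            mcpiSample K N σ tie δ (H s) = i).card : ℝ) ≤ plays (H t) i := by exact_mod_cast ih1
          have h5 : √(t : ℝ) ≤ √T := Real.sqrt_le_sqrt (by exact_mod_cast (by omega : t ≤ T))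
          linarith
      · exact ⟨ih1.trans hmono, ih2⟩
  have hmaps : ∀ s ∈ (Finset.range T).filter fun s => K ≤ s ∧ Forced K (H s),
      mcpiSample K N σ tie δ (H s) ∈ Finset.Icc 1 K := fun s hs => by
    have h := (Finset.mem_filter.1 hs).2
    exact (hH.sample_of_forced htie h.1 h.2).1
  rw [Finset.card_eq_sum_card_fiberwise hmaps]
  push_cast
  calc _ ≤ ∑ i ∈ Finset.Icc 1 K, (√T + 1) := by
        refine Finset.sum_le_sum fun i _ => ?_
        rw [Finset.filter_filter]
        exact (key i T le_rfl).2
    _ = _ := by simp [mul_add]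

end IsRun

open Classical in
/-- The number of rounds of `[H₀, T)` without forced exploration and with the estimate `a`. -/
noncomputable def estCount (K N : ℕ) (σ : ℝ) (tie : ℕ → Finset ℕ → ℕ) (δ : ℝ) (H : ℕ → History)
    (H₀ a T : ℕ) : ℕ :=
  ((Finset.range T).filter fun s => (H₀ ≤ s ∧ ¬ Forced K (H s)) ∧
    (mcpiState K N σ tie δ (H s)).est = a).card

theorem estCount_succ_of {H₀ a T : ℕ} (h : (H₀ ≤ T ∧ ¬ Forced K (H T)) ∧
    (mcpiState K N σ tie δ (H T)).est = a) :
    estCount K N σ tie δ H H₀ a (T + 1) = estCount K N σ tie δ H H₀ a T + 1 := by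
  rw [estCount, Finset.range_add_one, Finset.filter_insert, if_pos h,
    Finset.card_insert_of_notMem (by simp), estCount]

theorem estCount_succ_of_not {H₀ a T : ℕ} (h : ¬ ((H₀ ≤ T ∧ ¬ Forced K (H T)) ∧
    (mcpiState K N σ tie δ (H T)).est = a)) :
    estCount K N σ tie δ H H₀ a (T + 1) = estCount K N σ tie δ H H₀ a T := by
  rw [estCount, Finset.range_add_one, Finset.filter_insert, if_neg h, estCount]

/-- Each counted round plays the less played arm of the pair. The third bound carries the induction:
if `a` is played then plays(a) ≤ plays(a+1), so the count so far is at most twice plays(a+1). -/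
theorem IsRun.estCount_le (hH : IsRun K N σ tie δ H)
    (htie : ∀ (t : ℕ) (s : Finset ℕ), s.Nonempty → tie t s ∈ s) {H₀ : ℕ} (hK : K ≤ H₀) (a T : ℕ) :
    estCount K N σ tie δ H H₀ a T ≤ 2 * plays (H T) a + 1 ∧
    estCount K N σ tie δ H H₀ a T ≤ 2 * plays (H T) (a + 1) + 1 ∧
    estCount K N σ tie δ H H₀ a T ≤ plays (H T) a + plays (H T) (a + 1) := by
  induction T with
  | zero => simp [estCount]
  | succ T ih =>
    have e1 := hH.plays_succ T a
    have e2 := hH.plays_succ T (a + 1)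
    by_cases hc : (H₀ ≤ T ∧ ¬ Forced K (H T)) ∧ (mcpiState K N σ tie δ (H T)).est = a
    · rw [estCount_succ_of hc]
      rcases hH.sample_of_not_forced htie (hK.trans hc.1.1) hc.1.2 hc.2 with ⟨h1, h2⟩ | ⟨h1, h2⟩
      · rw [if_pos h1] at e1
        rw [if_neg (by omega)] at e2
        omega
      · rw [if_neg (by omega)] at e1
        rw [if_pos h1] at e2
        omega
    · rw [estCount_succ_of_not hc]
      omega

theorem IsRun.le_sum_estCount (hH : IsRun K N σ tie δ H)
    (htie : ∀ (t : ℕ) (s : Finset ℕ), s.Nonempty → tie t s ∈ s) {H₀ T : ℕ} (hK : K ≤ H₀)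
    {A : Finset ℕ} (hA : ∀ s, H₀ ≤ s → s < T → ¬ Forced K (H s) →
      (mcpiState K N σ tie δ (H s)).est ∈ A) :
    (T : ℝ) ≤ H₀ + K * (√T + 1) + ∑ a ∈ A, (estCount K N σ tie δ H H₀ a T : ℝ) := by
  classical
  have hsub : Finset.range T ⊆ (Finset.range H₀ ∪ (Finset.range T).filter fun s =>
      K ≤ s ∧ Forced K (H s)) ∪ (Finset.range T).filter fun s => H₀ ≤ s ∧ ¬ Forced K (H s) := by
    intro s hs
    simp only [Finset.mem_union, Finset.mem_filter, Finset.mem_range] at hs ⊢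
    rcases Nat.lt_or_ge s H₀ with h | h
    · exact .inl (.inl h)
    · by_cases hF : Forced K (H s)
      · exact .inl (.inr ⟨hs, by omega, hF⟩)
      · exact .inr ⟨hs, h, hF⟩
  have h1 := (Finset.card_le_card hsub).trans ((Finset.card_union_le _ _).trans
    (Nat.add_le_add_right (Finset.card_union_le _ _) _))
  have hmaps : ∀ s ∈ (Finset.range T).filter fun s => H₀ ≤ s ∧ ¬ Forced K (H s),
      (mcpiState K N σ tie δ (H s)).est ∈ A := fun s hs => by
    obtain ⟨h1, h2, h3⟩ := Finset.mem_filter.1 hs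
    exact hA s h2 (Finset.mem_range.1 h1) h3
  rw [Finset.card_eq_sum_card_fiberwise hmaps, Finset.card_range, Finset.card_range] at h1
  simp only [Finset.filter_filter] at h1
  have h2 := hH.card_forced_le htie T
  have h3 : (T : ℝ) ≤ H₀ + ((Finset.range T).filter fun s => K ≤ s ∧ Forced K (H s)).card
      + ∑ a ∈ A, (estCount K N σ tie δ H H₀ a T : ℝ) := by
    unfold estCount
    exact_mod_cast h1
  linarith

end Exploration

/-! ### Runs with accurate estimates -/

section Accurate

/-- The magnitude of the change at `a`. -/
def change (μ : ℕ → ℝ) (a : ℕ) : ℝ := |μ a - μ (a + 1)|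

/-- A positive lower bound for the changes and for the differences between distinct changes. -/
structure IsGap (K : ℕ) (μ : ℕ → ℝ) (g : ℝ) : Prop where
  pos : 0 < g
  le_change : ∀ a ∈ changePoints K μ, g ≤ change μ a
  le_sub : ∀ a ∈ Finset.Icc 1 (K - 1), ∀ b ∈ Finset.Icc 1 (K - 1), change μ a < change μ b →
    g ≤ change μ b - change μ a

theorem mem_changePoints {K : ℕ} {μ : ℕ → ℝ} {a : ℕ} :
    a ∈ changePoints K μ ↔ a ∈ Finset.Icc 1 (K - 1) ∧ μ a ≠ μ (a + 1) := by
  simp [changePoints]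

theorem change_pos_iff {K : ℕ} {μ : ℕ → ℝ} {a : ℕ} (ha : a ∈ Finset.Icc 1 (K - 1)) :
    0 < change μ a ↔ a ∈ changePoints K μ := by
  rw [mem_changePoints, change, abs_pos, sub_ne_zero]
  exact (and_iff_right ha).symm

theorem exists_isGap (K : ℕ) (μ : ℕ → ℝ) : ∃ g, IsGap K μ g := by
  classical
  let S : Finset ℝ := (((changePoints K μ).image (change μ)) ∪
    ((Finset.Icc 1 (K - 1) ×ˢ Finset.Icc 1 (K - 1)).image
      fun p => change μ p.2 - change μ p.1)).filter (0 < ·)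
  rcases S.eq_empty_or_nonempty with hS | hS
  · refine ⟨1, one_pos, fun a ha => ?_, fun a ha b hb hab => ?_⟩
    · have : change μ a ∈ S := Finset.mem_filter.2 ⟨Finset.mem_union_left _
        (Finset.mem_image_of_mem _ ha), (change_pos_iff (mem_changePoints.1 ha).1).2 ha⟩
      simp [hS] at this
    · have : change μ b - change μ a ∈ S := Finset.mem_filter.2 ⟨Finset.mem_union_right _
        (Finset.mem_image.2 ⟨(a, b), Finset.mk_mem_product ha hb, rfl⟩), sub_pos.2 hab⟩
      simp [hS] at this
  · refine ⟨S.min' hS, (Finset.mem_filter.1 (S.min'_mem hS)).2, fun a ha => ?_,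
      fun a ha b hb hab => ?_⟩
    · exact S.min'_le _ (Finset.mem_filter.2 ⟨Finset.mem_union_left _
        (Finset.mem_image_of_mem _ ha), (change_pos_iff (mem_changePoints.1 ha).1).2 ha⟩)
    · exact S.min'_le _ (Finset.mem_filter.2 ⟨Finset.mem_union_right _
        (Finset.mem_image.2 ⟨(a, b), Finset.mk_mem_product ha hb, rfl⟩), sub_pos.2 hab⟩)

/-- A run of MCPI for which all the empirical means are accurate from the round `H₀` on. -/
structure AccurateRun (K N : ℕ) (σ : ℝ) (tie : ℕ → Finset ℕ → ℕ) (δ : ℝ) (μ : ℕ → ℝ) (g κ : ℝ)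
    (W : ℕ → ℕ → ℝ) (H₀ : ℕ) (H : ℕ → History) : Prop extends IsRun K N σ tie δ H where
  tie_mem : ∀ (t : ℕ) (s : Finset ℕ), s.Nonempty → tie t s ∈ s
  one_le : 1 ≤ N
  card_le : N ≤ (changePoints K μ).card
  sep : ∀ i ∈ changePoints K μ, ∀ j ∈ changePoints K μ, i < j → i + 1 < j
  sigma_pos : 0 < σ
  gap : IsGap K μ g
  kappa_pos : 0 < κ
  kappa_le : κ ≤ 1 / 8
  K_le : K ≤ H₀
  mean : ∀ t a, plays (H t) a ≠ 0 →
    empMean (H t) a = μ a + W a (plays (H t) a) / plays (H t) a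
  acc : ∀ t, H₀ ≤ t → ∀ a ∈ Finset.Icc 1 K, |W a (plays (H t) a)| < κ * g * plays (H t) a
  update : ∀ t : ℕ, H₀ ≤ t →
    K = 2 ∨ ((K : ℝ) < (t : ℝ) ^ (1 / 4 : ℝ) ∧ σ * radius K t < g / 2)

namespace AccurateRun

variable {K N : ℕ} {σ : ℝ} {tie : ℕ → Finset ℕ → ℕ} {δ : ℝ} {μ : ℕ → ℝ} {g κ : ℝ}
  {W : ℕ → ℕ → ℝ} {H₀ : ℕ} {H : ℕ → History}

theorem le_sub_one (h : AccurateRun K N σ tie δ μ g κ W H₀ H) : N ≤ K - 1 := by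
  refine h.card_le.trans ?_
  exact (Finset.card_le_card (Finset.filter_subset _ _)).trans_eq (by simp)

theorem two_le (h : AccurateRun K N σ tie δ μ g κ W H₀ H) : 2 ≤ K := by
  have := h.le_sub_one
  have := h.one_le
  omega

theorem abs_empMean_sub (h : AccurateRun K N σ tie δ μ g κ W H₀ H) {t : ℕ} (ht : H₀ ≤ t) {a : ℕ}
    (ha : a ∈ Finset.Icc 1 K) : |empMean (H t) a - μ a| ≤ κ * g := by
  have h1 := h.one_le_plays ha (h.K_le.trans ht)
  have h1' : (0 : ℝ) < plays (H t) a := by exact_mod_cast h1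
  rw [h.mean t a (by omega), add_sub_cancel_left, abs_div, abs_of_pos h1', div_le_iff₀ h1']
  exact (h.acc t ht a ha).le

theorem mem_Icc_of_mem {a : ℕ} (ha : a ∈ Finset.Icc 1 (K - 1)) :
    a ∈ Finset.Icc 1 K ∧ a + 1 ∈ Finset.Icc 1 K := by
  simp only [Finset.mem_Icc] at ha ⊢
  omega

theorem abs_empChange_sub (h : AccurateRun K N σ tie δ μ g κ W H₀ H) {t : ℕ} (ht : H₀ ≤ t) {a : ℕ}
    (ha : a ∈ Finset.Icc 1 (K - 1)) : |empChange (H t) a - change μ a| ≤ 2 * (κ * g) := by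
  obtain ⟨h1, h2⟩ := mem_Icc_of_mem ha
  have h3 := h.abs_empMean_sub ht h1
  have h4 := h.abs_empMean_sub ht h2
  rw [empChange, change]
  refine (abs_abs_sub_abs_le_abs_sub _ _).trans ?_
  calc |empMean (H t) a - empMean (H t) (a + 1) - (μ a - μ (a + 1))|
      = |(empMean (H t) a - μ a) - (empMean (H t) (a + 1) - μ (a + 1))| := by congr 1; ring
    _ ≤ |empMean (H t) a - μ a| + |empMean (H t) (a + 1) - μ (a + 1)| := abs_sub _ _
    _ ≤ _ := by linarith

theorem updateCond (h : AccurateRun K N σ tie δ μ g κ W H₀ H) {t : ℕ} (ht : H₀ ≤ t) :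
    UpdateCond K σ (H t) ∨ K = 2 := by
  rcases h.update t ht with hK | ⟨h1, h2⟩
  · exact .inr hK
  by_cases hK2 : K = 2
  · exact .inr hK2
  left
  have hK := h.two_le
  obtain ⟨i, hi⟩ : (changePoints K μ).Nonempty :=
    Finset.card_pos.1 (by have := h.card_le; have := h.one_le; omega)
  have hi1 := (mem_changePoints.1 hi).1
  -- For K ≥ 3, separation prevents 1 and 2 from both being change points. A position without change
  -- against one with change at least `g` then triggers the update: errors use up at most half of
  -- `g`, and σr(t) < g/2.
  obtain ⟨j, hj, hjc⟩ : ∃ j ∈ Finset.Icc 1 (K - 1), j ∉ changePoints K μ := by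
    by_contra hcon
    push Not at hcon
    have := h.sep 1 (hcon 1 (by simp; omega)) 2 (hcon 2 (by simp; omega)) (by omega)
    omega
  have hj0 : change μ j = 0 := by
    have h3 : ¬ 0 < change μ j := fun h' => hjc ((change_pos_iff hj).1 h')
    have h4 : 0 ≤ change μ j := abs_nonneg _
    linarith
  have h3 := abs_le.1 (h.abs_empChange_sub ht hi1)
  have h4 := abs_le.1 (h.abs_empChange_sub ht hj)
  have h5 := h.gap.le_change i hi
  have h6 : κ * g ≤ 1 / 8 * g := mul_le_mul_of_nonneg_right h.kappa_le h.gap.pos.le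
  refine ⟨by rwa [h.length_eq], i, hi1, j, hj, ?_⟩
  rw [h.length_eq]
  linarith [h3.1, h4.2]

/-- The estimate is the best of the remaining candidates. -/
theorem est_spec (h : AccurateRun K N σ tie δ μ g κ W H₀ H) {t : ℕ} (ht : H₀ ≤ t)
    (hc : (mcpiState K N σ tie δ (H t)).found.card < N) :
    (mcpiState K N σ tie δ (H t)).est ∈ changePoints K μ ∧
    ∀ b ∈ Finset.Icc 1 (K - 1), b ∉ (mcpiState K N σ tie δ (H t)).found →
      empChange (H t) b ≤ empChange (H t) (mcpiState K N σ tie δ (H t)).est ∧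
      change μ b ≤ change μ (mcpiState K N σ tie δ (H t)).est := by
  have hNK := h.le_sub_one
  have hK := h.two_le
  have hKl := h.K_le
  obtain ⟨t, rfl⟩ : ∃ s, t = s + 1 := ⟨t - 1, by omega⟩
  obtain ⟨y, hy⟩ := h.succ t
  have hl := h.length_eq (t + 1)
  have hU := h.updateCond ht
  have hacc := fun a ha => h.abs_empChange_sub ht (a := a) ha
  rw [hy] at hl hU hc hacc ⊢
  have hKle : K ≤ List.length ((mcpiSample K N σ tie δ (H t), y) :: H t) := by omega
  have hr := stateReady_mcpiState (σ := σ) (δ := δ) h.tie_mem hNK hKle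
  have hmax := est_isMax (σ := σ) (δ := δ) h.tie_mem hNK hKle hU hc
  have hmem := hr.est_mem hc
  rw [hr.cand_eq] at hmax hmem
  set e := (mcpiState K N σ tie δ ((mcpiSample K N σ tie δ (H t), y) :: H t)).est
  set F := (mcpiState K N σ tie δ ((mcpiSample K N σ tie δ (H t), y) :: H t)).found
  have he1 := (Finset.mem_sdiff.1 hmem).1
  -- Two empirical changes together err by at most 4κg ≤ g/2, too little to reverse an order with
  -- gap `g`.
  have hb : ∀ b ∈ Finset.Icc 1 (K - 1), b ∉ F → change μ b ≤ change μ e := by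
    intro b hb hbF
    by_contra hlt
    have h1 := h.gap.le_sub e he1 b hb (not_le.1 hlt)
    have h2 := hmax b (Finset.mem_sdiff.2 ⟨hb, hbF⟩)
    have h3 := abs_le.1 (hacc e he1)
    have h4 := abs_le.1 (hacc b hb)
    have h6 : κ * g ≤ 1 / 8 * g := mul_le_mul_of_nonneg_right h.kappa_le h.gap.pos.le
    have := h.gap.pos
    linarith [h3.2, h4.1]
  refine ⟨?_, fun b hb' hbF => ⟨hmax b (Finset.mem_sdiff.2 ⟨hb', hbF⟩), hb b hb' hbF⟩⟩
  -- Fewer than `N` positions are recorded, so some change point remains and the best candidate has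
  -- a positive change.
  obtain ⟨c, hc1, hc2⟩ : ∃ c ∈ changePoints K μ, c ∉ F := by
    by_contra hcon
    push Not at hcon
    have := Finset.card_le_card (show changePoints K μ ⊆ F from hcon)
    have := h.card_le
    omega
  have hc3 := (mem_changePoints.1 hc1).1
  exact (change_pos_iff he1).1 (((change_pos_iff hc3).2 hc1).trans_le (hb c hc3 hc2))

end AccurateRun

end Accurate

/-! ### Time spent on an estimate, and the competition between tied changes. -/

section Phases

theorem threshold_mono {K N : ℕ} {δ : ℝ} (hK : 2 ≤ K) (hN : 1 ≤ N) (hδ : 0 < δ) (hδ1 : δ < 1)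
    {s t : ℕ} (hs : 1 ≤ s) (hst : s ≤ t) : threshold K s (δ / N) ≤ threshold K t (δ / N) := by
  have hA := le_logConst hK hN hδ hδ1
  have hs' : (1 : ℝ) ≤ s := by exact_mod_cast hs
  have h1 : Real.log s ≤ Real.log t :=
    Real.log_le_log (by linarith) (by exact_mod_cast hst)
  have h0 : 0 ≤ Real.log s := Real.log_nonneg hs'
  rw [threshold_eq hK hN hδ hs, threshold_eq hK hN hδ (hs.trans hst)]
  have h2 : Real.log (Real.log s + logConst K N δ) ≤ Real.log (Real.log t + logConst K N δ) :=
    Real.log_le_log (by linarith) (by linarith)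
  linarith

theorem threshold_nonneg {K N : ℕ} {δ : ℝ} (hK : 2 ≤ K) (hN : 1 ≤ N) (hδ : 0 < δ) (hδ1 : δ < 1)
    {t : ℕ} (ht : 1 ≤ t) : 0 ≤ threshold K t (δ / N) := by
  have hA := le_logConst hK hN hδ hδ1
  have h0 : 0 ≤ Real.log t := Real.log_nonneg (by exact_mod_cast ht)
  have h1 : 0 ≤ Real.log (Real.log t + logConst K N δ) := Real.log_nonneg (by linarith)
  rw [threshold_eq hK hN hδ ht]
  linarith

/-- If both counts are at least `p`, then nk/(n + k) ≥ p/2. -/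
theorem le_statZ {σ : ℝ} (hσ : 0 < σ) {h : History} {a p : ℕ} (h1 : p ≤ plays h a)
    (h2 : p ≤ plays h (a + 1)) {x : ℝ} (hx : 0 ≤ x) (h3 : x ≤ empChange h a) :
    p / (4 * σ ^ 2) * x ^ 2 ≤ statZ σ h a := by
  rcases Nat.eq_zero_or_pos p with rfl | hp
  · rw [statZ]
    simp
    positivity
  have hp' : (0 : ℝ) < p := by exact_mod_cast hp
  have h1' : (p : ℝ) ≤ plays h a := by exact_mod_cast h1
  have h2' : (p : ℝ) ≤ plays h (a + 1) := by exact_mod_cast h2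
  have q1 : (0 : ℝ) < plays h a := hp'.trans_le h1'
  have q2 : (0 : ℝ) < plays h (a + 1) := hp'.trans_le h2'
  rw [statZ]
  have h4 : x ^ 2 ≤ empChange h a ^ 2 := pow_le_pow_left₀ hx h3 2
  have h5 : p / (4 * σ ^ 2) ≤ (plays h a * plays h (a + 1) : ℝ)
      / (2 * σ ^ 2 * (plays h a + plays h (a + 1))) := by
    rw [div_le_div_iff₀ (by positivity) (by positivity)]
    have h6 : (p : ℝ) * (plays h a + plays h (a + 1)) ≤ 2 * (plays h a * plays h (a + 1)) := by
      nlinarith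
    have := mul_le_mul_of_nonneg_left h6 (show (0 : ℝ) ≤ 2 * σ ^ 2 by positivity)
    linarith
  gcongr

namespace AccurateRun

variable {K N : ℕ} {σ : ℝ} {tie : ℕ → Finset ℕ → ℕ} {δ : ℝ} {μ : ℕ → ℝ} {g κ : ℝ}
  {W : ℕ → ℕ → ℝ} {H₀ : ℕ} {H : ℕ → History}

theorem card_found_lt (h : AccurateRun K N σ tie δ μ g κ W H₀ H) {s t : ℕ} (hst : s ≤ t)
    (hc : (mcpiState K N σ tie δ (H t)).found.card < N) :
    (mcpiState K N σ tie δ (H s)).found.card < N :=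
  (Finset.card_le_card (h.found_mono hst)).trans_lt hc

theorem statZ_lt (h : AccurateRun K N σ tie δ μ g κ W H₀ H) {t : ℕ} (ht : H₀ ≤ t)
    (hc : (mcpiState K N σ tie δ (H t)).found.card < N) :
    statZ σ (H t) (mcpiState K N σ tie δ (H t)).est < threshold K t (δ / N) := by
  have hK := h.two_le
  have hKl := h.K_le
  obtain ⟨t, rfl⟩ : ∃ s, t = s + 1 := ⟨t - 1, by omega⟩
  obtain ⟨y, hy⟩ := h.succ t
  have hl := h.length_eq (t + 1)
  rw [hy] at hc hl ⊢
  have := statZ_lt_of_card_lt (σ := σ) (δ := δ) h.tie_mem h.le_sub_one (by omega) hc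
  rwa [hl] at this

/-- The number of rounds in which an action is the estimate. -/
theorem estCount_le_of_card_lt (h : AccurateRun K N σ tie δ μ g κ W H₀ H) (hδ : 0 < δ) (hδ1 : δ < 1)
    {a : ℕ} (ha : a ∈ changePoints K μ) {T : ℕ} (hT : 1 ≤ T)
    (hc : (mcpiState K N σ tie δ (H T)).found.card < N) :
    (estCount K N σ tie δ H H₀ a T : ℝ)
      ≤ 2 + 8 * σ ^ 2 * threshold K T (δ / N) / (1 - 2 * κ) ^ 2 * (1 / change μ a ^ 2) := by
  have hK := h.two_le
  have hσ := h.sigma_pos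
  have hκ := h.kappa_le
  have hκ' : 0 < 1 - 2 * κ := by linarith
  have hg := h.gap.le_change a ha
  have hg0 := h.gap.pos
  have hΔ : 0 < change μ a := by linarith
  have hβ := threshold_nonneg hK h.one_le hδ hδ1 hT
  -- The count grows only in a round whose estimate is `a` and whose phase is still open. There Z <
  -- β bounds the smaller count p of the pair, and the estimate count is at most 2p + 1 before the
  -- round, hence the constant 2.
  suffices hs : ∀ t ≤ T, (estCount K N σ tie δ H H₀ a t : ℝ)
      ≤ 2 + 8 * σ ^ 2 * threshold K T (δ / N) / (1 - 2 * κ) ^ 2 * (1 / change μ a ^ 2) from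
    hs T le_rfl
  intro t
  induction t with
  | zero => intro _; simp [estCount]; positivity
  | succ t ih =>
    intro ht
    by_cases hcond : (H₀ ≤ t ∧ ¬ Forced K (H t)) ∧ (mcpiState K N σ tie δ (H t)).est = a
    · rw [estCount_succ_of hcond]
      obtain ⟨h1, h2, -⟩ := h.estCount_le h.tie_mem h.K_le a t
      have hKl := h.K_le
      have hlt := h.statZ_lt hcond.1.1 (h.card_found_lt (by omega) hc)
      rw [hcond.2] at hlt
      have hmono := threshold_mono hK h.one_le hδ hδ1 (s := t) (t := T) (by omega) (by omega)
      have hemp := abs_le.1 (h.abs_empChange_sub hcond.1.1 (mem_changePoints.1 ha).1)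
      have hx : (1 - 2 * κ) * change μ a ≤ empChange (H t) a := by
        have : κ * g ≤ κ * change μ a := mul_le_mul_of_nonneg_left hg h.kappa_pos.le
        linarith [hemp.1]
      obtain ⟨p, hp1, hp2, hp3⟩ : ∃ p, p ≤ plays (H t) a ∧ p ≤ plays (H t) (a + 1) ∧
          estCount K N σ tie δ H H₀ a t ≤ 2 * p + 1 :=
        ⟨min (plays (H t) a) (plays (H t) (a + 1)), min_le_left _ _, min_le_right _ _, by omega⟩
      have hZ := le_statZ hσ hp1 hp2 (by positivity) hx
      have hZ2 : p / (4 * σ ^ 2) * ((1 - 2 * κ) * change μ a) ^ 2 ≤ threshold K T (δ / N) := by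
        linarith
      have hp : (p : ℝ) ≤ 4 * σ ^ 2 * threshold K T (δ / N) / (1 - 2 * κ) ^ 2
          * (1 / change μ a ^ 2) := by
        rw [mul_one_div, div_div, le_div_iff₀ (by positivity)]
        have h3 := mul_le_mul_of_nonneg_left hZ2 (show (0 : ℝ) ≤ 4 * σ ^ 2 by positivity)
        refine le_trans (le_of_eq ?_) h3
        field_simp
      have hp4 : ((estCount K N σ tie δ H H₀ a t + 1 : ℕ) : ℝ) ≤ 2 * p + 2 := by
        exact_mod_cast (by omega)
      refine hp4.trans ?_
      have e : 8 * σ ^ 2 * threshold K T (δ / N) / (1 - 2 * κ) ^ 2 * (1 / change μ a ^ 2)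
          = 2 * (4 * σ ^ 2 * threshold K T (δ / N) / (1 - 2 * κ) ^ 2 * (1 / change μ a ^ 2)) := by
        ring
      rw [e]
      linarith
    · rw [estCount_succ_of_not hcond]
      exact ih (by omega)

/-- Rounds without forced exploration are devoted to the estimate. -/
theorem sample_pair (h : AccurateRun K N σ tie δ μ g κ W H₀ H) {t a : ℕ} (ht : H₀ ≤ t)
    (hc : (mcpiState K N σ tie δ (H t)).found.card < N) (ha : a ∈ changePoints K μ) :
    (mcpiSample K N σ tie δ (H t) = a →
      plays (H t) a ≤ plays (H t) (a + 1) ∧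
        ((plays (H t) a : ℝ) < √t ∨ (mcpiState K N σ tie δ (H t)).est = a)) ∧
    (mcpiSample K N σ tie δ (H t) = a + 1 →
      plays (H t) (a + 1) ≤ plays (H t) a ∧
        ((plays (H t) (a + 1) : ℝ) < √t ∨ (mcpiState K N σ tie δ (H t)).est = a)) := by
  obtain ⟨m1, m2⟩ := mem_Icc_of_mem (mem_changePoints.1 ha).1
  by_cases hF : Forced K (H t)
  · obtain ⟨-, h1, h2⟩ := h.sample_of_forced h.tie_mem (h.K_le.trans ht) hF
    constructor
    · intro hs
      rw [hs] at h1 h2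
      exact ⟨h1 _ m2, .inl h2⟩
    · intro hs
      rw [hs] at h1 h2
      exact ⟨h1 _ m1, .inl h2⟩
  · have hspec := (h.est_spec ht hc).1
    set e := (mcpiState K N σ tie δ (H t)).est with he
    have hs := h.sample_of_not_forced h.tie_mem (h.K_le.trans ht) hF he.symm
    have h1 := h.sep e hspec a ha
    have h2 := h.sep a ha e hspec
    constructor
    · intro hs'
      have : e = a := by omega
      rw [this] at hs
      exact ⟨by omega, .inr this⟩
    · intro hs'
      have : e = a := by omega
      rw [this] at hs
      exact ⟨by omega, .inr this⟩

/-- After `H₀` all estimates are change points, and these are separated, so within the pair of `a`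
only the less played arm is ever chosen. An imbalance inherited from the first `H₀` rounds can only
be filled up, with both counts at most `H₀` meanwhile. -/
theorem plays_balanced (h : AccurateRun K N σ tie δ μ g κ W H₀ H) {t a : ℕ} (ht : H₀ ≤ t)
    (hc : (mcpiState K N σ tie δ (H t)).found.card < N) (ha : a ∈ changePoints K μ) :
    (plays (H t) a ≤ plays (H t) (a + 1) + 1 ∧ plays (H t) (a + 1) ≤ plays (H t) a + 1) ∨
      (plays (H t) a ≤ H₀ ∧ plays (H t) (a + 1) ≤ H₀) := by
  induction t, ht using Nat.le_induction with
  | base =>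
    right
    have := h.plays_add_plays_le (show a ≠ a + 1 by omega) H₀
    omega
  | succ t ht ih =>
    have hc' := h.card_found_lt (Nat.le_succ t) hc
    have := ih hc'
    obtain ⟨h1, h2⟩ := h.sample_pair ht hc' ha
    rw [h.plays_succ, h.plays_succ]
    split_ifs with e1 e2 e2
    · omega
    · have := (h1 e1).1
      omega
    · have := (h2 e2).1
      omega
    · omega

theorem empChange_congr (h : AccurateRun K N σ tie δ μ g κ W H₀ H) {s t a : ℕ} (hs : H₀ ≤ s)
    (ha : a ∈ Finset.Icc 1 (K - 1))
    (h1 : plays (H t) a = plays (H s) a) (h2 : plays (H t) (a + 1) = plays (H s) (a + 1)) :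
    empChange (H t) a = empChange (H s) a := by
  obtain ⟨m1, m2⟩ := mem_Icc_of_mem ha
  have k1 := h.one_le_plays m1 (h.K_le.trans hs)
  have k2 := h.one_le_plays m2 (h.K_le.trans hs)
  rw [empChange, empChange, h.mean t a (by omega), h.mean t (a + 1) (by omega),
    h.mean s a (by omega), h.mean s (a + 1) (by omega), h1, h2]

/-- Once one of two rival empirical changes is low, one of them stays low. -/
theorem low_invariant (h : AccurateRun K N σ tie δ μ g κ W H₀ H) {t₀ T : ℕ} (ht₀ : H₀ ≤ t₀)
    (hc : (mcpiState K N σ tie δ (H T)).found.card < N)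
    {a b : ℕ} (ha : a ∈ changePoints K μ) (hb : b ∈ changePoints K μ) (hab : a ≠ b)
    (haF : a ∉ (mcpiState K N σ tie δ (H T)).found) (hbF : b ∉ (mcpiState K N σ tie δ (H T)).found)
    (pa : √T ≤ plays (H t₀) a) (pa' : √T ≤ plays (H t₀) (a + 1))
    (pb : √T ≤ plays (H t₀) b) (pb' : √T ≤ plays (H t₀) (b + 1)) {x : ℝ}
    (hlow : empChange (H t₀) a ≤ x ∨ empChange (H t₀) b ≤ x) {t : ℕ} (ht : t₀ ≤ t) (htT : t ≤ T) :
    empChange (H t) a ≤ x ∨ empChange (H t) b ≤ x := by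
  -- With at least √T plays each, the arms of `a` are no longer forced. If one of them is played,
  -- `a` is the estimate, so its low empirical change dominates that of `b`, which is low too.
  have step : ∀ {a b : ℕ}, a ∈ changePoints K μ → b ∈ changePoints K μ → a ≠ b →
      a ∉ (mcpiState K N σ tie δ (H T)).found → b ∉ (mcpiState K N σ tie δ (H T)).found →
      √T ≤ plays (H t₀) a → √T ≤ plays (H t₀) (a + 1) →
      ∀ s, t₀ ≤ s → s < T → empChange (H s) a ≤ x →
        empChange (H (s + 1)) a ≤ x ∨ empChange (H s) b ≤ x := by
    intro a b ha hb hab haF hbF pa pa' s hs hsT hlow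
    have hc' := h.card_found_lt hsT.le hc
    have ha' := (mem_changePoints.1 ha).1
    by_cases hplay : mcpiSample K N σ tie δ (H s) = a ∨ mcpiSample K N σ tie δ (H s) = a + 1
    · right
      have hest : (mcpiState K N σ tie δ (H s)).est = a := by
        have hsq : √(s : ℝ) ≤ √T := Real.sqrt_le_sqrt (by exact_mod_cast hsT.le)
        have q1 : (plays (H t₀) a : ℝ) ≤ plays (H s) a := by exact_mod_cast h.plays_mono a hs
        have q2 : (plays (H t₀) (a + 1) : ℝ) ≤ plays (H s) (a + 1) := by
          exact_mod_cast h.plays_mono (a + 1) hs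
        obtain ⟨h1, h2⟩ := h.sample_pair (ht₀.trans hs) hc' ha
        rcases hplay with e | e
        · exact (h1 e).2.resolve_left (by linarith)
        · exact (h2 e).2.resolve_left (by linarith)
      have h3 := ((h.est_spec (ht₀.trans hs) hc').2 b (mem_changePoints.1 hb).1
        (fun hm => hbF (h.found_mono hsT.le hm))).1
      rw [hest] at h3
      exact h3.trans hlow
    · left
      push Not at hplay
      rw [h.empChange_congr (ht₀.trans hs) ha']
      · exact hlow
      · rw [h.plays_succ, if_neg hplay.1, add_zero]
      · rw [h.plays_succ, if_neg hplay.2, add_zero]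
  -- The two pairs of arms are disjoint, so one round can lift at most one of two low values.
  have both : ∀ {a b : ℕ}, a ∈ changePoints K μ → b ∈ changePoints K μ → a ≠ b →
      ∀ s, H₀ ≤ s → empChange (H s) a ≤ x → empChange (H s) b ≤ x →
        empChange (H (s + 1)) a ≤ x ∨ empChange (H (s + 1)) b ≤ x := by
    intro a b ha hb hab s hs hla hlb
    have h1 := h.sep a ha b hb
    have h2 := h.sep b hb a ha
    by_cases hplay : mcpiSample K N σ tie δ (H s) = a ∨ mcpiSample K N σ tie δ (H s) = a + 1
    · right
      rw [h.empChange_congr hs (mem_changePoints.1 hb).1]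
      · exact hlb
      · rw [h.plays_succ, if_neg (by omega), add_zero]
      · rw [h.plays_succ, if_neg (by omega), add_zero]
    · left
      push Not at hplay
      rw [h.empChange_congr hs (mem_changePoints.1 ha).1]
      · exact hla
      · rw [h.plays_succ, if_neg hplay.1, add_zero]
      · rw [h.plays_succ, if_neg hplay.2, add_zero]
  induction t, ht using Nat.le_induction with
  | base => exact hlow
  | succ t ht ih =>
    rcases ih (by omega) with hl | hl
    · rcases step ha hb hab haF hbF pa pa' t ht (by omega) hl with h1 | h1
      · exact .inl h1
      · exact both ha hb hab t (ht₀.trans ht) hl h1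
    · rcases step hb ha hab.symm hbF haF pb pb' t ht (by omega) hl with h1 | h1
      · exact .inr h1
      · exact both ha hb hab t (ht₀.trans ht) h1 hl

theorem exists_plays_add_eq (h : AccurateRun K N σ tie δ μ g κ W H₀ H) {a n T : ℕ}
    (hn : n ≤ plays (H T) a + plays (H T) (a + 1)) :
    ∃ t ≤ T, plays (H t) a + plays (H t) (a + 1) = n := by
  induction T with
  | zero => exact ⟨0, le_rfl, by rw [h.zero] at hn ⊢; simp [plays_nil] at hn ⊢; omega⟩
  | succ T ih =>
    by_cases h1 : n ≤ plays (H T) a + plays (H T) (a + 1)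
    · obtain ⟨t, ht, h2⟩ := ih h1
      exact ⟨t, by omega, h2⟩
    · refine ⟨T + 1, le_rfl, le_antisymm ?_ hn⟩
      rw [h.plays_succ, h.plays_succ]
      split_ifs <;> omega

/-- Two equal changes cannot both be played often if one of the walks has a dip. -/
theorem not_both_heavy (h : AccurateRun K N σ tie δ μ g κ W H₀ H) {T n₁ n₂ n₃ : ℕ} {c : ℝ}
    (hc : (mcpiState K N σ tie δ (H T)).found.card < N)
    (hn₁ : H₀ < n₁) (hTn : √T ≤ n₁) (hn₁₂ : n₁ ≤ n₂) (hn₂₃ : n₂ ≤ n₃)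
    (hcn : c ≤ σ / √n₂)
    (hdip : ∀ a ∈ changePoints K μ, ∃ k, n₁ ≤ k ∧ k ≤ n₂ ∧
      (SignType.sign (μ a - μ (a + 1)) : ℝ) * (W a k - W (a + 1) k) ≤ -(σ * √k))
    (hstab : ∀ a ∈ Finset.Icc 1 K, ∀ n, n₃ ≤ n → |W a n| < c / 2 * n)
    {a b : ℕ} (ha : a ∈ changePoints K μ) (hb : b ∈ changePoints K μ) (hab : a ≠ b)
    (hΔ : change μ a = change μ b)
    (haF : a ∉ (mcpiState K N σ tie δ (H T)).found) (hbF : b ∉ (mcpiState K N σ tie δ (H T)).found)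
    (hwa : 2 * n₃ < estCount K N σ tie δ H H₀ a T) (hwb : 2 * n₃ < estCount K N σ tie δ H H₀ b T) :
    False := by
  -- the time of the dip
  have dip : ∀ {a : ℕ}, a ∈ changePoints K μ → 2 * n₃ < estCount K N σ tie δ H H₀ a T →
      ∃ t ≤ T, H₀ ≤ t ∧ n₁ ≤ plays (H t) a ∧ n₁ ≤ plays (H t) (a + 1) ∧
        empChange (H t) a ≤ change μ a - c := by
    intro a ha hwa
    obtain ⟨m1, m2⟩ := mem_Icc_of_mem (mem_changePoints.1 ha).1
    obtain ⟨k, hk1, hk2, hk⟩ := hdip a ha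
    have hle := (h.estCount_le h.tie_mem h.K_le a T).2.2
    obtain ⟨t, htT, ht⟩ := h.exists_plays_add_eq (a := a) (n := 2 * k) (T := T) (by omega)
    have hH₀t : H₀ ≤ t := by
      have := h.plays_add_plays_le (show a ≠ a + 1 by omega) t
      omega
    -- The total is 2k with k ≥ n₁ > H₀, so the counts differ by at most one; being of even sum they
    -- both equal `k`. The walks are thus seen exactly at the time of the dip.
    have hbal := h.plays_balanced hH₀t (h.card_found_lt htT hc) ha
    have e1 : plays (H t) a = k := by omega
    have e2 : plays (H t) (a + 1) = k := by omega
    refine ⟨t, htT, hH₀t, by omega, by omega, ?_⟩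
    have hk0 : (0 : ℝ) < k := by exact_mod_cast (by omega : 0 < k)
    have hb1 := h.acc t hH₀t a m1
    have hb2 := h.acc t hH₀t (a + 1) m2
    rw [e1] at hb1
    rw [e2] at hb2
    rw [empChange, h.mean t a (by omega), h.mean t (a + 1) (by omega), e1, e2]
    have hgc := h.gap.le_change a ha
    have hκ := h.kappa_le
    have hg0 := h.gap.pos
    have h6 : κ * g ≤ 1 / 8 * g := mul_le_mul_of_nonneg_right hκ hg0.le
    have hσ := h.sigma_pos
    have hdk : (SignType.sign (μ a - μ (a + 1)) : ℝ) * (W a k / k - W (a + 1) k / k) ≤ -c := by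
      have h7 : c ≤ σ / √k := hcn.trans (div_le_div_of_nonneg_left hσ.le (by positivity)
        (Real.sqrt_le_sqrt (by exact_mod_cast hk2)))
      have h8 : (SignType.sign (μ a - μ (a + 1)) : ℝ) * (W a k / k - W (a + 1) k / k)
          = ((SignType.sign (μ a - μ (a + 1)) : ℝ) * (W a k - W (a + 1) k)) / k := by ring
      rw [h8, div_le_iff₀ hk0]
      have h9 : σ * √k = σ / √k * k := by
        rw [div_mul_eq_mul_div, mul_div_assoc, Real.div_sqrt]
      nlinarith
    have hw1 : |W a k / k| ≤ κ * g := by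
      rw [abs_div, abs_of_pos hk0, div_le_iff₀ hk0]; exact hb1.le
    have hw2 : |W (a + 1) k / k| ≤ κ * g := by
      rw [abs_div, abs_of_pos hk0, div_le_iff₀ hk0]; exact hb2.le
    have hw1' := abs_le.1 hw1
    have hw2' := abs_le.1 hw2
    rcases lt_or_gt_of_ne (sub_ne_zero.2 (mem_changePoints.1 ha).2) with hneg | hpos
    · rw [sign_neg hneg] at hdk
      have e3 : change μ a = -(μ a - μ (a + 1)) := abs_of_neg hneg
      simp only [SignType.coe_neg, SignType.coe_one] at hdk
      rw [abs_of_neg (by linarith [hw1'.2, hw2'.1])]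
      linarith
    · rw [sign_pos hpos] at hdk
      have e3 : change μ a = μ a - μ (a + 1) := abs_of_pos hpos
      simp only [SignType.coe_one] at hdk
      rw [abs_of_pos (by linarith [hw1'.1, hw2'.2])]
      linarith
  -- After more than 2n₃ rounds as estimate, balance gives both arms at least n₃ plays, and each
  -- mean errs by less than c/2.
  have high : ∀ {a : ℕ}, a ∈ changePoints K μ → 2 * n₃ < estCount K N σ tie δ H H₀ a T →
      change μ a - c < empChange (H T) a := by
    intro a ha hwa
    obtain ⟨m1, m2⟩ := mem_Icc_of_mem (mem_changePoints.1 ha).1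
    obtain ⟨t, htT, ht, -⟩ := dip ha hwa
    have hle := (h.estCount_le h.tie_mem h.K_le a T).2.2
    have hbal := h.plays_balanced (ht.trans htT) hc ha
    have k1 : n₃ ≤ plays (H T) a := by omega
    have k2 : n₃ ≤ plays (H T) (a + 1) := by omega
    have s1 := hstab a m1 _ k1
    have s2 := hstab (a + 1) m2 _ k2
    have p1 : (0 : ℝ) < plays (H T) a := by exact_mod_cast (by omega : 0 < plays (H T) a)
    have p2 : (0 : ℝ) < plays (H T) (a + 1) := by
      exact_mod_cast (by omega : 0 < plays (H T) (a + 1))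
    rw [empChange, h.mean T a (by omega), h.mean T (a + 1) (by omega), change]
    have w1 : |W a (plays (H T) a) / plays (H T) a| < c / 2 := by
      rwa [abs_div, abs_of_pos p1, div_lt_iff₀ p1]
    have w2 : |W (a + 1) (plays (H T) (a + 1)) / plays (H T) (a + 1)| < c / 2 := by
      rwa [abs_div, abs_of_pos p2, div_lt_iff₀ p2]
    set w := W a (plays (H T) a) / plays (H T) a
    set w' := W (a + 1) (plays (H T) (a + 1)) / plays (H T) (a + 1)
    have h3 := abs_sub_abs_le_abs_sub (μ a - μ (a + 1)) (μ a + w - (μ (a + 1) + w'))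
    have h4 : |μ a - μ (a + 1) - (μ a + w - (μ (a + 1) + w'))| ≤ |w| + |w'| := by
      rw [show μ a - μ (a + 1) - (μ a + w - (μ (a + 1) + w')) = -(w - w') by ring, abs_neg]
      exact abs_sub _ _
    linarith
  obtain ⟨ta, hta, hta₀, qa, qa', la⟩ := dip ha hwa
  obtain ⟨tb, htb, htb₀, qb, qb', lb⟩ := dip hb hwb
  have cast : ∀ {s t x : ℕ}, s ≤ t → n₁ ≤ plays (H s) x → √T ≤ plays (H t) x := by
    intro s t x hst hx
    refine hTn.trans ?_
    exact_mod_cast hx.trans (h.plays_mono x hst)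
  -- The invariant is started at the later of the two dips, when both pairs have at least n₁ ≥ √T
  -- plays.
  have hfin : empChange (H T) a ≤ change μ a - c ∨ empChange (H T) b ≤ change μ a - c := by
    rcases le_total ta tb with hle | hle
    · exact h.low_invariant htb₀ hc ha hb hab haF hbF (cast hle qa) (cast hle qa')
        (cast le_rfl qb) (cast le_rfl qb') (.inr (by rwa [hΔ])) htb le_rfl
    · exact h.low_invariant hta₀ hc ha hb hab haF hbF (cast le_rfl qa) (cast le_rfl qa')
        (cast hle qb) (cast hle qb') (.inl la) hta le_rfl
  have h1 := high ha hwa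
  have h2 := high hb hwb
  rcases hfin with h3 | h3 <;> linarith

end AccurateRun

end Phases

/-! ### The largest changes -/

section Ordered

theorem sum_range_getD_eq (l : List ℝ) (f : ℝ → ℝ) {n : ℕ} (hn : n ≤ l.length) :
    ∑ i ∈ Finset.range n, f (l.getD i 0) = ((l.take n).map f).sum := by
  induction n with
  | zero => simp
  | succ n ih =>
    have hn' : n < l.length := by omega
    rw [Finset.sum_range_succ, ih (by omega), List.take_add_one, List.map_append, List.sum_append,
      List.getElem?_eq_getElem hn']
    simp [List.getD, List.getElem?_eq_getElem hn']

theorem sum_map_eq_of_forall_le (l : List ℝ) (f : ℝ → ℝ) {D : ℝ} (hl : ∀ x ∈ l, D ≤ x) :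
    (l.map f).sum = ((l.filter (D < ·)).map f).sum
      + (l.length - (l.filter (D < ·)).length : ℝ) * f D := by
  induction l with
  | nil => simp
  | cons x l ih =>
    have ih := ih fun y hy => hl y (List.mem_cons_of_mem _ hy)
    rcases (hl x List.mem_cons_self).lt_or_eq with h | h
    · simp [h, ih]
      ring
    · subst h
      simp [ih]
      ring

theorem sorted_take_spec {l : List ℝ} (hl : l.Pairwise (· ≥ ·)) {n : ℕ} (hn : 1 ≤ n)
    (hnl : n ≤ l.length) (f : ℝ → ℝ) :
    (l.filter (l.getD (n - 1) 0 < ·)).length < n ∧ n ≤ (l.filter (l.getD (n - 1) 0 ≤ ·)).length ∧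
    ∑ i ∈ Finset.range n, f (l.getD i 0) = ((l.filter (l.getD (n - 1) 0 < ·)).map f).sum
      + (n - (l.filter (l.getD (n - 1) 0 < ·)).length : ℝ) * f (l.getD (n - 1) 0) := by
  have hD : l.getD (n - 1) 0 = l[n - 1] := by
    simp [List.getD, List.getElem?_eq_getElem (show n - 1 < l.length by omega)]
  rw [hD]
  set D := l[n - 1] with hDdef
  have hge : ∀ i (hi : i < l.length) j (hj : j < l.length), i ≤ j → l[j] ≤ l[i] := by
    intro i hi j hj hij
    rcases hij.lt_or_eq with h | h
    · exact List.pairwise_iff_getElem.1 hl i j hi hj h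
    · subst h; exact le_rfl
  have htake : ∀ x ∈ l.take n, D ≤ x := by
    intro x hx
    obtain ⟨i, hi, rfl⟩ := List.mem_iff_getElem.1 hx
    rw [List.getElem_take]
    rw [List.length_take] at hi
    exact hge _ _ _ _ (by omega)
  have hdrop : ∀ x ∈ l.drop n, x ≤ D := by
    intro x hx
    obtain ⟨i, hi, rfl⟩ := List.mem_iff_getElem.1 hx
    rw [List.getElem_drop]
    exact hge _ _ _ _ (by omega)
  have hfd : (l.drop n).filter (D < ·) = [] := by
    rw [List.filter_eq_nil_iff]
    intro x hx
    simpa using hdrop x hx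
  have hf : l.filter (D < ·) = (l.take n).filter (D < ·) := by
    conv_lhs => rw [← List.take_append_drop n l, List.filter_append, hfd, List.append_nil]
  have hlen : (l.take n).length = n := by simp [hnl]
  refine ⟨?_, ?_, ?_⟩
  · rw [hf]
    have h1 : ((l.take n).filter (D < ·)).length < (l.take n).length := by
      rw [List.length_filter_lt_length_iff_exists]
      refine ⟨D, ?_, by simp⟩
      rw [List.mem_iff_getElem]
      exact ⟨n - 1, by omega, by rw [List.getElem_take]⟩
    omega
  · have h1 : (l.take n).filter (D ≤ ·) = l.take n := by
      rw [List.filter_eq_self]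
      intro x hx
      simpa using htake x hx
    have h2 : ((l.take n).filter (D ≤ ·)).length ≤ (l.filter (D ≤ ·)).length :=
      ((List.take_sublist n l).filter _).length_le
    rw [h1] at h2
    omega
  · rw [sum_range_getD_eq l f hnl, sum_map_eq_of_forall_le _ f htake, hf, hlen]

/-- Separates the changes strictly above Δ_(N) from those tied with it: of the ties, only as many
count in the sum as are needed to reach `N` terms, and the choice among them is immaterial. -/
theorem orderedChange_spec {K N : ℕ} {μ : ℕ → ℝ} (hN : 1 ≤ N) (hNC : N ≤ (changePoints K μ).card)
    (f : ℝ → ℝ) :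
    ((changePoints K μ).filter fun a => orderedChange K μ N < change μ a).card < N ∧
    N ≤ ((changePoints K μ).filter fun a => orderedChange K μ N ≤ change μ a).card ∧
    ∑ i ∈ Finset.Icc 1 N, f (orderedChange K μ i)
      = ∑ a ∈ (changePoints K μ).filter (fun a => orderedChange K μ N < change μ a), f (change μ a)
        + (N - ((changePoints K μ).filter fun a => orderedChange K μ N < change μ a).card : ℝ)
          * f (orderedChange K μ N) := by
  set C := changePoints K μ
  set l := sortedChanges K μ with hl
  have hcoe : (l : Multiset ℝ) = C.val.map (change μ) := Multiset.sort_eq _ _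
  have hsort : l.Pairwise (· ≥ ·) := Multiset.pairwise_sort _ _
  have hlen : l.length = C.card := by
    rw [← Multiset.coe_card, hcoe, Multiset.card_map]; rfl
  have key : ∀ (p : ℝ → Prop) [DecidablePred p], ((l.filter p : List ℝ) : Multiset ℝ)
      = (C.filter fun a => p (change μ a)).val.map (change μ) := by
    intro p _
    rw [← Multiset.filter_coe, hcoe, Multiset.filter_map]
    rfl
  have hcard : ∀ (p : ℝ → Prop) [DecidablePred p], (l.filter p).length
      = (C.filter fun a => p (change μ a)).card := by
    intro p _
    rw [← Multiset.coe_card, key, Multiset.card_map]; rfl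
  have hsum : ∀ (p : ℝ → Prop) [DecidablePred p], ((l.filter p).map f).sum
      = ∑ a ∈ C.filter (fun a => p (change μ a)), f (change μ a) := by
    intro p _
    rw [← Multiset.sum_coe, ← Multiset.map_coe, key, Multiset.map_map]
    rfl
  obtain ⟨h1, h2, h3⟩ := sorted_take_spec hsort hN (by omega) f
  rw [hcard] at h1 h2
  rw [hsum, hcard] at h3
  refine ⟨h1, h2, ?_⟩
  have hI : Finset.Icc 1 N = (Finset.range N).image (· + 1) := by
    ext i
    simp only [Finset.mem_Icc, Finset.mem_image, Finset.mem_range]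
    exact ⟨fun h => ⟨i - 1, by omega, by omega⟩, by rintro ⟨j, hj, rfl⟩; omega⟩
  rw [hI, Finset.sum_image fun i _ j _ h => by simpa using h]
  exact h3

end Ordered

/-! ### Bounds for the number of rounds before the policy stops -/

theorem card_changePoints_le (K : ℕ) (μ : ℕ → ℝ) : (changePoints K μ).card ≤ K :=
  (Finset.card_le_card (Finset.filter_subset _ _)).trans (by simp)

namespace AccurateRun

variable {K N : ℕ} {σ : ℝ} {tie : ℕ → Finset ℕ → ℕ} {δ : ℝ} {μ : ℕ → ℝ} {g κ : ℝ}
  {W : ℕ → ℕ → ℝ} {H₀ : ℕ} {H : ℕ → History}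

/-- A bound which holds for every accurate run. -/
theorem rounds_le (h : AccurateRun K N σ tie δ μ g κ W H₀ H) (hδ : 0 < δ) (hδ1 : δ < 1)
    {T : ℕ} (hT : 1 ≤ T) (hc : (mcpiState K N σ tie δ (H T)).found.card < N) :
    (T : ℝ) ≤ H₀ + K * (√T + 1) + 2 * K + 8 * σ ^ 2 * threshold K T (δ / N) / (1 - 2 * κ) ^ 2
      * ∑ a ∈ changePoints K μ, 1 / change μ a ^ 2 := by
  have h1 := h.le_sum_estCount h.tie_mem h.K_le (T := T) (A := changePoints K μ)
    fun s hs hsT _ => (h.est_spec hs (h.card_found_lt hsT.le hc)).1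
  have h2 : ∑ a ∈ changePoints K μ, (estCount K N σ tie δ H H₀ a T : ℝ)
      ≤ ∑ a ∈ changePoints K μ, (2 + 8 * σ ^ 2 * threshold K T (δ / N) / (1 - 2 * κ) ^ 2
        * (1 / change μ a ^ 2)) :=
    Finset.sum_le_sum fun a ha => h.estCount_le_of_card_lt hδ hδ1 ha hT hc
  rw [Finset.sum_add_distrib, ← Finset.mul_sum, Finset.sum_const, nsmul_eq_mul] at h2
  have h3 : ((changePoints K μ).card : ℝ) ≤ K := by exact_mod_cast (card_changePoints_le K μ)
  linarith

/-- The sharp bound: actions with equal changes do not compete for long if their walks have dips. -/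
theorem rounds_le_sharp (h : AccurateRun K N σ tie δ μ g κ W H₀ H) (hδ : 0 < δ) (hδ1 : δ < 1)
    {T n₁ n₂ n₃ : ℕ} {c : ℝ} (hT : 1 ≤ T)
    (hc : (mcpiState K N σ tie δ (H T)).found.card < N)
    (hn₁ : H₀ < n₁) (hTn : √T ≤ n₁) (hn₁₂ : n₁ ≤ n₂) (hn₂₃ : n₂ ≤ n₃)
    (hcn : c ≤ σ / √n₂)
    (hdip : ∀ a ∈ changePoints K μ, ∃ k, n₁ ≤ k ∧ k ≤ n₂ ∧
      (SignType.sign (μ a - μ (a + 1)) : ℝ) * (W a k - W (a + 1) k) ≤ -(σ * √k))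
    (hstab : ∀ a ∈ Finset.Icc 1 K, ∀ n, n₃ ≤ n → |W a n| < c / 2 * n) :
    (T : ℝ) ≤ H₀ + K * (√T + 1) + 2 * K + K * (2 * n₃)
      + 8 * σ ^ 2 * threshold K T (δ / N) / (1 - 2 * κ) ^ 2
        * ∑ i ∈ Finset.Icc 1 N, 1 / orderedChange K μ i ^ 2 := by
  classical
  obtain ⟨hL, hNle, hS⟩ := orderedChange_spec (K := K) (μ := μ) h.one_le h.card_le
    fun x => 1 / x ^ 2
  set C := changePoints K μ
  set D := orderedChange K μ N
  set F := (mcpiState K N σ tie δ (H T)).found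
  set A := C.filter fun a => D < change μ a with hA
  set E := C.filter fun a => D = change μ a with hE
  set q := 8 * σ ^ 2 * threshold K T (δ / N) / (1 - 2 * κ) ^ 2 with hq
  let n : ℕ → ℝ := fun a => estCount K N σ tie δ H H₀ a T
  have hAE : C.filter (fun a => D ≤ change μ a) = A ∪ E := by
    ext a
    simp only [hA, hE, Finset.mem_filter, Finset.mem_union, le_iff_lt_or_eq]
    tauto
  have hdisj : Disjoint A E := Finset.disjoint_left.2 fun a ha ha' => by
    have h1 := (Finset.mem_filter.1 ha).2
    have h2 := (Finset.mem_filter.1 ha').2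
    exact h1.ne h2
  -- every estimate is one of the `N` largest changes, up to ties
  have hest : ∀ s, H₀ ≤ s → s < T → (mcpiState K N σ tie δ (H s)).est ∈ A ∪ E ∧
      ((mcpiState K N σ tie δ (H s)).est ∈ E → A ⊆ F) := by
    intro s hs hsT
    have hc' := h.card_found_lt hsT.le hc
    obtain ⟨h1, h2⟩ := h.est_spec hs hc'
    constructor
    · obtain ⟨b, hb1, hb2⟩ : ∃ b ∈ C.filter (fun a => D ≤ change μ a),
          b ∉ (mcpiState K N σ tie δ (H s)).found := by
        by_contra hcon
        push Not at hcon
        have := Finset.card_le_card (show C.filter (fun a => D ≤ change μ a) ⊆ _ from hcon)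
        omega
      obtain ⟨hb3, hb4⟩ := Finset.mem_filter.1 hb1
      rw [← hAE]
      exact Finset.mem_filter.2 ⟨h1, hb4.trans (h2 b (mem_changePoints.1 hb3).1 hb2).2⟩
    · intro hsE b hb
      obtain ⟨hb1, hb2⟩ := Finset.mem_filter.1 hb
      by_contra hbF
      have h3 := (h2 b (mem_changePoints.1 hb1).1 fun hm => hbF (h.found_mono hsT.le hm)).2
      rw [← (Finset.mem_filter.1 hsE).2] at h3
      linarith
  set V := E.filter fun a => 2 * n₃ < estCount K N σ tie δ H H₀ a T with hV
  -- A tied position is the estimate only after all of `A` has been recorded. So the recorded heavy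
  -- ties and `A` together number at most N - 1, and at most one heavy tie is unrecorded, since two
  -- of them cannot coexist.
  have hVcard : V.card + A.card ≤ N := by
    by_contra hcon
    have hVpos : 0 < V.card := by omega
    obtain ⟨a, haV⟩ := Finset.card_pos.1 hVpos
    obtain ⟨haE, haw⟩ := Finset.mem_filter.1 haV
    have hAF : A ⊆ F := by
      have hpos : 0 < estCount K N σ tie δ H H₀ a T := by omega
      obtain ⟨s, hs⟩ := Finset.card_pos.1 hpos
      obtain ⟨h1, h2, h3⟩ := Finset.mem_filter.1 hs
      exact (hest s h2.1 (Finset.mem_range.1 h1)).2 (h3 ▸ haE)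
    have h1 : (F ∩ V).card + A.card ≤ F.card := by
      rw [← Finset.card_union_of_disjoint]
      · exact Finset.card_le_card (Finset.union_subset Finset.inter_subset_left hAF)
      · exact (hdisj.mono_right ((Finset.inter_subset_right).trans (Finset.filter_subset _ _))).symm
    have h2 : (V \ F).card + (F ∩ V).card = V.card := by
      rw [Finset.inter_comm]; exact Finset.card_sdiff_add_card_inter V F
    obtain ⟨a, ha, b, hb, hab⟩ := Finset.one_lt_card.1 (show 1 < (V \ F).card by omega)
    obtain ⟨haV, haF⟩ := Finset.mem_sdiff.1 ha
    obtain ⟨hbV, hbF⟩ := Finset.mem_sdiff.1 hb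
    obtain ⟨haE, hwa⟩ := Finset.mem_filter.1 haV
    obtain ⟨hbE, hwb⟩ := Finset.mem_filter.1 hbV
    obtain ⟨haC, haD⟩ := Finset.mem_filter.1 haE
    obtain ⟨hbC, hbD⟩ := Finset.mem_filter.1 hbE
    exact h.not_both_heavy hc hn₁ hTn hn₁₂ hn₂₃ hcn hdip hstab haC hbC hab (haD.symm.trans hbD)
      haF hbF hwa hwb
  have hq0 : 0 ≤ q := by
    have := threshold_nonneg h.two_le h.one_le hδ hδ1 hT
    positivity
  have hcount : ∀ a ∈ C, n a ≤ 2 + q * (1 / change μ a ^ 2) := fun a ha =>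
    h.estCount_le_of_card_lt hδ hδ1 ha hT hc
  have hsumA : ∑ a ∈ A, n a ≤ 2 * A.card + q * ∑ a ∈ A, 1 / change μ a ^ 2 := by
    refine (Finset.sum_le_sum fun a ha => hcount a (Finset.mem_filter.1 ha).1).trans_eq ?_
    rw [Finset.sum_add_distrib, ← Finset.mul_sum, Finset.sum_const, nsmul_eq_mul, mul_comm]
  have hsumE : ∑ a ∈ E, n a ≤ V.card * (2 + q * (1 / D ^ 2)) + (E.card : ℝ) * (2 * n₃) := by
    rw [← Finset.sum_filter_add_sum_filter_not E fun a => 2 * n₃ < estCount K N σ tie δ H H₀ a T]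
    refine add_le_add ?_ ?_
    · rw [← nsmul_eq_mul, ← Finset.sum_const]
      refine Finset.sum_le_sum fun a ha => ?_
      obtain ⟨haE, -⟩ := Finset.mem_filter.1 ha
      obtain ⟨haC, haD⟩ := Finset.mem_filter.1 haE
      have := hcount a haC
      rwa [← haD] at this
    · calc _ ≤ ∑ a ∈ E.filter fun a => ¬ 2 * n₃ < estCount K N σ tie δ H H₀ a T, (2 * n₃ : ℝ) := by
            refine Finset.sum_le_sum fun a ha => ?_
            have := not_lt.1 (Finset.mem_filter.1 ha).2
            change (estCount K N σ tie δ H H₀ a T : ℝ) ≤ 2 * n₃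
            exact_mod_cast this
        _ = ((E.filter fun a => ¬ 2 * n₃ < estCount K N σ tie δ H H₀ a T).card : ℝ) * (2 * n₃) := by
            rw [Finset.sum_const, nsmul_eq_mul]
        _ ≤ _ := by
            gcongr
            exact Finset.filter_subset _ _
  have hmain := h.le_sum_estCount h.tie_mem h.K_le (T := T) (A := A ∪ E)
    fun s hs hsT _ => (hest s hs hsT).1
  rw [Finset.sum_union hdisj] at hmain
  change (T : ℝ) ≤ H₀ + K * (√T + 1) + (∑ a ∈ A, n a + ∑ a ∈ E, n a) at hmain
  have hcards : ((V.card : ℝ) + A.card) ≤ N := by exact_mod_cast hVcard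
  have hNK : (N : ℝ) ≤ K := by
    have := h.le_sub_one
    exact_mod_cast (by omega : N ≤ K)
  have hEK : (E.card : ℝ) * (2 * n₃) ≤ K * (2 * n₃) := by
    have : (E.card : ℝ) ≤ K := by
      exact_mod_cast (Finset.card_le_card (Finset.filter_subset _ _)).trans (card_changePoints_le K μ)
    gcongr
  have hD0 : 0 ≤ q * (1 / D ^ 2) := by positivity
  have hVq : V.card * (q * (1 / D ^ 2)) ≤ ((N : ℝ) - A.card) * (q * (1 / D ^ 2)) :=
    mul_le_mul_of_nonneg_right (by linarith) hD0
  rw [hS]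
  have e : q * (∑ a ∈ A, 1 / change μ a ^ 2 + ((N : ℝ) - A.card) * (1 / D ^ 2))
      = q * ∑ a ∈ A, 1 / change μ a ^ 2 + ((N : ℝ) - A.card) * (q * (1 / D ^ 2)) := by ring
  rw [e]
  linarith

end AccurateRun

/-! ### Growth rates -/

section Rates

/-- The integral part of the eighth root. -/
def scale (T : ℕ) : ℕ := Nat.findGreatest (fun u => u ^ 8 ≤ T) T

theorem scale_pow_le (T : ℕ) : scale T ^ 8 ≤ T :=
  Nat.findGreatest_spec (P := fun u => u ^ 8 ≤ T) (Nat.zero_le T) (by simp)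

theorem le_scale {u T : ℕ} (h : u ^ 8 ≤ T) : u ≤ scale T :=
  Nat.le_findGreatest ((Nat.le_self_pow (by norm_num) u).trans h) h

theorem lt_scale_succ_pow (T : ℕ) : T < (scale T + 1) ^ 8 := by
  by_contra h
  have := le_scale (not_lt.1 h)
  omega

theorem tendsto_scale : Tendsto scale atTop atTop :=
  tendsto_atTop.2 fun b => (eventually_ge_atTop (b ^ 8)).mono fun _ h => le_scale h

theorem tendsto_scale_pow_div :
    Tendsto (fun T : ℕ => (scale T : ℝ) ^ 7 / T) atTop (𝓝 0) := by
  have h1 : Tendsto (fun T : ℕ => ((scale T : ℝ))⁻¹) atTop (𝓝 0) :=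
    tendsto_inv_atTop_zero.comp (tendsto_natCast_atTop_atTop.comp tendsto_scale)
  refine tendsto_of_tendsto_of_tendsto_of_le_of_le' tendsto_const_nhds h1
    (Eventually.of_forall fun T => by positivity) ?_
  filter_upwards [eventually_ge_atTop 1] with T hT
  have h2 : (1 : ℝ) ≤ scale T := by exact_mod_cast le_scale (by simpa using hT)
  have h3 : (scale T : ℝ) ^ 8 ≤ T := by exact_mod_cast scale_pow_le T
  have hT' : (0 : ℝ) < T := by exact_mod_cast hT
  rw [div_le_iff₀ hT', ← div_eq_inv_mul, le_div_iff₀ (by linarith)]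
  exact le_of_eq_of_le (by ring) h3

theorem eventually_linear_lt (a₁ a₂ a₃ a₄ : ℝ) {q : ℝ} (hq : q < 1) :
    ∀ᶠ T : ℕ in atTop, a₁ + a₂ * √T + a₃ * (scale T : ℝ) ^ 7 + a₄ * Real.log T + q * T < T := by
  have hcast := tendsto_natCast_atTop_atTop (R := ℝ)
  have h1 : Tendsto (fun T : ℕ => a₁ / (T : ℝ)) atTop (𝓝 0) := tendsto_const_div_atTop_nhds_zero_nat a₁
  have h2 : Tendsto (fun T : ℕ => a₂ * (√(T : ℝ))⁻¹) atTop (𝓝 (a₂ * 0)) :=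
    (tendsto_inv_atTop_zero.comp (Real.tendsto_sqrt_atTop.comp hcast)).const_mul a₂
  have h3 := tendsto_scale_pow_div.const_mul a₃
  have h4 : Tendsto (fun T : ℕ => a₄ * (Real.log T / T)) atTop (𝓝 (a₄ * 0)) :=
    (Real.isLittleO_log_id_atTop.tendsto_div_nhds_zero.comp hcast).const_mul a₄
  have h5 := (((h1.add h2).add h3).add h4).add_const q
  simp only [mul_zero, add_zero, zero_add] at h5
  filter_upwards [h5.eventually (gt_mem_nhds hq), eventually_ge_atTop 1] with T hlt hT
  have hT' : (0 : ℝ) < T := by exact_mod_cast hT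
  have hs : (√(T : ℝ))⁻¹ = √T / T := by rw [Real.sqrt_div_self']; simp
  rw [hs] at hlt
  have : a₁ / T + a₂ * (√T / T) + a₃ * ((scale T : ℝ) ^ 7 / T) + a₄ * (Real.log T / T) + q
      = (a₁ + a₂ * √T + a₃ * (scale T : ℝ) ^ 7 + a₄ * Real.log T + q * T) / T := by
    field_simp
  rw [this, div_lt_one hT'] at hlt
  exact hlt

theorem logConst_eq {K N : ℕ} {δ : ℝ} (hK : 2 ≤ K) (hN : 1 ≤ N) (hδ : 0 < δ) :
    logConst K N δ = Real.log (gammaConst * (K - 1) * N) + Real.log (1 / δ) := by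
  have hK' : (2 : ℝ) ≤ K := by exact_mod_cast hK
  have h1 : (0 : ℝ) < K - 1 := by linarith
  have hN' : (1 : ℝ) ≤ N := by exact_mod_cast hN
  have hg := gammaConst_pos
  rw [logConst, ← Real.log_mul (by positivity) (by positivity), mul_one_div]

/-- If `T` is large compared with `log (1/δ)` then the bounds for the number of rounds fail. -/
theorem eventually_rate_lt {K N : ℕ} (hK : 2 ≤ K) (hN : 1 ≤ N) {Q C : ℝ} (hQ : 0 ≤ Q) (hQC : Q < C) :
    ∀ᶠ T : ℕ in atTop, ∀ δ : ℝ, 0 < δ → δ < 1 → C * Real.log (1 / δ) ≤ T →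
      ((scale T ^ 2 + K + K * scale T : ℕ) : ℝ) + K * (√T + 1) + 2 * K + K * (2 * scale T ^ 7 : ℕ)
        + Q * threshold K T (δ / N) < T := by
  have hC : 0 < C := hQ.trans_lt hQC
  set c₀ := Real.log (gammaConst * (K - 1) * N) with hc₀
  set M := 1 + 1 / C + |c₀| with hM
  have hM1 : 1 ≤ M := by rw [hM]; have := abs_nonneg c₀; have : 0 < 1 / C := by positivity
                         linarith
  filter_upwards [eventually_linear_lt (4 * K + Q * (c₀ + 8 * Real.log M)) K (1 + 3 * K) (9 * Q)
    ((div_lt_one hC).2 hQC), eventually_ge_atTop 1] with T hlt hT δ hδ hδ1 hCT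
  have hT' : (1 : ℝ) ≤ T := by exact_mod_cast hT
  have hu : 1 ≤ scale T := le_scale (by simpa using hT)
  have hu' : (1 : ℝ) ≤ scale T := by exact_mod_cast hu
  have hA := le_logConst hK hN hδ hδ1
  have hlogT : 0 ≤ Real.log T := Real.log_nonneg hT'
  -- δ enters the estimate only through this bound, which is why the conclusion is uniform in δ; the
  -- resulting term QT/C is absorbed because Q < C.
  have hx : Real.log (1 / δ) ≤ T / C := by rw [le_div_iff₀ hC]; linarith
  have hL : logConst K N δ ≤ c₀ + T / C := by rw [logConst_eq hK hN hδ]; linarith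
  have hy : Real.log T + logConst K N δ ≤ M * T := by
    have h1 : Real.log T ≤ T := (Real.log_le_sub_one_of_pos (by linarith)).trans (by linarith)
    have h2 : c₀ ≤ |c₀| * T := (le_abs_self c₀).trans (le_mul_of_one_le_right (abs_nonneg _) hT')
    have h3 : M * T = T + T / C + |c₀| * T := by rw [hM]; ring
    linarith
  have hlog : Real.log (Real.log T + logConst K N δ) ≤ Real.log M + Real.log T := by
    rw [← Real.log_mul (by linarith) (by linarith)]
    exact Real.log_le_log (by linarith) hy
  have hβ : threshold K T (δ / N) ≤ c₀ + 8 * Real.log M + 9 * Real.log T + T / C := by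
    rw [threshold_eq hK hN hδ hT]
    linarith
  have hQβ := mul_le_mul_of_nonneg_left hβ hQ
  have hp2 : (scale T : ℝ) ^ 2 ≤ (scale T : ℝ) ^ 7 := pow_le_pow_right₀ hu' (by norm_num)
  have hp1 : (K : ℝ) * scale T ≤ K * (scale T : ℝ) ^ 7 := by
    gcongr
    exact le_self_pow₀ hu' (by norm_num)
  push_cast
  have e : Q * (c₀ + 8 * Real.log M + 9 * Real.log T + T / C)
      = Q * (c₀ + 8 * Real.log M) + 9 * Q * Real.log T + Q / C * T := by ring
  linarith

end Rates

/-! ### Good events for MCPI -/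

section GoodEvents

variable {K N : ℕ} {σ : ℝ} {tie : ℕ → Finset ℕ → ℕ} {δ : ℝ} {μ : ℕ → ℝ} {g κ : ℝ}

theorem eventually_radius_lt (K : ℕ) {e : ℝ} (he : 0 < e) :
    ∀ᶠ t : ℕ in atTop, (K : ℝ) < (t : ℝ) ^ (1 / 4 : ℝ) ∧ radius K t < e := by
  have hcast := tendsto_natCast_atTop_atTop (R := ℝ)
  have h1 : ∀ᶠ t : ℕ in atTop, Real.log t ≤ e ^ 2 / 16 * (t : ℝ) ^ (1 / 4 : ℝ) := by
    have := (isLittleO_log_rpow_atTop (show (0 : ℝ) < 1 / 4 by norm_num)).def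
      (show (0 : ℝ) < e ^ 2 / 16 by positivity)
    filter_upwards [hcast.eventually this] with t ht
    rw [Real.norm_of_nonneg (by positivity : (0 : ℝ) ≤ (t : ℝ) ^ (1 / 4 : ℝ))] at ht
    exact (le_abs_self _).trans ht
  have h2 : ∀ᶠ t : ℕ in atTop, 2 * (K + 1 / (e ^ 2)) < (t : ℝ) ^ (1 / 4 : ℝ) :=
    ((tendsto_rpow_atTop (show (0 : ℝ) < 1 / 4 by norm_num)).comp hcast).eventually_gt_atTop _
  have h3 : ∀ᶠ t : ℕ in atTop, 1 < Real.log t :=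
    (Real.tendsto_log_atTop.comp hcast).eventually_gt_atTop _
  filter_upwards [h1, h2, h3] with t h1 h2 h3
  set y := (t : ℝ) ^ (1 / 4 : ℝ)
  have hKy : (K : ℝ) < y := by
    have : (0 : ℝ) < 1 / e ^ 2 := by positivity
    have : (0 : ℝ) ≤ K := by positivity
    linarith
  refine ⟨hKy, ?_⟩
  have h4 : Real.log (2 * Real.log t) ≤ 2 * Real.log t := by
    have := Real.log_le_sub_one_of_pos (show 0 < 2 * Real.log t by linarith)
    linarith
  rw [radius, Real.sqrt_lt' he, div_lt_iff₀ (by linarith)]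
  have h5 : e ^ 2 * (2 * (K + 1 / e ^ 2)) < e ^ 2 * y := mul_lt_mul_of_pos_left h2 (by positivity)
  have h6 : e ^ 2 * (2 * (K + 1 / e ^ 2)) = 2 * (e ^ 2 * K) + 2 := by field_simp
  have h7 : e ^ 2 * (y - K) = e ^ 2 * y - e ^ 2 * K := by ring
  have h8 : e ^ 2 / 16 * y = e ^ 2 * y / 16 := by ring
  linarith

/-- From `n` plays on, the empirical means of all the actions are accurate up to `x`. -/
def AllAccurate (K : ℕ) (x : ℝ) (n : ℕ) : Set (ℕ × ℕ → ℝ) := ⋂ a ∈ Finset.Icc 1 K, Accurate x a n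

/-- At each change point, the empirical change has a dip between `n` and `m` plays. -/
def AllDips (K : ℕ) (σ : ℝ) (μ : ℕ → ℝ) (n m : ℕ) : Set (ℕ × ℕ → ℝ) :=
  ⋂ a ∈ changePoints K μ, Dips σ (SignType.sign (μ a - μ (a + 1)) : ℝ) a n m

theorem measurableSet_allAccurate (K : ℕ) (x : ℝ) (n : ℕ) : MeasurableSet (AllAccurate K x n) :=
  Finset.measurableSet_biInter _ fun a _ => measurableSet_accurate x a n

theorem measurableSet_allDips (K : ℕ) (σ : ℝ) (μ : ℕ → ℝ) (n m : ℕ) :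
    MeasurableSet (AllDips K σ μ n m) :=
  Finset.measurableSet_biInter _ fun a _ => measurableSet_dips σ _ a n m

theorem measureReal_compl_biInter_le {Ω ι : Type*} [MeasurableSpace Ω] (P : Measure Ω)
    [IsProbabilityMeasure P] (s : Finset ι) (A : ι → Set Ω) {b : ℝ}
    (h : ∀ i ∈ s, P.real (A i)ᶜ ≤ b) : P.real (⋂ i ∈ s, A i)ᶜ ≤ s.card * b := by
  rw [Set.compl_iInter₂]
  exact (measureReal_biUnion_finset_le _ _).trans ((Finset.sum_le_sum h).trans_eq (by simp))

theorem allAccurate_compl_le (hσ : 0 < σ) {x : ℝ} (hx : 0 < x) (n : ℕ) :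
    (stackLaw σ).real (AllAccurate K x n)ᶜ
      ≤ K * (2 * (1 - Real.exp (-(x ^ 2 / (2 * σ ^ 2))))⁻¹
      * Real.exp (-(x ^ 2 / (2 * σ ^ 2))) ^ n) := by
  have := measureReal_compl_biInter_le (stackLaw σ) (Finset.Icc 1 K) (fun a => Accurate x a n)
    fun a _ => accurate_compl_le hσ hx a n
  simpa [AllAccurate] using this

theorem sign_sq_of_mem_changePoints {a : ℕ} (ha : a ∈ changePoints K μ) :
    (SignType.sign (μ a - μ (a + 1)) : ℝ) ^ 2 = 1 := by
  rcases (sub_ne_zero.2 (mem_changePoints.1 ha).2).lt_or_gt with h | h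
  · rw [sign_neg h]; simp
  · rw [sign_pos h]; simp

/-- The window from u⁵ to u⁶ has ratio `u`, which exceeds any fixed ratio sufficient for a dip. -/
theorem tendsto_allDips_compl (hσ : 0 < σ) (K : ℕ) (μ : ℕ → ℝ) :
    Tendsto (fun u : ℕ => (stackLaw σ).real (AllDips K σ μ (u ^ 5) (u ^ 6))ᶜ) atTop (𝓝 0) := by
  rw [Metric.tendsto_atTop]
  intro η hη
  have hc : (0 : ℝ) < (changePoints K μ).card + 1 := by positivity
  obtain ⟨u₀, hu₀⟩ := exists_dips_compl_le hσ (div_pos hη hc)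
  refine ⟨max u₀ 1, fun u hu => ?_⟩
  have h := measureReal_compl_biInter_le (stackLaw σ) (changePoints K μ)
    (fun a => Dips σ (SignType.sign (μ a - μ (a + 1)) : ℝ) a (u ^ 5) (u ^ 6)) fun a ha => by
      have := hu₀ u (le_of_max_le_left hu) (u ^ 5) (Nat.one_le_pow _ _ (le_of_max_le_right hu)) a _
        (sign_sq_of_mem_changePoints ha)
      rwa [← pow_succ] at this
  rw [Real.dist_0_eq_abs, abs_of_nonneg measureReal_nonneg]
  refine h.trans_lt ?_
  rw [mul_div_assoc', div_lt_iff₀ hc]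
  nlinarith

/-- Exponential decay beats polynomial growth along the integers. -/
theorem tendsto_pow_mul_exp_neg {c : ℝ} (hc : 0 < c) (k : ℕ) :
    Tendsto (fun u : ℕ => (u : ℝ) ^ k * Real.exp (-(c * u))) atTop (𝓝 0) := by
  have h := tendsto_rpow_mul_exp_neg_mul_atTop_nhds_zero (k : ℝ) c hc
  simpa [Function.comp_def] using h.comp (tendsto_natCast_atTop_atTop (R := ℝ))

/-- u⁷ samples at precision σ/(2u³) give the exponent u/8, while the geometric series contributes a
factor of order u⁶ only. -/
theorem tendsto_stable_compl (hσ : 0 < σ) (K : ℕ) :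
    Tendsto (fun u : ℕ => (stackLaw σ).real (AllAccurate K (σ / u ^ 3 / 2) (u ^ 7))ᶜ) atTop (𝓝 0) := by
  have h := (((tendsto_pow_mul_exp_neg (show (0 : ℝ) < 1 / 8 by norm_num) 6).const_mul 8).add
    (tendsto_pow_mul_exp_neg (show (0 : ℝ) < 1 / 8 by norm_num) 0)).const_mul (2 * K : ℝ)
  simp only [mul_zero, add_zero] at h
  refine tendsto_of_tendsto_of_tendsto_of_le_of_le' tendsto_const_nhds h
    (Eventually.of_forall fun u => measureReal_nonneg) ?_
  filter_upwards [eventually_ge_atTop 1] with u hu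
  have hu' : (0 : ℝ) < u := by exact_mod_cast hu
  refine (allAccurate_compl_le hσ (by positivity) (u ^ 7)).trans ?_
  have e1 : (σ / u ^ 3 / 2) ^ 2 / (2 * σ ^ 2) = 1 / (8 * (u : ℝ) ^ 6) := by field_simp; norm_num
  rw [e1, ← Real.exp_nat_mul]
  have e2 : ((u ^ 7 : ℕ) : ℝ) * -(1 / (8 * (u : ℝ) ^ 6)) = -(1 / 8 * u) := by
    push_cast; field_simp
  rw [e2]
  set z := 1 / (8 * (u : ℝ) ^ 6) with hz
  have hz0 : 0 < z := by positivity
  have e3 : (1 - Real.exp (-z))⁻¹ ≤ 8 * (u : ℝ) ^ 6 + 1 := by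
    have h1 : Real.exp (-z) ≤ (1 + z)⁻¹ := by
      rw [Real.exp_neg]
      gcongr
      linarith [Real.add_one_le_exp z]
    have h2 : (8 * (u : ℝ) ^ 6 + 1)⁻¹ = 1 - (1 + z)⁻¹ := by
      rw [hz]; field_simp; ring
    have h3 : (8 * (u : ℝ) ^ 6 + 1)⁻¹ ≤ 1 - Real.exp (-z) := by rw [h2]; linarith
    exact inv_le_of_inv_le₀ (by positivity) h3
  calc (K : ℝ) * (2 * (1 - Real.exp (-z))⁻¹ * Real.exp (-(1 / 8 * u)))
      ≤ K * (2 * (8 * (u : ℝ) ^ 6 + 1) * Real.exp (-(1 / 8 * u))) := by gcongr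
    _ = _ := by ring

theorem tendsto_allAccurate_compl (hσ : 0 < σ) (K : ℕ) {x : ℝ} (hx : 0 < x) :
    Tendsto (fun u : ℕ => (stackLaw σ).real (AllAccurate K x u)ᶜ) atTop (𝓝 0) := by
  have hρ1 : Real.exp (-(x ^ 2 / (2 * σ ^ 2))) < 1 :=
    Real.exp_lt_one_iff.2 (by rw [neg_lt_zero]; positivity)
  have h := ((tendsto_pow_atTop_nhds_zero_of_lt_one (Real.exp_pos _).le hρ1).const_mul
    (2 * (1 - Real.exp (-(x ^ 2 / (2 * σ ^ 2))))⁻¹)).const_mul (K : ℝ)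
  simp only [mul_zero] at h
  exact squeeze_zero (fun _ => measureReal_nonneg) (fun u => allAccurate_compl_le hσ hx u) h

/-- exp(-zu) is at most a multiple of (u+1)^{-16}, and T + 1 ≤ (u+1)⁸ turns this into a multiple of
(T+1)^{-2}. -/
theorem summable_allAccurate_compl (hσ : 0 < σ) (K : ℕ) {x : ℝ} (hx : 0 < x) :
    Summable fun T : ℕ => (stackLaw σ).real (AllAccurate K x (scale T))ᶜ := by
  set z := x ^ 2 / (2 * σ ^ 2) with hz
  have hz0 : 0 < z := by positivity
  set q := 2 * (1 - Real.exp (-z))⁻¹ with hq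
  have hq0 : 0 ≤ q := by
    have : Real.exp (-z) ≤ 1 := Real.exp_le_one_iff.2 (by linarith)
    have : 0 ≤ (1 - Real.exp (-z))⁻¹ := inv_nonneg.2 (by linarith)
    positivity
  obtain ⟨b, hb⟩ := (tendsto_pow_mul_exp_neg hz0 16).bddAbove_range
  have hb' : ∀ u : ℕ, (u : ℝ) ^ 16 * Real.exp (-(z * u)) ≤ b := fun u => hb ⟨u, rfl⟩
  have hs : Summable fun T : ℕ => K * q * (b * Real.exp z) * (1 / ((T + 1 : ℕ) : ℝ) ^ 2) :=
    ((summable_nat_add_iff 1).2 (Real.summable_one_div_nat_pow.2 one_lt_two)).mul_left _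
  refine hs.of_nonneg_of_le (fun _ => measureReal_nonneg) fun T => ?_
  refine (allAccurate_compl_le hσ hx _).trans ?_
  rw [← hz, ← hq, ← Real.exp_nat_mul, ← mul_assoc, mul_assoc (K * q : ℝ)]
  refine mul_le_mul_of_nonneg_left ?_ (by positivity)
  set u := scale T
  have h1 : ((T + 1 : ℕ) : ℝ) ≤ ((u + 1 : ℕ) : ℝ) ^ 8 := by exact_mod_cast lt_scale_succ_pow T
  have h2 : ((T + 1 : ℕ) : ℝ) ^ 2 ≤ ((u + 1 : ℕ) : ℝ) ^ 16 :=
    (pow_le_pow_left₀ (by positivity) h1 2).trans_eq (by ring)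
  have hT : (0 : ℝ) < ((T + 1 : ℕ) : ℝ) ^ 2 := by positivity
  rw [mul_one_div, le_div_iff₀ hT]
  calc Real.exp (u * -z) * ((T + 1 : ℕ) : ℝ) ^ 2
      ≤ Real.exp (u * -z) * ((u + 1 : ℕ) : ℝ) ^ 16 := by gcongr
    _ = ((u + 1 : ℕ) : ℝ) ^ 16 * Real.exp (-(z * (u + 1 : ℕ))) * Real.exp z := by
      rw [mul_assoc, ← Real.exp_add, mul_comm]
      congr 2
      push_cast; ring
    _ ≤ b * Real.exp z := by gcongr; exact hb' _

/-- On the good events, the stack model is an accurate run. -/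
theorem eventually_accurateRun (hN : 1 ≤ N) (hσ : 0 < σ)
    (htie : ∀ (t : ℕ) (s : Finset ℕ), s.Nonempty → tie t s ∈ s) {m : ℕ} (hm : N ≤ m)
    (hμ : μ ∈ Env K m) (hg : IsGap K μ g) (hκ0 : 0 < κ) (hκ : κ ≤ 1 / 8) :
    ∀ᶠ u : ℕ in atTop, ∀ δ, ∀ X ∈ AllAccurate K (κ * g) u,
      AccurateRun K N σ tie δ μ g κ (walk X) (u ^ 2 + K + K * u)
        (stackHistory (mcpi K N σ tie δ) μ X) := by
  obtain ⟨t₀, ht₀⟩ := eventually_atTop.1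
    (eventually_radius_lt K (show 0 < g / (2 * σ) by have := hg.pos; positivity))
  filter_upwards [eventually_ge_atTop (t₀ + 1)] with u hu δ X hX
  have hrun := isRun_stackHistory (K := K) (N := N) (σ := σ) (tie := tie) (δ := δ) μ X
  have hu2 : u ≤ u ^ 2 := Nat.le_self_pow two_ne_zero u
  refine { hrun with
    tie_mem := htie
    one_le := hN
    card_le := hm.trans_eq hμ.1.symm
    sep := hμ.2
    sigma_pos := hσ
    gap := hg
    kappa_pos := hκ0
    kappa_le := hκ
    K_le := by omega
    mean := fun t a h => empMean_stackHistory _ μ X t a h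
    acc := fun t ht a ha => Set.mem_iInter₂.1 hX a ha _ (hrun.le_plays htie ht ha)
    update := fun t ht => Or.inr ?_ }
  obtain ⟨h1, h2⟩ := ht₀ t (by omega)
  refine ⟨h1, ?_⟩
  rw [lt_div_iff₀ (by positivity)] at h2
  linarith

variable (K N σ tie μ) in
/-- The phases completed after `T` rounds in the stack model. -/
noncomputable def phases (δ : ℝ) (T : ℕ) (X : ℕ × ℕ → ℝ) : ℕ :=
  (mcpiState K N σ tie δ (stackHistory (mcpi K N σ tie δ) μ X T)).found.card

/-- The crude bound: MCPI stops within a multiple of `log (1/δ)` rounds. -/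
theorem exists_crude_bound (hN : 1 ≤ N) (hσ : 0 < σ)
    (htie : ∀ (t : ℕ) (s : Finset ℕ), s.Nonempty → tie t s ∈ s) {m : ℕ} (hm : N ≤ m)
    (hμ : μ ∈ Env K m) (hK : 2 ≤ K) :
    ∃ C : ℝ, 0 < C ∧ ∃ A : ℕ → Set (ℕ × ℕ → ℝ), (∀ T, MeasurableSet (A T)) ∧
      (Summable fun T => (stackLaw σ).real (A T)ᶜ) ∧ ∃ T₁, ∀ T : ℕ, T₁ ≤ T → ∀ δ : ℝ, 0 < δ → δ < 1 →
        C * Real.log (1 / δ) ≤ T → ∀ X ∈ A T, N ≤ phases K N σ tie μ δ T X := by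
  obtain ⟨g, hg⟩ := exists_isGap K μ
  have hx : 0 < 1 / 8 * g := by have := hg.pos; positivity
  set S := ∑ a ∈ changePoints K μ, 1 / change μ a ^ 2
  have hS : 0 ≤ S := Finset.sum_nonneg fun a _ => by positivity
  set Q := 8 * σ ^ 2 / (1 - 2 * (1 / 8)) ^ 2 * S with hQ
  have hQ0 : 0 ≤ Q := by positivity
  -- Any constant above Q works. The events and `T₁` depend only on the environment and not on δ, so
  -- the tail sum is one fixed constant in the final limit.
  refine ⟨Q + 1, by positivity, fun T => AllAccurate K (1 / 8 * g) (scale T),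
    fun T => measurableSet_allAccurate _ _ _, summable_allAccurate_compl hσ K hx, ?_⟩
  have h := ((eventually_rate_lt hK hN hQ0 (lt_add_one Q)).and (tendsto_scale.eventually
    (eventually_accurateRun (tie := tie) hN hσ htie hm hμ hg (by norm_num) le_rfl))).and
    (eventually_ge_atTop 1)
  obtain ⟨T₁, hT₁⟩ := eventually_atTop.1 h
  refine ⟨T₁, fun T hT δ hδ hδ1 hCT X hX => ?_⟩
  obtain ⟨⟨hrate, hrun⟩, hT1⟩ := hT₁ T hT
  by_contra hc
  have h1 := (hrun δ X hX).rounds_le hδ hδ1 hT1 (not_le.1 hc)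
  have h2 := hrate δ hδ hδ1 hCT
  have h3 : (0 : ℝ) ≤ K * (2 * scale T ^ 7 : ℕ) := by positivity
  have h4 : 8 * σ ^ 2 * threshold K T (δ / N) / (1 - 2 * (1 / 8)) ^ 2 * S
      = Q * threshold K T (δ / N) := by rw [hQ]; ring
  linarith

/-- T < (u+1)⁸ ≤ (2u)⁸ = 16²u⁸ ≤ u¹⁰ once u ≥ 16. -/
theorem sqrt_le_scale_pow {T : ℕ} (h : 16 ≤ scale T) : √(T : ℝ) ≤ (scale T ^ 5 : ℕ) := by
  rw [Real.sqrt_le_left (by positivity)]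
  have h1 : (scale T + 1) ^ 8 ≤ (scale T ^ 5) ^ 2 := by
    calc (scale T + 1) ^ 8 ≤ (2 * scale T) ^ 8 := Nat.pow_le_pow_left (by omega) 8
      _ = 16 ^ 2 * scale T ^ 8 := by ring
      _ ≤ scale T ^ 2 * scale T ^ 8 := Nat.mul_le_mul_right _ (Nat.pow_le_pow_left h 2)
      _ = (scale T ^ 5) ^ 2 := by ring
  exact_mod_cast (lt_scale_succ_pow T).le.trans h1

/-- The sharp bound for the number of rounds of MCPI, with high probability. -/
theorem exists_sharp_bound (hN : 1 ≤ N) (hσ : 0 < σ)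
    (htie : ∀ (t : ℕ) (s : Finset ℕ), s.Nonempty → tie t s ∈ s) {m : ℕ} (hm : N ≤ m)
    (hμ : μ ∈ Env K m) (hK : 2 ≤ K) {C : ℝ}
    (hC : 8 * σ ^ 2 * ∑ i ∈ Finset.Icc 1 N, 1 / orderedChange K μ i ^ 2 < C) :
    ∃ B : ℕ → Set (ℕ × ℕ → ℝ), (∀ T, MeasurableSet (B T)) ∧
      Tendsto (fun T => (stackLaw σ).real (B T)ᶜ) atTop (𝓝 0) ∧
      ∃ T₀, ∀ T : ℕ, T₀ ≤ T → ∀ δ : ℝ, 0 < δ → δ < 1 →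
        C * Real.log (1 / δ) ≤ T → ∀ X ∈ B T, N ≤ phases K N σ tie μ δ T X := by
  obtain ⟨g, hg⟩ := exists_isGap K μ
  set S := ∑ i ∈ Finset.Icc 1 N, 1 / orderedChange K μ i ^ 2
  have hS : 0 ≤ S := Finset.sum_nonneg fun a _ => by positivity
  -- The relative accuracy is chosen so fine that the loss (1 - 2κ)⁻² fits below `C`.
  obtain ⟨κ, hκ0, hκ, hκC⟩ : ∃ κ : ℝ, 0 < κ ∧ κ ≤ 1 / 8 ∧ 8 * σ ^ 2 / (1 - 2 * κ) ^ 2 * S < C := by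
    have hcont : Tendsto (fun κ : ℝ => 8 * σ ^ 2 / (1 - 2 * κ) ^ 2 * S) (𝓝[>] 0)
        (𝓝 (8 * σ ^ 2 / (1 - 2 * 0) ^ 2 * S)) := by
      refine (ContinuousAt.tendsto ?_).mono_left nhdsWithin_le_nhds
      refine (continuousAt_const.div (by fun_prop) (by norm_num)).mul continuousAt_const
    have hle : ∀ᶠ κ : ℝ in 𝓝[>] 0, κ ≤ 1 / 8 :=
      nhdsWithin_le_nhds (Iic_mem_nhds (by norm_num))
    obtain ⟨κ, h1, h2, h3⟩ := ((hcont.eventually (gt_mem_nhds (show _ < C by simpa using hC))).and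
      (hle.and self_mem_nhdsWithin)).exists
    exact ⟨κ, h3, h2, h1⟩
  set Q := 8 * σ ^ 2 / (1 - 2 * κ) ^ 2 * S with hQ
  have hQ0 : 0 ≤ Q := by positivity
  have hx : 0 < κ * g := mul_pos hκ0 hg.pos
  -- The scales n₁ = u⁵, n₂ = u⁶, n₃ = u⁷ and c = σ/√n₂ = σ/u³: n₁ is beyond forced exploration, the
  -- dip window is long, stability at level c/2 holds from n₃ on, and n₃ is still o(T).
  let B : ℕ → Set (ℕ × ℕ → ℝ) := fun u => AllAccurate K (κ * g) u ∩ (AllDips K σ μ (u ^ 5) (u ^ 6) ∩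
    AllAccurate K (σ / u ^ 3 / 2) (u ^ 7))
  have hB : Tendsto (fun u => (stackLaw σ).real (B u)ᶜ) atTop (𝓝 0) := by
    have h := (tendsto_allAccurate_compl hσ K hx).add
      ((tendsto_allDips_compl hσ K μ).add (tendsto_stable_compl hσ K))
    simp only [add_zero] at h
    refine squeeze_zero (fun _ => measureReal_nonneg) (fun u => ?_) h
    rw [Set.compl_inter, Set.compl_inter]
    exact (measureReal_union_le _ _).trans (add_le_add_right (measureReal_union_le _ _) _)
  refine ⟨fun T => B (scale T), fun T => (measurableSet_allAccurate _ _ _).inter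
    ((measurableSet_allDips _ _ _ _ _).inter (measurableSet_allAccurate _ _ _)),
    hB.comp tendsto_scale, ?_⟩
  have h := ((eventually_rate_lt hK hN hQ0 hκC).and (tendsto_scale.eventually
    (eventually_accurateRun (tie := tie) hN hσ htie hm hμ hg hκ0 hκ))).and
    ((eventually_ge_atTop 1).and (tendsto_scale.eventually (eventually_ge_atTop (16 + K))))
  obtain ⟨T₀, hT₀⟩ := eventually_atTop.1 h
  refine ⟨T₀, fun T hT δ hδ hδ1 hCT X hX => ?_⟩
  obtain ⟨⟨hrate, hrun⟩, hT1, hu⟩ := hT₀ T hT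
  set u := scale T
  have hu1 : 1 ≤ u := by omega
  obtain ⟨hX1, hX2, hX3⟩ := hX
  by_contra hc
  have hlt : u ^ 2 + K + K * u < u ^ 5 := by
    have h1 : K ≤ u := by omega
    calc u ^ 2 + K + K * u ≤ u ^ 2 + u ^ 2 + u ^ 2 := by nlinarith
      _ < u ^ 3 * u ^ 2 := by
        have : 3 < u ^ 3 := lt_of_lt_of_le (by omega) (Nat.le_self_pow three_ne_zero u)
        have : 0 < u ^ 2 := by positivity
        nlinarith
      _ = u ^ 5 := by ring
  have hsq : √((u ^ 6 : ℕ) : ℝ) = (u : ℝ) ^ 3 := by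
    rw [show ((u ^ 6 : ℕ) : ℝ) = ((u : ℝ) ^ 3) ^ 2 by push_cast; ring]
    exact Real.sqrt_sq (by positivity)
  have h1 := (hrun δ X hX1).rounds_le_sharp hδ hδ1 hT1 (not_le.1 hc) hlt
    (sqrt_le_scale_pow (by omega)) (Nat.pow_le_pow_right hu1 (by norm_num))
    (Nat.pow_le_pow_right hu1 (by norm_num) : u ^ 6 ≤ u ^ 7) (c := σ / u ^ 3) (by rw [hsq])
    (fun a ha => Set.mem_iInter₂.1 hX2 a ha) fun a ha => Set.mem_iInter₂.1 hX3 a ha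
  have h2 := hrate δ hδ hδ1 hCT
  have h4 : 8 * σ ^ 2 * threshold K T (δ / N) / (1 - 2 * κ) ^ 2 * S
      = Q * threshold K T (δ / N) := by rw [hQ]; ring
  push_cast at h1 h2
  linarith

end GoodEvents

/-! ### The stopping time of MCPI -/

section StoppingTime

variable {K N : ℕ} {σ : ℝ} {tie : ℕ → Finset ℕ → ℕ} {δ : ℝ} {μ : ℕ → ℝ}

theorem stoppingTime_stackNoise_le (htie : ∀ (t : ℕ) (s : Finset ℕ), s.Nonempty → tie t s ∈ s)
    (hNK : N ≤ K - 1) {T : ℕ} {X : ℕ × ℕ → ℝ} (h : N ≤ phases K N σ tie μ δ T X) :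
    (mcpi K N σ tie δ).stoppingTime μ (stackNoise (mcpi K N σ tie δ) μ X) ≤ T := by
  refine iInf₂_le T ?_
  show (mcpiState K N σ tie δ _).found.card = N
  rw [history_stackNoise]
  exact (stateInv_mcpiState htie hNK _).card_le.antisymm h

theorem measurableSet_stoppingTime_lt_top (K N : ℕ) (σ : ℝ) (tie : ℕ → Finset ℕ → ℕ) (δ : ℝ)
    (μ : ℕ → ℝ) : MeasurableSet {ε | (mcpi K N σ tie δ).stoppingTime μ ε < ⊤} := by
  have : {ε | (mcpi K N σ tie δ).stoppingTime μ ε < ⊤}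
      = ⋃ t, (fun ε => mcpiState K N σ tie δ ((mcpi K N σ tie δ).history μ ε t)) ⁻¹'
        {s | s.found.card = N} := by
    ext ε
    simp only [Set.mem_ofPred_eq, Policy.stoppingTime, iInf_lt_iff, Set.mem_iUnion, Set.mem_preimage,
      ENat.natCast_lt_top, exists_prop, and_true]
    rfl
  rw [this]
  exact .iUnion fun t => (measHistory_history K N σ tie δ μ t).2 trivial

theorem two_le_of_env (hN : 1 ≤ N) {m : ℕ} (hm : N ≤ m) (hμ : μ ∈ Env K m) :
    N ≤ K - 1 ∧ 2 ≤ K := by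
  have h : (changePoints K μ).card ≤ K - 1 :=
    (Finset.card_le_card (Finset.filter_subset _ _)).trans_eq (by simp)
  rw [hμ.1] at h
  omega

theorem mul_le_add_ceil (C x : ℝ) (T : ℕ) : C * x ≤ ((T + ⌈C * x⌉₊ : ℕ) : ℝ) := by
  push_cast
  have := Nat.le_ceil (C * x)
  have : (0 : ℝ) ≤ T := by positivity
  linarith

/-- MCPI stops almost surely. -/
theorem ae_stoppingTime_lt_top (hN : 1 ≤ N) (hσ : 0 < σ)
    (htie : ∀ (t : ℕ) (s : Finset ℕ), s.Nonempty → tie t s ∈ s) {m : ℕ} (hm : N ≤ m)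
    (hμ : μ ∈ Env K m) (hδ : 0 < δ) (hδ1 : δ < 1) :
    ∀ᵐ ε ∂(noise σ), (mcpi K N σ tie δ).stoppingTime μ ε < ⊤ := by
  obtain ⟨hNK, hK⟩ := two_le_of_env hN hm hμ
  obtain ⟨C, hC, A, -, hAs, T₁, hT₁⟩ := exists_crude_bound hN hσ htie hm hμ hK
  rw [← map_stackNoise K N σ tie δ μ, ae_map_iff (measurable_stackNoise K N σ tie δ μ).aemeasurable
    (measurableSet_stoppingTime_lt_top K N σ tie δ μ)]
  have hne : ∑' T, stackLaw σ (A T)ᶜ ≠ ∞ := by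
    have := hAs.tsum_ofReal_ne_top
    simpa [measureReal_def, ENNReal.ofReal_toReal] using this
  -- Borel–Cantelli: almost surely the good event occurs for all large `T`.
  filter_upwards [ae_eventually_notMem hne] with X hX
  obtain ⟨T, hT, hT'⟩ := (hX.and (eventually_ge_atTop (T₁ + ⌈C * Real.log (1 / δ)⌉₊))).exists
  refine (stoppingTime_stackNoise_le htie hNK (hT₁ T (by omega) δ hδ hδ1 ?_ X
    (Set.notMem_compl_iff.1 hT))).trans_lt (ENat.natCast_lt_top T)
  exact (mul_le_add_ceil C _ T₁).trans (by exact_mod_cast hT')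

theorem enat_coe_le_of_forall {τ : ℕ∞} {R : ℝ≥0∞} (h : ∀ n : ℕ, (n : ℕ∞) ≤ τ → (n : ℝ≥0∞) ≤ R) :
    (τ : ℝ≥0∞) ≤ R := by
  induction τ using ENat.recTopCoe with
  | top =>
    have : R = ⊤ := ENNReal.eq_top_of_forall_nnreal_le fun r => by
      obtain ⟨n, hn⟩ := exists_nat_ge r
      exact (ENNReal.coe_le_coe.2 hn).trans (by simpa using h n le_top)
    simp [this]
  | coe n => simpa using h n le_rfl

/-- A stopping time is bounded by a time and the number of the later bad rounds. -/
theorem enat_coe_le_add_tsum {Ω : Type*} {τ : ℕ∞} {T : ℕ} {A : ℕ → Set Ω} {ω : Ω}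
    (h : ∀ n, T ≤ n → ω ∈ A n → τ ≤ n) :
    (τ : ℝ≥0∞) ≤ T + ∑' n, (A n)ᶜ.indicator 1 ω := by
  refine enat_coe_le_of_forall fun n hn => ?_
  have h1 : ((n - T : ℕ) : ℝ≥0∞) ≤ ∑' n, (A n)ᶜ.indicator 1 ω := by
    refine le_trans (le_of_eq ?_) (ENNReal.sum_le_tsum (Finset.Ico T n))
    rw [Finset.sum_congr rfl (g := fun _ => (1 : ℝ≥0∞)) fun k hk => ?_]
    · simp
    · rw [Finset.mem_Ico] at hk
      refine Set.indicator_of_mem (fun hkA => ?_) _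
      have := hn.trans (h k hk.1 hkA)
      rw [Nat.cast_le] at this
      omega
  calc (n : ℝ≥0∞) ≤ ((T + (n - T) : ℕ) : ℝ≥0∞) := by exact_mod_cast (by omega)
    _ = T + ((n - T : ℕ) : ℝ≥0∞) := by push_cast; rfl
    _ ≤ _ := by gcongr

/-- A bound for the expectation of a stopping time in terms of a sharp time `T₀`, which may fail on a
small event, and a crude time `T₁`. -/
theorem lintegral_enat_le {Ω : Type*} [MeasurableSpace Ω] {P : Measure Ω} [IsProbabilityMeasure P]
    {τ : Ω → ℕ∞} {T₀ T₁ : ℕ} {A : ℕ → Set Ω} {B : Set Ω} (hA : ∀ n, MeasurableSet (A n))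
    (hB : MeasurableSet B) (hτB : ∀ ω ∈ B, τ ω ≤ T₀)
    (hτA : ∀ n, T₁ ≤ n → ∀ ω ∈ A n, τ ω ≤ n) :
    ∫⁻ ω, (τ ω : ℝ≥0∞) ∂P ≤ T₀ + T₁ * P Bᶜ + ∑' n, P (A n)ᶜ := by
  have hind : ∀ s : Set Ω, MeasurableSet s → Measurable (s.indicator (1 : Ω → ℝ≥0∞)) :=
    fun s hs => measurable_one.indicator hs
  calc ∫⁻ ω, (τ ω : ℝ≥0∞) ∂P
      ≤ ∫⁻ ω, ((T₀ + T₁ * Bᶜ.indicator 1 ω) + ∑' n, (A n)ᶜ.indicator 1 ω) ∂P := by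
        refine lintegral_mono fun ω => ?_
        by_cases hω : ω ∈ B
        · have : (τ ω : ℝ≥0∞) ≤ T₀ := by exact_mod_cast hτB ω hω
          exact this.trans (le_self_add.trans le_self_add)
        · rw [Set.indicator_of_mem (show ω ∈ Bᶜ from hω), Pi.one_apply, mul_one]
          refine (enat_coe_le_add_tsum fun n hn hωn => hτA n hn ω hωn).trans ?_
          gcongr
          exact le_add_self
    _ = _ := by
        rw [lintegral_add_right _ (Measurable.tsum fun n => hind _ (hA n).compl),
          lintegral_add_left measurable_const, lintegral_const_mul _ (hind _ hB.compl),
          lintegral_tsum fun n => (hind _ (hA n).compl).aemeasurable, lintegral_indicator_one hB.compl]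
        simp [lintegral_indicator_one (hA _).compl]

theorem tendsto_log_one_div : Tendsto (fun δ : ℝ => Real.log (1 / δ)) (𝓝[>] 0) atTop := by
  simp only [one_div]
  exact Real.tendsto_log_atTop.comp tendsto_inv_nhdsGT_zero

/-- On the sharp event τ is at most C log(1/δ) + O(1). Off it, the crude time of order log(1/δ) is
weighted by a probability tending to 0, and the remaining tail sum does not depend on δ. Letting `C`
decrease to the constant is left for afterwards. -/
theorem limsup_expectedTime_le_of_lt (hN : 1 ≤ N) (hσ : 0 < σ)
    (htie : ∀ (t : ℕ) (s : Finset ℕ), s.Nonempty → tie t s ∈ s) {m : ℕ} (hm : N ≤ m)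
    (hμ : μ ∈ Env K m) {C : ℝ}
    (hC : 8 * σ ^ 2 * ∑ i ∈ Finset.Icc 1 N, 1 / orderedChange K μ i ^ 2 < C) :
    limsup (fun δ : ℝ => (mcpi K N σ tie δ).expectedTime σ μ / ENNReal.ofReal (Real.log (1 / δ)))
      (𝓝[>] (0 : ℝ)) ≤ ENNReal.ofReal C := by
  obtain ⟨hNK, hK⟩ := two_le_of_env hN hm hμ
  have hC0 : 0 < C := lt_of_le_of_lt (by positivity) hC
  obtain ⟨C₁, hC₁, A, hA, hAs, T₁, hT₁⟩ := exists_crude_bound hN hσ htie hm hμ hK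
  obtain ⟨B, hB, hBlim, T₀, hT₀⟩ := exists_sharp_bound hN hσ htie hm hμ hK hC
  set s := ∑' T, (stackLaw σ).real (A T)ᶜ with hs
  have hs0 : 0 ≤ s := tsum_nonneg fun _ => measureReal_nonneg
  let x : ℝ → ℝ := fun δ => Real.log (1 / δ)
  let t : ℝ → ℕ := fun δ => T₀ + ⌈C * x δ⌉₊
  let p : ℝ → ℝ := fun δ => (stackLaw σ).real (B (t δ))ᶜ
  let R : ℝ → ℝ := fun δ => C + (1 + T₀) * (x δ)⁻¹ + (C₁ + (1 + T₁) * (x δ)⁻¹) * p δ + s * (x δ)⁻¹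
  have hx : Tendsto x (𝓝[>] 0) atTop := tendsto_log_one_div
  have ht : Tendsto t (𝓝[>] 0) atTop := tendsto_atTop_mono (fun δ => Nat.le_add_left _ _)
    (tendsto_nat_ceil_atTop.comp (hx.const_mul_atTop hC0))
  have hxi : Tendsto (fun δ => (x δ)⁻¹) (𝓝[>] 0) (𝓝 0) := tendsto_inv_atTop_zero.comp hx
  have hR : Tendsto R (𝓝[>] 0) (𝓝 C) := by
    have hp : Tendsto p (𝓝[>] 0) (𝓝 0) := hBlim.comp ht
    have := (((hxi.const_mul (1 + T₀ : ℝ)).const_add C).add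
      (((hxi.const_mul (1 + T₁ : ℝ)).const_add C₁).mul hp)).add (hxi.const_mul s)
    simpa using this
  rw [← (ENNReal.tendsto_ofReal hR).limsup_eq]
  refine limsup_le_limsup ?_
  filter_upwards [Ioo_mem_nhdsGT (show (0 : ℝ) < 1 by norm_num)] with δ ⟨hδ, hδ1⟩
  have hx0 : 0 < x δ := Real.log_pos (by rw [lt_div_iff₀ hδ]; linarith)
  have hp0 : 0 ≤ p δ := measureReal_nonneg
  rw [ENNReal.div_le_iff (ENNReal.ofReal_pos.2 hx0).ne' ENNReal.ofReal_ne_top,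
    ← ENNReal.ofReal_mul' hx0.le]
  set π := mcpi K N σ tie δ
  -- An inequality suffices here, and it does not need measurability of the stopping time.
  have h1 : π.expectedTime σ μ ≤ ∫⁻ X, (π.stoppingTime μ (stackNoise π μ X) : ℝ≥0∞) ∂(stackLaw σ) := by
    rw [Policy.expectedTime, ← map_stackNoise K N σ tie δ μ]
    exact lintegral_map_le _ _
  have h2 := lintegral_enat_le (P := stackLaw σ) (τ := fun X => π.stoppingTime μ (stackNoise π μ X))
    (T₀ := t δ) (T₁ := T₁ + ⌈C₁ * x δ⌉₊) hA (hB (t δ))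
    (fun X hX => stoppingTime_stackNoise_le htie hNK
      (hT₀ (t δ) (Nat.le_add_right _ _) δ hδ hδ1 (mul_le_add_ceil _ _ _) X hX))
    fun n hn X hX => stoppingTime_stackNoise_le htie hNK
      (hT₁ n (by omega) δ hδ hδ1 ((mul_le_add_ceil C₁ (x δ) T₁).trans (by exact_mod_cast hn)) X hX)
  refine h1.trans (h2.trans ?_)
  have e1 : ∑' n, stackLaw σ (A n)ᶜ = ENNReal.ofReal s := by
    rw [hs, ENNReal.ofReal_tsum_of_nonneg (fun _ => measureReal_nonneg) hAs]
    simp [measureReal_def, ENNReal.ofReal_toReal]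
  have e2 : stackLaw σ (B (t δ))ᶜ = ENNReal.ofReal (p δ) := by
    simp [p, measureReal_def, ENNReal.ofReal_toReal]
  rw [e1, e2, ← ENNReal.ofReal_natCast, ← ENNReal.ofReal_natCast, ← ENNReal.ofReal_mul (by positivity),
    ← ENNReal.ofReal_add (by positivity) (by positivity),
    ← ENNReal.ofReal_add (by positivity) hs0]
  refine ENNReal.ofReal_le_ofReal ?_
  have e3 : R δ * x δ = (T₀ + (C * x δ + 1)) + (T₁ + (C₁ * x δ + 1)) * p δ + s := by
    simp only [R]
    field_simp
    ring
  rw [e3]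
  simp only [t]
  push_cast
  gcongr
  · exact (Nat.ceil_lt_add_one (by positivity)).le
  · exact (Nat.ceil_lt_add_one (by positivity)).le

theorem limsup_expectedTime_le (hN : 1 ≤ N) (hσ : 0 < σ)
    (htie : ∀ (t : ℕ) (s : Finset ℕ), s.Nonempty → tie t s ∈ s) {m : ℕ} (hm : N ≤ m)
    (hμ : μ ∈ Env K m) :
    limsup (fun δ : ℝ => (mcpi K N σ tie δ).expectedTime σ μ / ENNReal.ofReal (Real.log (1 / δ)))
      (𝓝[>] (0 : ℝ)) ≤ ENNReal.ofReal
        (8 * σ ^ 2 * ∑ i ∈ Finset.Icc 1 N, 1 / orderedChange K μ i ^ 2) := by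
  refine ge_of_tendsto ((ENNReal.continuous_ofReal.tendsto _).mono_left
    (nhdsWithin_le_nhds (s := Set.Ioi (8 * σ ^ 2 * ∑ i ∈ Finset.Icc 1 N,
      1 / orderedChange K μ i ^ 2)))) ?_
  filter_upwards [self_mem_nhdsWithin] with C hC
  exact limsup_expectedTime_le_of_lt hN hσ htie hm hμ hC

theorem isAny_mcpi (hN : 1 ≤ N) (hσ : 0 < σ)
    (htie : ∀ (t : ℕ) (s : Finset ℕ), s.Nonempty → tie t s ∈ s) (hδ : 0 < δ) (hδ1 : δ < 1) :
    (mcpi K N σ tie δ).IsAny K σ N δ := by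
  intro m hm μ hμ
  have hfin := ae_stoppingTime_lt_top hN hσ htie hm hμ hδ hδ1
  exact ⟨hfin.mono fun _ => card_output,
    output_subset_probability hN hσ htie hδ hδ1 (two_le_of_env hN hm hμ).1 μ, hfin⟩

/-- With exactly `N` change points, a subset of size `N` is the whole set. -/
theorem Policy.IsAny.isExact {π : Policy} (h : π.IsAny K σ N δ) : π.IsExact K σ N δ := by
  intro μ hμ
  obtain ⟨h1, h2, h3⟩ := h N le_rfl μ hμ
  refine ⟨h2.trans_le (ENNReal.toReal_mono (measure_ne_top _ _) (measure_mono_ae ?_)), h3⟩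
  filter_upwards [h1] with ε hε hsub
  exact Finset.eq_of_subset_of_card_le hsub (hμ.1.trans hε.symm).le

end StoppingTime

end PiecewiseBandit

theorem mainTheorem1 (K N : ℕ) (hN : 1 ≤ N) (σ : ℝ) (hσ : 0 < σ)
    (tie : ℕ → Finset ℕ → ℕ)
    (htie : ∀ (t : ℕ) (s : Finset ℕ), s.Nonempty → tie t s ∈ s) :
    (∀ δ : ℝ, 0 < δ → δ < 1 →
      (PiecewiseBandit.mcpi K N σ tie δ).IsExact K σ N δ ∧
      (PiecewiseBandit.mcpi K N σ tie δ).IsAny K σ N δ) ∧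
    ∀ m : ℕ, N ≤ m → ∀ μ ∈ PiecewiseBandit.Env K m,
      limsup
        (fun δ : ℝ =>
          (PiecewiseBandit.mcpi K N σ tie δ).expectedTime σ μ / ENNReal.ofReal (Real.log (1 / δ)))
        (𝓝[>] (0 : ℝ))
      ≤ ENNReal.ofReal
          (8 * σ ^ 2 * ∑ i ∈ Finset.Icc 1 N, 1 / PiecewiseBandit.orderedChange K μ i ^ 2) := by
  refine ⟨fun δ hδ hδ1 => ?_, fun m hm μ hμ =>
    PiecewiseBandit.limsup_expectedTime_le hN hσ htie hm hμ⟩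
  have h := PiecewiseBandit.isAny_mcpi (K := K) hN hσ htie hδ hδ1
  exact ⟨h.isExact, h⟩
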